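/- Let $G\rightrightarrows M$ be a Lie groupoid with compact unit manifold $M$ (all manifolds being smooth, Hausdorff, finite-dimensional and without boundary), with range and source $r,s:G\to M$, identity section $\upsilon:M\to G$, inversion $\iota$ and multiplication $m$ defined on $\{(\gamma_1,\gamma_2): s(\gamma_1)=r(\gamma_2)\}$. Let $AG=\ker ds|_M$ be its Lie algebroid, $A^*G\to M$ the dual bundle, and let $\Gamma=T^*G\rightrightarrows A^*G$ be the cotangent groupoid, with $$r_\Gamma(\gamma,\xi)=\big(r(\gamma),\ \xi\circ dR_\gamma|_{A_{r(\gamma)}G}\big),\qquad s_\Gamma(\gamma,\xi)=\big(s(\gamma),\ -\xi\circ d(L_\gamma\circ\iota)|_{A_{s(\gamma)}G}\big),$$ where $R_\gamma,L_\gamma$ are right and left multiplication by $\gamma$, and, when $s_\Gamma(\gamma_1,\xi_1)=r_\Gamma(\gamma_2,\xi_2)$, with product $(\gamma_1,\xi_1)(\gamma_2,\xi_2)=(\gamma_1\gamma_2,\xi)$, where $\xi(dm(t_1,t_2))=\xi_1(t_1)+\xi_2(t_2)$ whenever $ds(t_1)=dr(t_2)$. The units of $\Gamma$ are identified with $A^*G$: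 $(x,\xi)\in A^*G$ is identified with the covector at $\upsilon(x)$ that extends $\xi$ by zero on $d\upsilon(T_xM)$. Let $$T^*_{\bullet}G=T^*G\setminus\ker r_\Gamma=\{\delta\in T^*G : r_\Gamma(\delta)\notin 0_M\},$$ where $0_M$ denotes the zero section of $A^*G$. Let $p^0_0:A^*G\setminus 0\to\mathbb R$ be smooth and positively homogeneous of degree one in the fibres (for instance the principal symbol of a symmetric elliptic first-order pseudodifferential $G$-operator), put $p^0=p^0_0\circ r_\Gamma$ on $T^*_{\bullet}G$, and let $H_{p^0}$ be its Hamiltonian vector field, defined by $dp^0=\omega(H_{p^0},\cdot)$ with $\omega=\sum_j d\gamma_j\wedge d\xi_j$ the canonical symplectic form of $T^*G$. Then the flow $\chi$ of $H_{p^0}$ on $T^*_{\bullet}G$ satisfies: 1. It is complete: every maximal integral curve of $H_{p^0}$ in $T^*_{\bullet}G$ is defined on all of $\mathbb R$. 2. It commutes with positive dilations: for all $a>0$, $t\in\mathbb R$ and $(\gamma,\xi)\in T^*_{\bullet}G$, one has $a\cdot\chi(t,\gamma,\xi)=\chi(t,\gamma,a\xi)$, where $a\cdot(\gamma,\eta)=(\gamma,a\eta)$.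 3. It provides at each time $t$ a section of $s_\Gamma$, that is $s_\Gamma(\chi(t,u))=u$ for every $u\in A^*G\setminus 0\subset T^*_{\bullet}G$; more generally $s_\Gamma(\chi(t,\delta))=s_\Gamma(\delta)$ for every $\delta\in T^*_{\bullet}G$; and $\chi$ commutes with right multiplication: for every $t\in\mathbb R$ and every composable pair $(\delta_1,\delta_2)\in\Gamma^{(2)}$ with $\delta_1\in T^*_{\bullet}G$, one has $\delta_1\delta_2\in T^*_{\bullet}G$ and $\chi(t,\delta_1\delta_2)=\chi(t,\delta_1)\,\delta_2$. In particular every integral curve of $H_{p^0}$ in $T^*_{\bullet}G$ lies in a single fibre of $s_\Gamma$. -/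

import Mathlib

open Set Bundle
open scoped Manifold ContDiff

noncomputable section

/-! ### Lie groupoids -/

/-- A Lie groupoid `G ⇉ M`: range `r` and source `s` are surjective submersions, `unit` is a common
section of both. The product `mul γ₁ γ₂` is meaningful only on the set of composable pairs
`{(γ₁, γ₂) | s γ₁ = r γ₂}`, a closed embedded submanifold of `G × G`; its values elsewhere are
irrelevant, and only its smoothness on that submanifold is required. -/
structure LieGroupoid (E B G M : Type*)
    [NormedAddCommGroup E] [NormedSpace ℝ E] [NormedAddCommGroup B] [NormedSpace ℝ B]
    [TopologicalSpace G] [ChartedSpace E G] [TopologicalSpace M] [ChartedSpace B M] where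
  r : C^∞⟮𝓘(ℝ, E), G; 𝓘(ℝ, B), M⟯
  s : C^∞⟮𝓘(ℝ, E), G; 𝓘(ℝ, B), M⟯
  unit : C^∞⟮𝓘(ℝ, B), M; 𝓘(ℝ, E), G⟯
  inv : C^∞⟮𝓘(ℝ, E), G; 𝓘(ℝ, E), G⟯
  mul : G → G → G
  mul_smooth : ContMDiffOn (𝓘(ℝ, E).prod 𝓘(ℝ, E)) 𝓘(ℝ, E) ∞
    (fun p : G × G => mul p.1 p.2) {p | s p.1 = r p.2}
  r_submersion : ∀ γ, Function.Surjective (mfderiv 𝓘(ℝ, E) 𝓘(ℝ, B) r γ)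
  s_submersion : ∀ γ, Function.Surjective (mfderiv 𝓘(ℝ, E) 𝓘(ℝ, B) s γ)
  r_unit : ∀ x, r (unit x) = x
  s_unit : ∀ x, s (unit x) = x
  r_mul : ∀ γ₁ γ₂, s γ₁ = r γ₂ → r (mul γ₁ γ₂) = r γ₁
  s_mul : ∀ γ₁ γ₂, s γ₁ = r γ₂ → s (mul γ₁ γ₂) = s γ₂
  unit_mul : ∀ γ, mul (unit (r γ)) γ = γ
  mul_unit : ∀ γ, mul γ (unit (s γ)) = γ
  r_inv : ∀ γ, r (inv γ) = s γ
  s_inv : ∀ γ, s (inv γ) = r γ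
  mul_inv : ∀ γ, mul γ (inv γ) = unit (r γ)
  inv_mul : ∀ γ, mul (inv γ) γ = unit (s γ)
  mul_assoc : ∀ γ₁ γ₂ γ₃, s γ₁ = r γ₂ → s γ₂ = r γ₃ →
    mul (mul γ₁ γ₂) γ₃ = mul γ₁ (mul γ₂ γ₃)

/-! ### The cotangent bundle and its canonical symplectic form -/

section Cotangent

variable (E : Type*) [NormedAddCommGroup E] [NormedSpace ℝ E]
  (G : Type*) [TopologicalSpace G] [ChartedSpace E G] [IsManifold 𝓘(ℝ, E) ∞ G]

/-- The cotangent bundle `T*G`, with the vector bundle and manifold structures of Mathlib. -/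
abbrev CotangentBundle : Type _ :=
  TotalSpace (E →L[ℝ] ℝ) (fun g : G => TangentSpace 𝓘(ℝ, E) g →L[ℝ] Trivial G ℝ g)

/-- The model with corners (without boundary) of `T*G`. -/
abbrev cotModel : ModelWithCorners ℝ (E × (E →L[ℝ] ℝ)) (ModelProd E (E →L[ℝ] ℝ)) :=
  𝓘(ℝ, E).prod 𝓘(ℝ, E →L[ℝ] ℝ)

variable {E G}

/-- The cotangent vector `(g, ξ)`. -/
abbrev cotMk (g : G) (ξ : TangentSpace 𝓘(ℝ, E) g →L[ℝ] ℝ) : CotangentBundle E G := ⟨g, ξ⟩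

/-- The linear form on `T_g G` underlying a point `(g, ξ)` of `T*G`. -/
abbrev cotForm (δ : CotangentBundle E G) : TangentSpace 𝓘(ℝ, E) δ.proj →L[ℝ] ℝ := δ.2

/-- The dilation `a · (g, ξ) = (g, a ξ)`. -/
def dilate (a : ℝ) (δ : CotangentBundle E G) : CotangentBundle E G :=
  cotMk δ.proj (a • cotForm δ)

/-- The Liouville one-form `θ_{(g, ξ)}(v) = ξ (dπ v)`, where `π : T*G → G`. -/
def liouville (δ : CotangentBundle E G) : TangentSpace (cotModel E) δ →L[ℝ] ℝ :=
  (cotForm δ).comp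
    (mfderiv (cotModel E) 𝓘(ℝ, E) (fun δ' : CotangentBundle E G => δ'.proj) δ)

/-- The pullback of the Liouville form to the model space by the inverse of the chart of `T*G`
at `δ₀`. -/
def liouvilleInChart (δ₀ : CotangentBundle E G) (z : E × (E →L[ℝ] ℝ)) :
    (E × (E →L[ℝ] ℝ)) →L[ℝ] ℝ :=
  (liouville ((extChartAt (cotModel E) δ₀).symm z)).comp
    (mfderiv 𝓘(ℝ, E × (E →L[ℝ] ℝ)) (cotModel E) (extChartAt (cotModel E) δ₀).symm z)

/-- The canonical symplectic form `ω = -dθ` of `T*G`; in canonical coordinates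
`ω = ∑ dγ_j ∧ dξ_j`. The exterior derivative is computed in the chart at `δ`, the one through which
Mathlib identifies the tangent space at `δ` with the model space. -/
def symplecticForm (δ : CotangentBundle E G) (u v : TangentSpace (cotModel E) δ) : ℝ :=
  -(fderiv ℝ (liouvilleInChart δ) (extChartAt (cotModel E) δ δ) u v
    - fderiv ℝ (liouvilleInChart δ) (extChartAt (cotModel E) δ δ) v u)

open Classical in
/-- The Hamiltonian vector field `H_p` of a function `p` on `T*G`: the unique vector with
`dp(v) = ω(H_p, v)` for every `v`. -/
def hamiltonianField (p : CotangentBundle E G → ℝ) (δ : CotangentBundle E G) :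
    TangentSpace (cotModel E) δ :=
  if h : ∃ X : TangentSpace (cotModel E) δ, ∀ v : TangentSpace (cotModel E) δ,
      mfderiv (cotModel E) 𝓘(ℝ, ℝ) p δ v = symplecticForm δ X v
  then h.choose else 0

end Cotangent

/-- `χ` is the flow of the vector field `X` on the open set `U`, and it is complete: every maximal
integral curve of `X` in `U` is defined on all of `ℝ`. That is, for `y ∈ U`, the curve `t ↦ χ t y`
is an integral curve that is defined on `ℝ`, starts at `y` and stays in `U`, and every integral
curve in `U` that starts at `y` is a restriction of it. -/
structure IsCompleteFlow {E H N : Type*} [NormedAddCommGroup E] [NormedSpace ℝ E]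
    [TopologicalSpace H] {I : ModelWithCorners ℝ E H} [TopologicalSpace N] [ChartedSpace H N]
    (X : (y : N) → TangentSpace I y) (U : Set N) (χ : ℝ → N → N) : Prop where
  zero : ∀ y ∈ U, χ 0 y = y
  mem : ∀ y ∈ U, ∀ t, χ t y ∈ U
  integralCurve : ∀ y ∈ U, IsMIntegralCurve (fun t => χ t y) X
  unique : ∀ y ∈ U, ∀ (J : Set ℝ) (c : ℝ → N), IsOpen J → J.OrdConnected → 0 ∈ J →
    IsMIntegralCurveOn c X J → MapsTo c J U → c 0 = y → ∀ t ∈ J, c t = χ t y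

/-! ### The cotangent groupoid `T*G ⇉ A*G` -/

namespace LieGroupoid

variable {E B G M : Type*}
  [NormedAddCommGroup E] [NormedSpace ℝ E] [NormedAddCommGroup B] [NormedSpace ℝ B]
  [TopologicalSpace G] [ChartedSpace E G] [TopologicalSpace M] [ChartedSpace B M]
  (𝒢 : LieGroupoid E B G M)

/-- The fibre `A_x G = ker ds` at the unit of `x` of the Lie algebroid. -/
abbrev algebroid (x : M) : Submodule ℝ (TangentSpace 𝓘(ℝ, E) (𝒢.unit x)) :=
  (mfderiv 𝓘(ℝ, E) 𝓘(ℝ, B) 𝒢.s (𝒢.unit x)).ker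

/-- The dual `A*G` of the Lie algebroid; its points are the pairs `⟨x, ξ⟩` with `ξ ∈ (A_x G)*`. -/
abbrev DualAlgebroid : Type _ := Σ x : M, (𝒢.algebroid x →L[ℝ] ℝ)

/-- The projection `v ↦ v - dυ (ds v)` of the tangent space of `G` at the unit of `x`, where `υ` is
the unit map. -/
def unitProj (x : M) :
    TangentSpace 𝓘(ℝ, E) (𝒢.unit x) →L[ℝ] TangentSpace 𝓘(ℝ, E) (𝒢.unit x) :=
  ContinuousLinearMap.id ℝ _ -
    (mfderiv 𝓘(ℝ, B) 𝓘(ℝ, E) 𝒢.unit x).comp (mfderiv 𝓘(ℝ, E) 𝓘(ℝ, B) 𝒢.s (𝒢.unit x))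

theorem unitProj_mem (x : M) (v : TangentSpace 𝓘(ℝ, E) (𝒢.unit x)) :
    𝒢.unitProj x v ∈ 𝒢.algebroid x := by
  have h1 : mfderiv 𝓘(ℝ, B) 𝓘(ℝ, B) (𝒢.s ∘ 𝒢.unit) x =
      (mfderiv 𝓘(ℝ, E) 𝓘(ℝ, B) 𝒢.s (𝒢.unit x)).comp (mfderiv 𝓘(ℝ, B) 𝓘(ℝ, E) 𝒢.unit x) :=
    mfderiv_comp x (𝒢.s.contMDiff.mdifferentiableAt (by simp))
      (𝒢.unit.contMDiff.mdifferentiableAt (by simp))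
  have h2 : (𝒢.s ∘ 𝒢.unit : M → M) = id := funext 𝒢.s_unit
  rw [h2, mfderiv_id] at h1
  have h3 := DFunLike.congr_fun h1 (mfderiv 𝓘(ℝ, E) 𝓘(ℝ, B) 𝒢.s (𝒢.unit x) v)
  refine LinearMap.mem_ker.2 ?_
  refine (map_sub (mfderiv 𝓘(ℝ, E) 𝓘(ℝ, B) 𝒢.s (𝒢.unit x)) v _).trans ?_
  exact sub_eq_zero.2 h3

variable [IsManifold 𝓘(ℝ, E) ∞ G]

/-- The pullback to `M` of `T*G` along the unit map. -/
abbrev UnitCotangentBundle : Type _ :=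
  TotalSpace (E →L[ℝ] ℝ)
    (𝒢.unit *ᵖ (fun g : G => TangentSpace 𝓘(ℝ, E) g →L[ℝ] Trivial G ℝ g))

/-- The restriction `(x, η) ↦ (x, η|_{A_x G})` of linear forms on `T_x G` to `A_x G`. It exhibits
`A*G` as a quotient of the vector bundle `T*G|_M`, and it is a surjective submersion. -/
def restrict (q : 𝒢.UnitCotangentBundle) : 𝒢.DualAlgebroid :=
  ⟨q.proj, (show TangentSpace 𝓘(ℝ, E) (𝒢.unit q.proj) →L[ℝ] ℝ from q.2).comp
    (𝒢.algebroid q.proj).subtypeL⟩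

/-- `f` is smooth on `A*G ∖ 0`, for the smooth structure of `A*G` as a quotient bundle of `T*G|_M`:
its composition with the surjective submersion `T*G|_M → A*G` is smooth. -/
def SmoothOffZero (f : 𝒢.DualAlgebroid → ℝ) : Prop :=
  ContMDiffOn (𝓘(ℝ, B).prod 𝓘(ℝ, E →L[ℝ] ℝ)) 𝓘(ℝ, ℝ) ∞
    (fun q => f (𝒢.restrict q)) {q | (𝒢.restrict q).2 ≠ 0}

/-- `f` is positively homogeneous of degree one on `A*G ∖ 0`. -/
def HomogeneousOffZero (f : 𝒢.DualAlgebroid → ℝ) : Prop :=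
  ∀ (x : M) (ξ : 𝒢.algebroid x →L[ℝ] ℝ) (a : ℝ), ξ ≠ 0 → 0 < a → f ⟨x, a • ξ⟩ = a * f ⟨x, ξ⟩

/-- The differential at the unit of `r γ` of the right multiplication
`R_γ : G_{r γ} → G_{s γ}, α ↦ α γ` between fibres of `s`, meaningful on
`A_{r γ} G = ker ds`, the tangent space of the fibre. -/
def dRight (γ : G) :
    TangentSpace 𝓘(ℝ, E) (𝒢.unit (𝒢.r γ)) →L[ℝ] TangentSpace 𝓘(ℝ, E) γ :=
  mfderivWithin 𝓘(ℝ, E) 𝓘(ℝ, E) (fun α => 𝒢.mul α γ) {α | 𝒢.s α = 𝒢.r γ} (𝒢.unit (𝒢.r γ))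

/-- The differential at the unit of `s γ` of `L_γ ∘ ι : G_{s γ} → G^{r γ}, α ↦ γ α⁻¹`, meaningful
on `A_{s γ} G = ker ds`, the tangent space of the fibre. -/
def dLeftInv (γ : G) :
    TangentSpace 𝓘(ℝ, E) (𝒢.unit (𝒢.s γ)) →L[ℝ] TangentSpace 𝓘(ℝ, E) γ :=
  mfderivWithin 𝓘(ℝ, E) 𝓘(ℝ, E) (fun α => 𝒢.mul γ (𝒢.inv α)) {α | 𝒢.s α = 𝒢.s γ}
    (𝒢.unit (𝒢.s γ))

/-- The range map `r_Γ(γ, ξ) = (r γ, ξ ∘ dR_γ)` of the cotangent groupoid. -/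
def rCot (δ : CotangentBundle E G) : 𝒢.DualAlgebroid :=
  ⟨𝒢.r δ.proj, ((cotForm δ).comp (𝒢.dRight δ.proj)).comp (𝒢.algebroid (𝒢.r δ.proj)).subtypeL⟩

/-- The source map `s_Γ(γ, ξ) = (s γ, -ξ ∘ d(L_γ ∘ ι))` of the cotangent groupoid. -/
def sCot (δ : CotangentBundle E G) : 𝒢.DualAlgebroid :=
  ⟨𝒢.s δ.proj, -((cotForm δ).comp (𝒢.dLeftInv δ.proj)).comp (𝒢.algebroid (𝒢.s δ.proj)).subtypeL⟩

/-- The differential at the composable pair `(γ₁, γ₂)` of the multiplication, meaningful on the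
tangent space `{(t₁, t₂) | ds t₁ = dr t₂}` of the manifold of composable pairs. -/
def dMul (γ₁ γ₂ : G) (t₁ : TangentSpace 𝓘(ℝ, E) γ₁) (t₂ : TangentSpace 𝓘(ℝ, E) γ₂) :
    TangentSpace 𝓘(ℝ, E) (𝒢.mul γ₁ γ₂) :=
  (mfderivWithin (𝓘(ℝ, E).prod 𝓘(ℝ, E)) 𝓘(ℝ, E) (fun p : G × G => 𝒢.mul p.1 p.2)
    {p | 𝒢.s p.1 = 𝒢.r p.2} (γ₁, γ₂) : E × E →L[ℝ] E) (t₁, t₂)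

/-- The defining property of the linear form `ξ` of a product `δ₁ δ₂ = (γ₁ γ₂, ξ)` in the cotangent
groupoid: `ξ (dm (t₁, t₂)) = ξ₁ t₁ + ξ₂ t₂`. -/
def IsProductForm (δ₁ δ₂ : CotangentBundle E G)
    (ξ : TangentSpace 𝓘(ℝ, E) (𝒢.mul δ₁.proj δ₂.proj) →L[ℝ] ℝ) : Prop :=
  ∀ (t₁ : TangentSpace 𝓘(ℝ, E) δ₁.proj) (t₂ : TangentSpace 𝓘(ℝ, E) δ₂.proj),
    (mfderiv 𝓘(ℝ, E) 𝓘(ℝ, B) 𝒢.s δ₁.proj t₁ : B) = mfderiv 𝓘(ℝ, E) 𝓘(ℝ, B) 𝒢.r δ₂.proj t₂ →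
      ξ (𝒢.dMul δ₁.proj δ₂.proj t₁ t₂) = cotForm δ₁ t₁ + cotForm δ₂ t₂

open Classical in
/-- The product of the cotangent groupoid, meaningful when `s_Γ δ₁ = r_Γ δ₂`: there is then exactly
one linear form with the defining property. -/
def mulCot (δ₁ δ₂ : CotangentBundle E G) : CotangentBundle E G :=
  cotMk (𝒢.mul δ₁.proj δ₂.proj)
    (if h : ∃ ξ, 𝒢.IsProductForm δ₁ δ₂ ξ then h.choose else 0)

/-- The inclusion `A*G → T*G` of the units of the cotangent groupoid: a form on `A_x G` is extended
by zero on the tangent space of `M`, which is a complement of `A_x G` in `T_x G`. -/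
def unitCot (a : 𝒢.DualAlgebroid) : CotangentBundle E G :=
  cotMk (𝒢.unit a.1)
    (a.2.comp ((𝒢.unitProj a.1).codRestrict (𝒢.algebroid a.1) (𝒢.unitProj_mem a.1)))

/-- The open subset `T*G ∖ ker r_Γ` of `T*G`. -/
def domCot : Set (CotangentBundle E G) := {δ | (𝒢.rCot δ).2 ≠ 0}

end LieGroupoid

end

open scoped Topology

/-! Two families of maps of `T*G` preserve the Hamiltonian field of `p = p₀ ∘ rCot`. A dilation by
`a > 0` multiplies both the Liouville form and `p` by `a`; the factors cancel, so the field is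
preserved without change of time. A right translation by a local bisection lifts to `T*G`, where one
may also add the differential of a function pulled back along `s`; this changes the Liouville form
by an exact form and leaves `rCot`, hence `p`, unchanged. Both are instances of `cotPull`, and
`mfderiv_cotPull_hamiltonianField` gives the invariance: from `Φ*θ = aθ + dh` and `p ∘ Φ = a p`
follows `dΦ(H_p) = H_p ∘ Φ`.

Right multiplication by `δ₂` is defined only on the set `sCot = rCot δ₂`, which need not be open.
There it agrees with a lifted right translation defined on an open set
(`IsBisection.mulCot_eq_cotPull`): the bisection passes through the base point of `δ₂`, and the
exact correction carries the values of `δ₂` on the tangent space of the bisection. So an integral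
curve multiplied on the right by `δ₂` is again an integral curve, provided that it stays in one
fibre of `sCot`.

This proviso is Noether's theorem (`sCot_eq_of_isTangentAt`). Adding to a covector a form that
vanishes on `ker ds` does not change `p`, so by Hamilton's equations the base curve stays in a fibre
of `s`. Moreover `p` is invariant under lifted right translations, and their momenta, the numbers `ξ
(dLeftInv γ v)`, are up to sign the components of `sCot`; they are therefore conserved.

Completeness follows from a uniform lifespan (`exists_isCompleteFlow`). Since `δ = unitCot (rCot δ)
· δ`, a lifespan valid at the nonzero units is valid everywhere (`hasCurveOn_mulCot`). At the units,
dilations reduce the question to covectors of norm one in coordinates, and compactness of their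
sphere and of `M` gives a common time (`exists_forall_hasCurveOn_unitCot`). The stated symmetries of
the flow are then instances of uniqueness of integral curves. -/

noncomputable section

/-! ### Canonical coordinates of `T*G` and the symplectic form in them. -/

section CotangentCharts
variable {E : Type*} [NormedAddCommGroup E] [NormedSpace ℝ E]
  {G : Type*} [TopologicalSpace G] [ChartedSpace E G] [IsManifold 𝓘(ℝ, E) ∞ G]

/-- This makes the hom-bundle trivialization explicit, and every later coordinate computation rests
on it: the fibre coordinate of a covector is its pullback by the inverse chart of `G`. -/
theorem cot_trivializationAt_snd (γ₀ : G) (δ : CotangentBundle E G)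
    (h : δ.proj ∈ (chartAt E γ₀).source) :
    (trivializationAt (E →L[ℝ] ℝ)
      (fun g : G => TangentSpace 𝓘(ℝ, E) g →L[ℝ] Trivial G ℝ g) γ₀ δ).2 =
    ((cotForm δ).comp (mfderiv 𝓘(ℝ, E) 𝓘(ℝ, E) (extChartAt 𝓘(ℝ, E) γ₀).symm
      (extChartAt 𝓘(ℝ, E) γ₀ δ.proj)) : E →L[ℝ] ℝ) := by
  have h1 := TangentBundle.symmL_trivializationAt (I := 𝓘(ℝ, E)) h
  simp only [modelWithCornersSelf_coe, Set.range_id, mfderivWithin_univ] at h1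
  have h2 := hom_trivializationAt_apply (σ := RingHom.id ℝ) (F₁ := E)
    (E₁ := (TangentSpace 𝓘(ℝ, E) : G → Type _)) (F₂ := ℝ) (E₂ := Trivial G ℝ) γ₀ δ
  rw [h2, ContinuousLinearMap.inCoordinates]
  erw [h1, Trivial.continuousLinearMapAt_trivialization]
  rfl

theorem cot_extChartAt_apply (δ₀ δ : CotangentBundle E G)
    (h : δ.proj ∈ (chartAt E δ₀.proj).source) :
    extChartAt (cotModel E) δ₀ δ = (extChartAt 𝓘(ℝ, E) δ₀.proj δ.proj,
      ((cotForm δ).comp (mfderiv 𝓘(ℝ, E) 𝓘(ℝ, E) (extChartAt 𝓘(ℝ, E) δ₀.proj).symm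
        (extChartAt 𝓘(ℝ, E) δ₀.proj δ.proj)) : E →L[ℝ] ℝ)) := by
  rw [← cot_trivializationAt_snd _ _ h, FiberBundle.extChartAt]
  rfl

theorem cot_extChartAt_source (δ₀ : CotangentBundle E G) :
    (extChartAt (cotModel E) δ₀).source = {δ | δ.proj ∈ (chartAt E δ₀.proj).source} := by
  rw [extChartAt_source, FiberBundle.chartedSpace_chartAt]
  ext δ
  have h : (trivializationAt (E →L[ℝ] ℝ)
      (fun g : G => TangentSpace 𝓘(ℝ, E) g →L[ℝ] Trivial G ℝ g) δ₀.proj δ).1 = δ.proj := rfl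
  simp [h]

theorem cot_extChartAt_target (δ₀ : CotangentBundle E G) :
    (extChartAt (cotModel E) δ₀).target = (extChartAt 𝓘(ℝ, E) δ₀.proj).target ×ˢ univ := by
  rw [FiberBundle.extChartAt_target]
  ext z
  simp only [hom_trivializationAt_baseSet, mem_prod, mem_inter_iff, mem_preimage, mem_univ,
    and_true, and_iff_left_iff_imp]
  intro h
  have h' := (extChartAt 𝓘(ℝ, E) δ₀.proj).map_target h
  rw [extChartAt_source] at h'
  exact ⟨h', trivial⟩

theorem cot_extChartAt_symm_proj (δ₀ : CotangentBundle E G) (z : E × (E →L[ℝ] ℝ))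
    (hz : z.1 ∈ (extChartAt 𝓘(ℝ, E) δ₀.proj).target) :
    ((extChartAt (cotModel E) δ₀).symm z).proj = (extChartAt 𝓘(ℝ, E) δ₀.proj).symm z.1 := by
  have hz' : z ∈ (extChartAt (cotModel E) δ₀).target := by
    rw [cot_extChartAt_target]; exact ⟨hz, trivial⟩
  have h1 := (extChartAt (cotModel E) δ₀).map_target hz'
  have h2 := (extChartAt (cotModel E) δ₀).right_inv hz'
  rw [cot_extChartAt_source] at h1
  rw [cot_extChartAt_apply _ _ h1] at h2
  rw [← (congrArg Prod.fst h2 : _ = z.1), (extChartAt 𝓘(ℝ, E) δ₀.proj).left_inv]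
  rw [extChartAt_source]; exact h1

theorem cot_extChartAt_symm_form (δ₀ : CotangentBundle E G) (z : E × (E →L[ℝ] ℝ))
    (hz : z.1 ∈ (extChartAt 𝓘(ℝ, E) δ₀.proj).target) (u : E) :
    cotForm ((extChartAt (cotModel E) δ₀).symm z)
      (mfderiv 𝓘(ℝ, E) 𝓘(ℝ, E) (extChartAt 𝓘(ℝ, E) δ₀.proj).symm z.1 u : E) = z.2 u := by
  have hz' : z ∈ (extChartAt (cotModel E) δ₀).target := by
    rw [cot_extChartAt_target]; exact ⟨hz, trivial⟩
  have h1 := (extChartAt (cotModel E) δ₀).map_target hz'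
  have h2 := (extChartAt (cotModel E) δ₀).right_inv hz'
  rw [cot_extChartAt_source] at h1
  rw [cot_extChartAt_apply _ _ h1] at h2
  have h3 := congrArg Prod.fst h2
  have h4 := DFunLike.congr_fun (congrArg Prod.snd h2) u
  simp only at h3 h4
  rw [h3] at h4
  exact h4

theorem mdifferentiableAt_extChartAt_symm' {F N : Type*} [NormedAddCommGroup F] [NormedSpace ℝ F]
    {H : Type*} [TopologicalSpace H] {I : ModelWithCorners ℝ F H} [I.Boundaryless]
    [TopologicalSpace N] [ChartedSpace H N] [IsManifold I 1 N] {x : N} {z : F}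
    (hz : z ∈ (extChartAt I x).target) :
    MDifferentiableAt 𝓘(ℝ, F) I (extChartAt I x).symm z := by
  have := mdifferentiableWithinAt_extChartAt_symm (I := I) hz
  rwa [I.range_eq_univ, mdifferentiableWithinAt_univ] at this

theorem mfderiv_symm_comp_extChartAt {F N : Type*} [NormedAddCommGroup F] [NormedSpace ℝ F]
    {H : Type*} [TopologicalSpace H] {I : ModelWithCorners ℝ F H} [I.Boundaryless]
    [TopologicalSpace N] [ChartedSpace H N] [IsManifold I 1 N] {x y : N}
    (hy : y ∈ (extChartAt I x).source) (v : TangentSpace I y) :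
    (mfderiv 𝓘(ℝ, F) I (extChartAt I x).symm (extChartAt I x y)
      (mfderiv I 𝓘(ℝ, F) (extChartAt I x) y v) : F) = v := by
  have := mfderivWithin_extChartAt_symm_comp_mfderiv_extChartAt' hy
  rw [I.range_eq_univ, mfderivWithin_univ] at this
  exact DFunLike.congr_fun this v

/-- This is `θ = ξ dx`: in canonical coordinates the bundle projection is the first projection, and
the fibre coordinate is the covector pulled back by the inverse chart. -/
theorem liouvilleInChart_apply (δ₀ : CotangentBundle E G) {z : E × (E →L[ℝ] ℝ)}
    (hz : z.1 ∈ (extChartAt 𝓘(ℝ, E) δ₀.proj).target) (v : E × (E →L[ℝ] ℝ)) :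
    liouvilleInChart δ₀ z v = z.2 v.1 := by
  have hz' : z ∈ (extChartAt (cotModel E) δ₀).target := by
    rw [cot_extChartAt_target]; exact ⟨hz, trivial⟩
  have hd := mdifferentiableAt_extChartAt_symm' hz'
  have hπ : MDifferentiableAt (cotModel E) 𝓘(ℝ, E) (fun δ : CotangentBundle E G => δ.proj)
      ((extChartAt (cotModel E) δ₀).symm z) :=
    (Bundle.contMDiffAt_proj (n := 1) _).mdifferentiableAt one_ne_zero
  have h1 := mfderiv_comp z hπ hd
  have h2 : (fun δ : CotangentBundle E G => δ.proj) ∘ (extChartAt (cotModel E) δ₀).symm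
      =ᶠ[𝓝 z] (extChartAt 𝓘(ℝ, E) δ₀.proj).symm ∘ Prod.fst := by
    have : ∀ᶠ z' : E × (E →L[ℝ] ℝ) in 𝓝 z, z'.1 ∈ (extChartAt 𝓘(ℝ, E) δ₀.proj).target :=
      continuous_fst.continuousAt.eventually ((isOpen_extChartAt_target _).mem_nhds hz)
    filter_upwards [this] with z' hz'
    exact cot_extChartAt_symm_proj δ₀ z' hz'
  have h3 : mfderiv 𝓘(ℝ, E × (E →L[ℝ] ℝ)) 𝓘(ℝ, E)
      ((extChartAt 𝓘(ℝ, E) δ₀.proj).symm ∘ (Prod.fst : E × (E →L[ℝ] ℝ) → E)) z v =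
      mfderiv 𝓘(ℝ, E) 𝓘(ℝ, E) (extChartAt 𝓘(ℝ, E) δ₀.proj).symm z.1 v.1 := by
    have h4 := mfderiv_comp z (mdifferentiableAt_extChartAt_symm' hz)
      (mdifferentiableAt_iff_differentiableAt.2 (differentiableAt_fst (𝕜 := ℝ) (p := z)))
    rw [h4, mfderiv_eq_fderiv, fderiv_fst]
    rfl
  rw [h2.mfderiv_eq] at h1
  have h5 := DFunLike.congr_fun h1 v
  have h6 : (mfderiv (cotModel E) 𝓘(ℝ, E) (fun δ : CotangentBundle E G => δ.proj)
      ((extChartAt (cotModel E) δ₀).symm z)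
      (mfderiv 𝓘(ℝ, E × (E →L[ℝ] ℝ)) (cotModel E) (extChartAt (cotModel E) δ₀).symm z v) : E) =
      mfderiv 𝓘(ℝ, E) 𝓘(ℝ, E) (extChartAt 𝓘(ℝ, E) δ₀.proj).symm z.1 v.1 := h5.symm.trans h3
  exact (congrArg (fun w : E =>
    (cotForm ((extChartAt (cotModel E) δ₀).symm z) : E →L[ℝ] ℝ) w) h6).trans
    (cot_extChartAt_symm_form δ₀ z hz v.1)

theorem fderiv_liouvilleInChart (δ : CotangentBundle E G) (u v : E × (E →L[ℝ] ℝ)) :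
    fderiv ℝ (liouvilleInChart δ) (extChartAt (cotModel E) δ δ) u v = u.2 v.1 := by
  have h0 : (extChartAt (cotModel E) δ δ).1 ∈ (extChartAt 𝓘(ℝ, E) δ.proj).target := by
    have := mem_extChartAt_target (I := cotModel E) δ
    rw [cot_extChartAt_target] at this
    exact this.1
  have h1 : liouvilleInChart δ =ᶠ[𝓝 (extChartAt (cotModel E) δ δ)] fun z =>
      ((ContinuousLinearMap.compL ℝ (E × (E →L[ℝ] ℝ)) E ℝ).flip
        (ContinuousLinearMap.fst ℝ E (E →L[ℝ] ℝ))).comp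
        (ContinuousLinearMap.snd ℝ E (E →L[ℝ] ℝ)) z := by
    have : ∀ᶠ z' : E × (E →L[ℝ] ℝ) in 𝓝 (extChartAt (cotModel E) δ δ),
        z'.1 ∈ (extChartAt 𝓘(ℝ, E) δ.proj).target :=
      continuous_fst.continuousAt.eventually ((isOpen_extChartAt_target _).mem_nhds h0)
    filter_upwards [this] with z hz
    exact ContinuousLinearMap.ext fun v => liouvilleInChart_apply δ hz v
  rw [h1.fderiv_eq, ContinuousLinearMap.fderiv]
  rfl

/-- The standard symplectic form of `E × E*`. -/
theorem symplecticForm_apply (δ : CotangentBundle E G) (u v : TangentSpace (cotModel E) δ) :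
    symplecticForm δ u v =
      (v : E × (E →L[ℝ] ℝ)).2 (u : E × (E →L[ℝ] ℝ)).1 -
        (u : E × (E →L[ℝ] ℝ)).2 (v : E × (E →L[ℝ] ℝ)).1 := by
  rw [symplecticForm]
  erw [fderiv_liouvilleInChart δ u v, fderiv_liouvilleInChart δ v u]
  ring

end CotangentCharts

/-! ### Nondegeneracy, and a formula for the Hamiltonian field. -/

section Sharp

variable {E : Type*} [NormedAddCommGroup E] [NormedSpace ℝ E]

variable (E) in
/-- The standard symplectic form `ω((u, μ), (u', μ')) = μ' u - μ u'` of `E × E*`. -/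
def stdSymplectic : (E × (E →L[ℝ] ℝ)) →L[ℝ] (E × (E →L[ℝ] ℝ)) →L[ℝ] ℝ :=
  ((ContinuousLinearMap.compL ℝ (E × (E →L[ℝ] ℝ)) (E →L[ℝ] ℝ) ℝ).flip
      (ContinuousLinearMap.snd ℝ E (E →L[ℝ] ℝ))).comp
    ((ContinuousLinearMap.id ℝ (E →L[ℝ] ℝ)).flip.comp (ContinuousLinearMap.fst ℝ E (E →L[ℝ] ℝ))) -
  ((ContinuousLinearMap.compL ℝ (E × (E →L[ℝ] ℝ)) E ℝ).flip
      (ContinuousLinearMap.fst ℝ E (E →L[ℝ] ℝ))).comp (ContinuousLinearMap.snd ℝ E (E →L[ℝ] ℝ))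
theorem stdSymplectic_apply (X v : E × (E →L[ℝ] ℝ)) :
    stdSymplectic E X v = v.2 X.1 - X.2 v.1 := rfl

/-- Pairing with `(0, f)`, for a norming functional `f`, kills the first component of the
difference; pairing with `(u, 0)` kills the second. -/
theorem stdSymplectic_injective : Function.Injective (stdSymplectic E) := by
  intro Y Z hYZ
  have h (v : E × (E →L[ℝ] ℝ)) : v.2 (Y - Z).1 - (Y - Z).2 v.1 = 0 := by
    have := DFunLike.congr_fun hYZ v
    rw [stdSymplectic_apply, stdSymplectic_apply] at this
    simp only [Prod.fst_sub, Prod.snd_sub, map_sub, _root_.sub_apply]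
    linarith
  rw [← sub_eq_zero]
  generalize Y - Z = X at h
  have h1 : X.1 = 0 := by
    by_contra hne
    obtain ⟨f, -, hf⟩ := exists_dual_vector ℝ X.1 (norm_ne_zero_iff.2 hne)
    have := h (0, f)
    simp only [map_zero, sub_zero] at this
    rw [this] at hf
    exact hne (norm_eq_zero.1 (by exact_mod_cast hf.symm))
  have h2 : X.2 = 0 := by
    ext u
    simpa using h (u, 0)
  exact Prod.ext h1 h2

variable (E) in
theorem finrank_strongDual [FiniteDimensional ℝ E] : Module.finrank ℝ (E →L[ℝ] ℝ) =
    Module.finrank ℝ E := by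
  rw [← (LinearMap.toContinuousLinearMap (𝕜 := ℝ) (E := E) (F' := ℝ)).finrank_eq]
  exact Subspace.dual_finrank_eq

/-- An injective linear map between normed spaces of the same finite dimension, as an
isomorphism. -/
def equivOfInjective {V W : Type*} [NormedAddCommGroup V] [NormedSpace ℝ V]
    [FiniteDimensional ℝ V] [NormedAddCommGroup W] [NormedSpace ℝ W] [FiniteDimensional ℝ W]
    (f : V →L[ℝ] W) (hf : Function.Injective f) (h : Module.finrank ℝ V = Module.finrank ℝ W) :
    V ≃L[ℝ] W :=
  (LinearEquiv.ofInjectiveOfFinrankEq f.toLinearMap hf h).toContinuousLinearEquiv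

variable (E) in
/-- The isomorphism of `E × E*` with its dual given by the standard symplectic form. -/
def stdFlat [FiniteDimensional ℝ E] : (E × (E →L[ℝ] ℝ)) ≃L[ℝ] ((E × (E →L[ℝ] ℝ)) →L[ℝ] ℝ) :=
  equivOfInjective (V := E × (E →L[ℝ] ℝ)) (W := (E × (E →L[ℝ] ℝ)) →L[ℝ] ℝ)
    (stdSymplectic E) stdSymplectic_injective (finrank_strongDual _).symm

variable [FiniteDimensional ℝ E]

theorem stdFlat_apply (X v : E × (E →L[ℝ] ℝ)) : stdFlat E X v = v.2 X.1 - X.2 v.1 := rfl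

theorem stdFlat_symm_apply (L : (E × (E →L[ℝ] ℝ)) →L[ℝ] ℝ) (v : E × (E →L[ℝ] ℝ)) :
    v.2 ((stdFlat E).symm L).1 - ((stdFlat E).symm L).2 v.1 = L v := by
  rw [← stdFlat_apply, ContinuousLinearEquiv.apply_symm_apply]

variable {G : Type*} [TopologicalSpace G] [ChartedSpace E G] [IsManifold 𝓘(ℝ, E) ∞ G]

/-- Nondegeneracy in finite dimension makes the defining vector exist and be unique, so the choice
in the definition is the musical isomorphism applied to `dp`. -/
theorem hamiltonianField_eq (p : CotangentBundle E G → ℝ) (δ : CotangentBundle E G) :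
    hamiltonianField p δ = (stdFlat E).symm (mfderiv (cotModel E) 𝓘(ℝ, ℝ) p δ) := by
  have h : ∃ X : TangentSpace (cotModel E) δ, ∀ v : TangentSpace (cotModel E) δ,
      mfderiv (cotModel E) 𝓘(ℝ, ℝ) p δ v = symplecticForm δ X v := by
    refine ⟨(stdFlat E).symm (mfderiv (cotModel E) 𝓘(ℝ, ℝ) p δ), fun v => ?_⟩
    exact (stdFlat_symm_apply _ _).symm.trans (symplecticForm_apply δ _ v).symm
  have h1 : hamiltonianField p δ = h.choose := dif_pos h
  rw [h1]
  refine ((stdFlat E).eq_symm_apply (x := mfderiv (cotModel E) 𝓘(ℝ, ℝ) p δ)).2 ?_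
  refine ContinuousLinearMap.ext fun v => ?_
  exact (symplecticForm_apply δ _ v).symm.trans (h.choose_spec v).symm

end Sharp

/-! ### Maps that rescale the Liouville form up to an exact form. -/

section Lift
variable {E : Type*} [NormedAddCommGroup E] [NormedSpace ℝ E]

theorem HasFDerivAt.clm_apply_vec {X Y Z : Type*} [NormedAddCommGroup X] [NormedSpace ℝ X]
    [NormedAddCommGroup Y] [NormedSpace ℝ Y] [NormedAddCommGroup Z] [NormedSpace ℝ Z]
    {c : X → Y →L[ℝ] Z} {c' : X →L[ℝ] Y →L[ℝ] Z} {x : X} (hc : HasFDerivAt c c' x) (v : Y) :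
    HasFDerivAt (fun y => c y v) (c'.flip v) x := by
  simpa using hc.clm_apply (hasFDerivAt_const v x)

/-- Differentiate `φ*θ = aθ + dh` and antisymmetrize: the second derivatives of `φ` and of `h` drop
out by symmetry. This is the rule that `d` commutes with pullback, obtained directly from second
derivatives. -/
theorem stdSymplectic_fderiv {φ : E × (E →L[ℝ] ℝ) → E × (E →L[ℝ] ℝ)}
    {h : E × (E →L[ℝ] ℝ) → ℝ} {a : ℝ} {z₀ : E × (E →L[ℝ] ℝ)}
    (hφ : ContDiffAt ℝ 2 φ z₀) (hh : ContDiffAt ℝ 2 h z₀)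
    (H : ∀ᶠ z in 𝓝 z₀, ∀ v, (φ z).2 (fderiv ℝ φ z v).1 = a * z.2 v.1 + fderiv ℝ h z v)
    (u v : E × (E →L[ℝ] ℝ)) :
    stdSymplectic E (fderiv ℝ φ z₀ u) (fderiv ℝ φ z₀ v) = a * stdSymplectic E u v := by
  have hφ1 : DifferentiableAt ℝ φ z₀ := hφ.differentiableAt (by simp)
  have hφ2 : DifferentiableAt ℝ (fderiv ℝ φ) z₀ :=
    (hφ.fderiv_right (m := 1) (by norm_num)).differentiableAt (by simp)
  have hh2 : DifferentiableAt ℝ (fderiv ℝ h) z₀ :=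
    (hh.fderiv_right (m := 1) (by norm_num)).differentiableAt (by simp)
  have key (u v : E × (E →L[ℝ] ℝ)) :
      (fderiv ℝ φ z₀ u).2 (fderiv ℝ φ z₀ v).1 + (φ z₀).2 (fderiv ℝ (fderiv ℝ φ) z₀ u v).1 =
        a * u.2 v.1 + fderiv ℝ (fderiv ℝ h) z₀ u v := by
    have e1 : HasFDerivAt (fun z => (φ z).2) ((ContinuousLinearMap.snd ℝ E (E →L[ℝ] ℝ)).comp
      (fderiv ℝ φ z₀)) z₀ := (ContinuousLinearMap.snd ℝ E (E →L[ℝ] ℝ)).hasFDerivAt.comp z₀ hφ1.hasFDerivAt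
    have e2 : HasFDerivAt (fun z => (fderiv ℝ φ z v).1)
        ((ContinuousLinearMap.fst ℝ E (E →L[ℝ] ℝ)).comp
          ((fderiv ℝ (fderiv ℝ φ) z₀).flip v)) z₀ :=
      (ContinuousLinearMap.fst ℝ E (E →L[ℝ] ℝ)).hasFDerivAt.comp z₀
        (hφ2.hasFDerivAt.clm_apply_vec v)
    have e3 := e1.clm_apply e2
    have e4 : HasFDerivAt (fun z : E × (E →L[ℝ] ℝ) => z.2 v.1)
        ((ContinuousLinearMap.snd ℝ E (E →L[ℝ] ℝ)).flip v.1) z₀ :=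
      (ContinuousLinearMap.snd ℝ E (E →L[ℝ] ℝ)).hasFDerivAt.clm_apply_vec v.1
    have e5 := (e4.const_mul a).add (hh2.hasFDerivAt.clm_apply_vec v)
    have e6 := e3.unique (e5.congr_of_eventuallyEq (H.mono fun z hz => hz v))
    have := DFunLike.congr_fun e6 u
    simp at this
    linarith
  have s1 := (hφ.isSymmSndFDerivAt (by simp)) u v
  have s2 := (hh.isSymmSndFDerivAt (by simp)) u v
  have k1 := key u v
  have k2 := key v u
  rw [s1, s2] at k1
  rw [stdSymplectic_apply, stdSymplectic_apply]
  linarith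

variable {G : Type*} [TopologicalSpace G] [ChartedSpace E G] [IsManifold 𝓘(ℝ, E) ∞ G]

theorem liouville_eq_chart (c δ : CotangentBundle E G) (hδ : δ ∈ (extChartAt (cotModel E) c).source)
    (w : TangentSpace (cotModel E) δ) :
    liouville δ w = (extChartAt (cotModel E) c δ).2
      (mfderiv (cotModel E) 𝓘(ℝ, E × (E →L[ℝ] ℝ)) (extChartAt (cotModel E) c) δ w :
        E × (E →L[ℝ] ℝ)).1 := by
  obtain ⟨z, hz, rfl⟩ : ∃ z ∈ (extChartAt (cotModel E) c).target,
      (extChartAt (cotModel E) c).symm z = δ :=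
    ⟨_, (extChartAt (cotModel E) c).map_source hδ, (extChartAt (cotModel E) c).left_inv hδ⟩
  have h1 := mfderivWithin_extChartAt_symm_comp_mfderiv_extChartAt hz
  rw [ModelWithCorners.range_eq_univ, mfderivWithin_univ] at h1
  have hz1 : z.1 ∈ (extChartAt 𝓘(ℝ, E) c.proj).target := by
    rw [cot_extChartAt_target] at hz; exact hz.1
  have h2 := liouvilleInChart_apply c hz1 (mfderiv (cotModel E) 𝓘(ℝ, E × (E →L[ℝ] ℝ))
    (extChartAt (cotModel E) c) ((extChartAt (cotModel E) c).symm z) w)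
  rw [(extChartAt (cotModel E) c).right_inv hz]
  refine Eq.trans ?_ h2
  exact congrArg (liouville ((extChartAt (cotModel E) c).symm z)) (DFunLike.congr_fun h1 w).symm

/-- The differential of a real function, as a linear form. -/
def differential {F N : Type*} [NormedAddCommGroup F] [NormedSpace ℝ F]
    {H : Type*} [TopologicalSpace H] (I : ModelWithCorners ℝ F H)
    [TopologicalSpace N] [ChartedSpace H N] (f : N → ℝ) (x : N) : TangentSpace I x →L[ℝ] ℝ :=
  mfderiv I 𝓘(ℝ, ℝ) f x

theorem mfderiv_eq_fderiv_chart {F F' N : Type*} [NormedAddCommGroup F] [NormedSpace ℝ F]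
    [NormedAddCommGroup F'] [NormedSpace ℝ F']
    {H : Type*} [TopologicalSpace H] {I : ModelWithCorners ℝ F H} [I.Boundaryless]
    [TopologicalSpace N] [ChartedSpace H N] {f : N → F'} {x : N}
    (hf : MDifferentiableAt I 𝓘(ℝ, F') f x) :
    mfderiv I 𝓘(ℝ, F') f x = fderiv ℝ (f ∘ (extChartAt I x).symm) (extChartAt I x x) := by
  rw [hf.mfderiv, I.range_eq_univ, fderivWithin_univ]
  rfl

/-- The target chart `c` is kept free, since the regularity of the Hamiltonian field has to be read
in one fixed chart at all nearby points. -/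
theorem stdSymplectic_mfderiv {Φ : CotangentBundle E G → CotangentBundle E G}
    {h : CotangentBundle E G → ℝ} {a : ℝ} {δ c : CotangentBundle E G}
    (hΦ : ContMDiffAt (cotModel E) (cotModel E) 2 Φ δ)
    (hh : ContMDiffAt (cotModel E) 𝓘(ℝ, ℝ) 2 h δ)
    (hc : Φ δ ∈ (extChartAt (cotModel E) c).source)
    (H : ∀ᶠ δ' in 𝓝 δ, ∀ v : TangentSpace (cotModel E) δ',
      liouville (Φ δ') (mfderiv (cotModel E) (cotModel E) Φ δ' v) =
        a * liouville δ' v + differential (cotModel E) h δ' v)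
    (u v : E × (E →L[ℝ] ℝ)) :
    stdSymplectic E
        (mfderiv (cotModel E) 𝓘(ℝ, E × (E →L[ℝ] ℝ)) (extChartAt (cotModel E) c ∘ Φ) δ u)
        (mfderiv (cotModel E) 𝓘(ℝ, E × (E →L[ℝ] ℝ)) (extChartAt (cotModel E) c ∘ Φ) δ v) =
      a * stdSymplectic E u v := by
  have hz₀ := mem_extChartAt_target (I := cotModel E) δ
  have hz₀' : (extChartAt (cotModel E) δ).symm (extChartAt (cotModel E) δ δ) = δ :=
    extChartAt_to_inv (I := cotModel E) δ
  have hψ : ContMDiffAt 𝓘(ℝ, E × (E →L[ℝ] ℝ)) (cotModel E) 2 (extChartAt (cotModel E) δ).symm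
      (extChartAt (cotModel E) δ δ) :=
    (contMDiffOn_extChartAt_symm δ).contMDiffAt ((isOpen_extChartAt_target δ).mem_nhds hz₀)
  have hcΦ : ContMDiffAt (cotModel E) 𝓘(ℝ, E × (E →L[ℝ] ℝ)) 2 (extChartAt (cotModel E) c ∘ Φ) δ :=
    (contMDiffAt_extChartAt' (by rwa [extChartAt_source] at hc)).comp δ hΦ
  rw [mfderiv_eq_fderiv_chart (hcΦ.mdifferentiableAt (by simp))]
  refine stdSymplectic_fderiv (h := h ∘ (extChartAt (cotModel E) δ).symm)
    (contMDiffAt_iff_contDiffAt.1 (hcΦ.comp_of_eq hψ hz₀'))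
    (contMDiffAt_iff_contDiffAt.1 (hh.comp_of_eq hψ hz₀')) ?_ u v
  have hψc := hψ.continuousAt
  rw [ContinuousAt, hz₀'] at hψc
  filter_upwards [hψc.eventually H, hψc.eventually (contMDiffAt_iff_contMDiffAt_nhds
      (by simp) |>.1 hΦ),
    hψc.eventually (contMDiffAt_iff_contMDiffAt_nhds (by simp) |>.1 hh),
    hψc.eventually (hΦ.continuousAt.eventually ((isOpen_extChartAt_source c).mem_nhds hc)),
    (isOpen_extChartAt_target δ).mem_nhds hz₀] with z h1 h2 h3 h4 h5 v
  have d0 := mdifferentiableAt_extChartAt_symm' h5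
  have d1 : MDifferentiableAt (cotModel E) (cotModel E) Φ ((extChartAt (cotModel E) δ).symm z) :=
    h2.mdifferentiableAt (by simp)
  have d2 : MDifferentiableAt (cotModel E) 𝓘(ℝ, ℝ) h ((extChartAt (cotModel E) δ).symm z) :=
    h3.mdifferentiableAt (by simp)
  have d3 : MDifferentiableAt (cotModel E) 𝓘(ℝ, E × (E →L[ℝ] ℝ)) (extChartAt (cotModel E) c)
      (Φ ((extChartAt (cotModel E) δ).symm z)) :=
    mdifferentiableAt_extChartAt (by rwa [extChartAt_source] at h4)
  have e1 := mfderiv_comp z d2 d0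
  have e2 := mfderiv_comp z (d3.comp _ d1) d0
  have e3 := mfderiv_comp ((extChartAt (cotModel E) δ).symm z) d3 d1
  rw [mfderiv_eq_fderiv] at e1 e2
  rw [e1, e2, e3]
  have hz1 : z.1 ∈ (extChartAt 𝓘(ℝ, E) δ.proj).target := by
    rw [cot_extChartAt_target] at h5; exact h5.1
  rw [← liouvilleInChart_apply δ hz1 v]
  refine Eq.trans ?_ (h1 _)
  exact (liouville_eq_chart c _ h4 _).symm

end Lift

/-! ### Naturality and regularity of the Hamiltonian field. -/

section HamiltonianNaturality
variable {E : Type*} [NormedAddCommGroup E] [NormedSpace ℝ E] [FiniteDimensional ℝ E]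
  {G : Type*} [TopologicalSpace G] [ChartedSpace E G] [IsManifold 𝓘(ℝ, E) ∞ G]

/-- A conformally symplectic map is injective by nondegeneracy, hence surjective by dimension, so it
is enough to pair both sides with vectors `D v`; the two factors `a` then agree. -/
theorem stdFlat_symm_of_conformal {D : (E × (E →L[ℝ] ℝ)) →L[ℝ] (E × (E →L[ℝ] ℝ))} {a : ℝ}
    (ha : a ≠ 0)
    (hD : ∀ u v, stdSymplectic E (D u) (D v) = a * stdSymplectic E u v)
    {L L' : (E × (E →L[ℝ] ℝ)) →L[ℝ] ℝ} (hL : ∀ v, L' (D v) = a * L v) :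
    D ((stdFlat E).symm L) = (stdFlat E).symm L' := by
  have hinj : Function.Injective D := by
    intro u v huv
    refine stdSymplectic_injective (ContinuousLinearMap.ext fun w => ?_)
    have h1 := hD u w
    rw [huv, hD v w] at h1
    exact (mul_left_cancel₀ ha h1).symm
  have hsurj : Function.Surjective D :=
    LinearMap.surjective_of_injective (f := D.toLinearMap) hinj
  refine ((stdFlat E).eq_symm_apply).2 (ContinuousLinearMap.ext fun w => ?_)
  obtain ⟨v, rfl⟩ := hsurj w
  refine (hD _ v).trans ?_
  rw [hL, stdSymplectic_apply, stdFlat_symm_apply]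

theorem mfderiv_hamiltonianField_chart {Φ : CotangentBundle E G → CotangentBundle E G}
    {h p : CotangentBundle E G → ℝ} {a : ℝ} (ha : a ≠ 0) {δ c : CotangentBundle E G}
    (hΦ : ContMDiffAt (cotModel E) (cotModel E) 2 Φ δ)
    (hh : ContMDiffAt (cotModel E) 𝓘(ℝ, ℝ) 2 h δ)
    (hc : Φ δ ∈ (extChartAt (cotModel E) c).source)
    (H : ∀ᶠ δ' in 𝓝 δ, ∀ v : TangentSpace (cotModel E) δ',
      liouville (Φ δ') (mfderiv (cotModel E) (cotModel E) Φ δ' v) =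
        a * liouville δ' v + differential (cotModel E) h δ' v)
    (hp : MDifferentiableAt (cotModel E) 𝓘(ℝ, ℝ) p (Φ δ))
    (hpΦ : ∀ᶠ δ' in 𝓝 δ, p (Φ δ') = a * p δ') :
    (mfderiv (cotModel E) 𝓘(ℝ, E × (E →L[ℝ] ℝ)) (extChartAt (cotModel E) c ∘ Φ) δ
      (hamiltonianField p δ) : E × (E →L[ℝ] ℝ)) =
      (stdFlat E).symm (fderiv ℝ (p ∘ (extChartAt (cotModel E) c).symm)
        (extChartAt (cotModel E) c (Φ δ))) := by
  rw [hamiltonianField_eq]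
  refine stdFlat_symm_of_conformal ha (stdSymplectic_mfderiv hΦ hh hc H) fun v => ?_
  have hc' : extChartAt (cotModel E) c (Φ δ) ∈ (extChartAt (cotModel E) c).target :=
    (extChartAt (cotModel E) c).map_source hc
  have hinv : (extChartAt (cotModel E) c).symm (extChartAt (cotModel E) c (Φ δ)) = Φ δ :=
    (extChartAt (cotModel E) c).left_inv hc
  have d1 : MDifferentiableAt (cotModel E) (cotModel E) Φ δ := hΦ.mdifferentiableAt (by simp)
  have d2 : MDifferentiableAt (cotModel E) 𝓘(ℝ, E × (E →L[ℝ] ℝ))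
      (extChartAt (cotModel E) c ∘ Φ) δ :=
    (mdifferentiableAt_extChartAt (by rwa [extChartAt_source] at hc)).comp δ d1
  have d3 : MDifferentiableAt 𝓘(ℝ, E × (E →L[ℝ] ℝ)) 𝓘(ℝ, ℝ)
      (p ∘ (extChartAt (cotModel E) c).symm) (extChartAt (cotModel E) c (Φ δ)) :=
    MDifferentiableAt.comp _ (by rwa [hinv]) (mdifferentiableAt_extChartAt_symm' hc')
  have e1 := mfderiv_comp δ d3 d2
  have e2 : (p ∘ (extChartAt (cotModel E) c).symm) ∘ (extChartAt (cotModel E) c ∘ Φ) =ᶠ[𝓝 δ]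
      fun δ' => a * p δ' := by
    filter_upwards [hΦ.continuousAt.eventually ((isOpen_extChartAt_source c).mem_nhds hc), hpΦ]
      with δ' h1 h2
    rw [← h2]
    exact congrArg p ((extChartAt (cotModel E) c).left_inv h1)
  rw [e2.mfderiv_eq, mfderiv_eq_fderiv] at e1
  -- Differentiability is assumed only at `Φ δ`; it comes back to `δ` because `p = a⁻¹ • (p ∘ Φ)`
  -- near `δ`.
  have e3 : MDifferentiableAt (cotModel E) 𝓘(ℝ, ℝ) p δ := by
    have := (hp.comp δ d1).const_smul a⁻¹
    refine this.congr_of_eventuallyEq ?_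
    filter_upwards [hpΦ] with δ' h2
    simp [h2, ha]
  have e4 : mfderiv (cotModel E) 𝓘(ℝ, ℝ) (fun δ' => a * p δ') δ =
      a • mfderiv (cotModel E) 𝓘(ℝ, ℝ) p δ := const_smul_mfderiv e3 a
  exact (DFunLike.congr_fun (e4.symm.trans e1) v).symm

/-- A conformally symplectic local map that rescales `p` preserves the Hamiltonian field of `p`. -/
theorem mfderiv_hamiltonianField {Φ : CotangentBundle E G → CotangentBundle E G}
    {h p : CotangentBundle E G → ℝ} {a : ℝ} (ha : a ≠ 0) {δ : CotangentBundle E G}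
    (hΦ : ContMDiffAt (cotModel E) (cotModel E) 2 Φ δ)
    (hh : ContMDiffAt (cotModel E) 𝓘(ℝ, ℝ) 2 h δ)
    (H : ∀ᶠ δ' in 𝓝 δ, ∀ v : TangentSpace (cotModel E) δ',
      liouville (Φ δ') (mfderiv (cotModel E) (cotModel E) Φ δ' v) =
        a * liouville δ' v + differential (cotModel E) h δ' v)
    (hp : MDifferentiableAt (cotModel E) 𝓘(ℝ, ℝ) p (Φ δ))
    (hpΦ : ∀ᶠ δ' in 𝓝 δ, p (Φ δ') = a * p δ') :
    mfderiv (cotModel E) (cotModel E) Φ δ (hamiltonianField p δ) = hamiltonianField p (Φ δ) := by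
  have h1 := mfderiv_hamiltonianField_chart ha hΦ hh (mem_extChartAt_source (Φ δ)) H hp hpΦ
  have d1 : MDifferentiableAt (cotModel E) (cotModel E) Φ δ := hΦ.mdifferentiableAt (by simp)
  rw [mfderiv_comp δ (mdifferentiableAt_extChartAt (mem_chart_source _ _)) d1,
    mfderiv_extChartAt_self, ← mfderiv_eq_fderiv_chart hp] at h1
  rw [hamiltonianField_eq p (Φ δ)]
  exact h1

/-- These are Hamilton's equations in an arbitrary canonical chart, the case `Φ = id`, `h = 0`, `a =
1` of naturality. They express the field near a point by a single formula. -/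
theorem mfderiv_extChartAt_hamiltonianField {p : CotangentBundle E G → ℝ}
    {δ c : CotangentBundle E G} (hc : δ ∈ (extChartAt (cotModel E) c).source)
    (hp : MDifferentiableAt (cotModel E) 𝓘(ℝ, ℝ) p δ) :
    (mfderiv (cotModel E) 𝓘(ℝ, E × (E →L[ℝ] ℝ)) (extChartAt (cotModel E) c) δ
      (hamiltonianField p δ) : E × (E →L[ℝ] ℝ)) =
      (stdFlat E).symm (fderiv ℝ (p ∘ (extChartAt (cotModel E) c).symm)
        (extChartAt (cotModel E) c δ)) := by
  refine mfderiv_hamiltonianField_chart (Φ := id) (h := fun _ => 0) one_ne_zero contMDiffAt_id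
    contMDiffAt_const hc (.of_forall fun δ' v => ?_) hp (.of_forall fun δ' => by simp)
  rw [mfderiv_id, differential, mfderiv_const]
  simp only [ContinuousLinearMap.id_apply, id, one_mul]
  exact (add_zero _).symm

theorem ContDiffAt.continuousLinearEquiv_comp {X Y Z : Type*} [NormedAddCommGroup X]
    [NormedSpace ℝ X] [NormedAddCommGroup Y] [NormedSpace ℝ Y] [NormedAddCommGroup Z]
    [NormedSpace ℝ Z] (e : Y ≃L[ℝ] Z) {f : X → Y} {x : X} {n : WithTop ℕ∞}
    (hf : ContDiffAt ℝ n f x) : ContDiffAt ℝ n (fun z => e (f z)) x :=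
  e.contDiff.contDiffAt.comp x hf

set_option synthInstance.maxHeartbeats 400000 in
theorem contMDiffAt_hamiltonianField {p : CotangentBundle E G → ℝ} {δ : CotangentBundle E G}
    (hp : ContMDiffAt (cotModel E) 𝓘(ℝ, ℝ) 2 p δ) :
    ContMDiffAt (cotModel E) (cotModel E).tangent 1
      (fun δ' => (⟨δ', hamiltonianField p δ'⟩ : TangentBundle (cotModel E) (CotangentBundle E G)))
      δ := by
  rw [contMDiffAt_section]
  have h1 : (fun δ' => (stdFlat E).symm (fderiv ℝ (p ∘ (extChartAt (cotModel E) δ).symm)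
        (extChartAt (cotModel E) δ δ'))) =ᶠ[𝓝 δ]
      fun δ' => (trivializationAt (E × (E →L[ℝ] ℝ)) (TangentSpace (cotModel E)) δ
        ⟨δ', hamiltonianField p δ'⟩).2 := by
    filter_upwards [(isOpen_extChartAt_source δ).mem_nhds (mem_extChartAt_source
        (I := cotModel E) δ),
      contMDiffAt_iff_contMDiffAt_nhds (by simp) |>.1 hp] with δ' h1 h2
    rw [← mfderiv_extChartAt_hamiltonianField h1 (h2.mdifferentiableAt (by simp))]
    rw [extChartAt_source] at h1
    rw [← TangentBundle.continuousLinearMapAt_trivializationAt h1]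
    exact Trivialization.continuousLinearMapAt_apply_of_mem _ _ h1 _
  refine ContMDiffAt.congr_of_eventuallyEq ?_ h1.symm
  have h2 : ContDiffAt ℝ 2 (p ∘ (extChartAt (cotModel E) δ).symm) (extChartAt (cotModel E) δ δ) :=
    contMDiffAt_iff_contDiffAt.1 (hp.comp_of_eq ((contMDiffOn_extChartAt_symm δ).contMDiffAt
      ((isOpen_extChartAt_target δ).mem_nhds (mem_extChartAt_target (I := cotModel E) δ)))
      (extChartAt_to_inv (I := cotModel E) δ))
  have h2' := h2.fderiv_right (m := 1) (by norm_num)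
  have h3 := ContDiffAt.continuousLinearEquiv_comp (X := E × (E →L[ℝ] ℝ))
    (Y := (E × (E →L[ℝ] ℝ)) →L[ℝ] ℝ) (Z := E × (E →L[ℝ] ℝ)) (stdFlat E).symm h2'
  exact h3.contMDiffAt.comp δ contMDiffAt_extChartAt

end HamiltonianNaturality

/-! ### Complete flows from a uniform lifespan. -/

section Flow

theorem FiberBundle.t2Space_totalSpace {X F : Type*} [TopologicalSpace X] [TopologicalSpace F]
    [T2Space X] [T2Space F] (V : X → Type*) [TopologicalSpace (TotalSpace F V)]
    [∀ x, TopologicalSpace (V x)] [FiberBundle F V] : T2Space (TotalSpace F V) := by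
  refine ⟨fun x y hxy => ?_⟩
  by_cases h : x.proj = y.proj
  · set e := trivializationAt F V x.proj
    have hx : x ∈ e.source := FiberBundle.mem_trivializationAt_proj_source
    have hy : y ∈ e.source := e.mem_source.2 (h ▸ e.mem_source.1 hx)
    obtain ⟨u, v, hu, hv, hxu, hyv, huv⟩ := t2_separation (e.injOn.ne hx hy hxy)
    refine ⟨e.source ∩ e ⁻¹' u, e.source ∩ e ⁻¹' v,
      e.toOpenPartialHomeomorph.isOpen_inter_preimage hu,
      e.toOpenPartialHomeomorph.isOpen_inter_preimage hv, ⟨hx, hxu⟩, ⟨hy, hyv⟩, ?_⟩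
    exact (huv.preimage e).mono inter_subset_right inter_subset_right
  · obtain ⟨u, v, hu, hv, hxu, hyv, huv⟩ := t2_separation h
    exact ⟨_, _, hu.preimage (FiberBundle.continuous_proj F V),
      hv.preimage (FiberBundle.continuous_proj F V), hxu, hyv, huv.preimage _⟩

variable {F H N : Type*} [NormedAddCommGroup F] [NormedSpace ℝ F] [TopologicalSpace H]
  {I : ModelWithCorners ℝ F H} [TopologicalSpace N] [ChartedSpace H N]
  {X : (y : N) → TangentSpace I y} {U : Set N}

/-- `c` is tangent to the vector field `X` at time `t`. -/
def IsTangentAt (X : (y : N) → TangentSpace I y) (c : ℝ → N) (t : ℝ) : Prop :=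
  HasMFDerivAt 𝓘(ℝ, ℝ) I c t ((1 : ℝ →L[ℝ] ℝ).smulRight (X (c t)))

theorem isMIntegralCurveOn_iff_isTangentAt {c : ℝ → N} {J : Set ℝ} (hJ : IsOpen J) :
    IsMIntegralCurveOn c X J ↔ ∀ t ∈ J, IsTangentAt X c t := by
  refine forall₂_congr fun t ht => ?_
  rw [IsTangentAt]
  exact ⟨fun h => h.hasMFDerivAt (hJ.mem_nhds ht), fun h => h.hasMFDerivWithinAt⟩

theorem IsTangentAt.congr {c c' : ℝ → N} {t : ℝ} (h : IsTangentAt X c t) (hc : c' =ᶠ[𝓝 t] c) :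
    IsTangentAt X c' t := by
  have := HasMFDerivAt.congr_of_eventuallyEq h hc
  rwa [IsTangentAt, hc.eq_of_nhds]

theorem IsTangentAt.comp_sub {c : ℝ → N} {t s : ℝ} (h : IsTangentAt X c (t - s)) :
    IsTangentAt X (fun t' => c (t' - s)) t := by
  have h1 : HasMFDerivAt 𝓘(ℝ, ℝ) 𝓘(ℝ, ℝ) (fun t' : ℝ => t' - s) t (ContinuousLinearMap.id ℝ ℝ) :=
    ((hasFDerivAt_id t).sub_const s).hasMFDerivAt
  have h2 := HasMFDerivAt.comp (g := c) (f := fun t' : ℝ => t' - s) t h h1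
  exact h2.congr_mfderiv (ContinuousLinearMap.ext fun τ => rfl)

/-- There is an integral curve of `X` in `U`, starting at `y`, on the time interval `(-ε, ε)`. -/
def HasCurveOn (X : (y : N) → TangentSpace I y) (U : Set N) (ε : ℝ) (y : N) : Prop :=
  ∃ c : ℝ → N, c 0 = y ∧ ∀ t ∈ Ioo (-ε) ε, IsTangentAt X c t ∧ c t ∈ U

theorem HasCurveOn.mono {ε ε' : ℝ} {y : N} (h : HasCurveOn X U ε y) (hε : ε' ≤ ε) :
    HasCurveOn X U ε' y := by
  obtain ⟨c, h0, hc⟩ := h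
  exact ⟨c, h0, fun t ht => hc t ⟨by linarith [ht.1], by linarith [ht.2]⟩⟩

variable [I.Boundaryless] [IsManifold I 1 N]

theorem IsTangentAt.eventuallyEq {c c' : ℝ → N} {t₀ : ℝ}
    (hX : ContMDiffAt I I.tangent 1 (fun y => (⟨y, X y⟩ : TangentBundle I N)) (c t₀))
    (hc : ∀ᶠ t in 𝓝 t₀, IsTangentAt X c t) (hc' : ∀ᶠ t in 𝓝 t₀, IsTangentAt X c' t)
    (h : c t₀ = c' t₀) : c =ᶠ[𝓝 t₀] c' :=
  isMIntegralCurveAt_eventuallyEq_of_contMDiffAt_boundaryless hX hc hc' h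

/-- Uniqueness of integral curves of a vector field that is of class `C¹` on `U`. -/
theorem eqOn_of_isTangentAt [T2Space N]
    (hX : ∀ y ∈ U, ContMDiffAt I I.tangent 1 (fun y => (⟨y, X y⟩ : TangentBundle I N)) y)
    {J : Set ℝ} (hJ : IsOpen J) (hJ' : J.OrdConnected) {c c' : ℝ → N} {t₀ : ℝ} (ht₀ : t₀ ∈ J)
    (hc : ∀ t ∈ J, IsTangentAt X c t) (hc' : ∀ t ∈ J, IsTangentAt X c' t)
    (hcU : ∀ t ∈ J, c t ∈ U) (h : c t₀ = c' t₀) : EqOn c c' J := by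
  have hcc : ContinuousOn c J := fun t ht => (hc t ht).continuousAt.continuousWithinAt
  have hcc' : ContinuousOn c' J := fun t ht => (hc' t ht).continuousAt.continuousWithinAt
  have hsub : J ⊆ {t | c =ᶠ[𝓝 t] c'} := by
    refine hJ'.isPreconnected.subset_of_closure_inter_subset ?_ ?_ ?_
    · exact isOpen_iff_mem_nhds.2 fun t ht => eventually_eventually_nhds.2 ht
    · exact ⟨t₀, ht₀, IsTangentAt.eventuallyEq (hX _ (hcU _ ht₀))
          (Filter.eventually_of_mem (hJ.mem_nhds ht₀) hc)
        (Filter.eventually_of_mem (hJ.mem_nhds ht₀) hc') h⟩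
    · rintro t ⟨ht, htJ⟩
      refine IsTangentAt.eventuallyEq (hX _ (hcU _ htJ)) (Filter.eventually_of_mem
          (hJ.mem_nhds htJ) hc)
        (Filter.eventually_of_mem (hJ.mem_nhds htJ) hc') ?_
      by_contra hne
      have h1 : ∀ᶠ t' in 𝓝 t, c t' ≠ c' t' := by
        have := (hc t htJ).continuousAt.prodMk_nhds (hc' t htJ).continuousAt
        exact this.eventually ((isClosed_diagonal.isOpen_compl).mem_nhds (x := (c t, c' t)) hne)
      obtain ⟨t', ht1, ht2⟩ := mem_closure_iff_nhds.1 ht _ h1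
      exact ht1 ht2.eq_of_nhds
  exact fun t ht => (hsub ht).eq_of_nhds

/-- Integral curves starting near a given point exist for a uniform time. -/
theorem eventually_hasCurveOn [CompleteSpace F] (hU : IsOpen U) {y₀ : N} (hy₀ : y₀ ∈ U)
    (hX : ContMDiffAt I I.tangent 1 (fun y => (⟨y, X y⟩ : TangentBundle I N)) y₀) :
    ∃ ε > 0, ∀ᶠ y in 𝓝 y₀, HasCurveOn X U ε y := by
  set φ := extChartAt I y₀ with hφ
  have hv : ContDiffAt ℝ 1 (fun z : F => (mfderiv I 𝓘(ℝ, F) φ (φ.symm z) (X (φ.symm z)) : F))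
      (φ y₀) := by
    rw [contMDiffAt_section] at hX
    have h1 : (fun y => (trivializationAt F (TangentSpace I) y₀ ⟨y, X y⟩).2) =ᶠ[𝓝 y₀]
        fun y => (mfderiv I 𝓘(ℝ, F) φ y (X y) : F) := by
      filter_upwards [(chartAt H y₀).open_source.mem_nhds (mem_chart_source H y₀)] with y hy
      rw [hφ, ← TangentBundle.continuousLinearMapAt_trivializationAt hy]
      exact (Trivialization.continuousLinearMapAt_apply_of_mem _ _ hy _).symm
    have h2 := hX.congr_of_eventuallyEq h1.symm
    refine contMDiffAt_iff_contDiffAt.1 (ContMDiffAt.comp_of_eq (x := φ y₀) h2 ?_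
      (extChartAt_to_inv y₀))
    exact (contMDiffOn_extChartAt_symm y₀).contMDiffAt
      ((isOpen_extChartAt_target y₀).mem_nhds (mem_extChartAt_target y₀))
  -- Picard–Lindelöf provides a local flow `α` that is jointly continuous in the initial value and
  -- in time; this keeps all nearby trajectories in the chart and in `U` up to a common time `ε'`.
  obtain ⟨ε, hε, a, r, L, K, hr, hpl⟩ := IsPicardLindelof.of_contDiffAt_one hv
  obtain ⟨α, hα, hαc⟩ := (hpl 0).exists_forall_mem_closedBall_eq_hasDerivWithinAt_continuousOn
  have hW : ∀ᶠ z in 𝓝 (φ y₀), z ∈ φ.target ∧ φ.symm z ∈ U := by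
    refine Filter.Eventually.and
      ((isOpen_extChartAt_target y₀).mem_nhds (mem_extChartAt_target y₀)) ?_
    exact (continuousAt_extChartAt_symm y₀).eventually
      (by rw [extChartAt_to_inv]; exact hU.mem_nhds hy₀)
  have hαc' : ContinuousAt α (φ y₀, 0) := hαc.continuousAt
    (prod_mem_nhds (Metric.closedBall_mem_nhds _ hr) (Icc_mem_nhds (by linarith) (by linarith)))
  have h0 : α (φ y₀, 0) = φ y₀ := (hα _ (Metric.mem_closedBall_self hr.le)).1
  have h1 : ∀ᶠ q : F × ℝ in 𝓝 (φ y₀, 0), α q ∈ φ.target ∧ φ.symm (α q) ∈ U :=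
    hαc'.eventually (by rwa [h0])
  rw [nhds_prod_eq] at h1
  obtain ⟨pa, hpa, pb, hpb, h2⟩ := Filter.eventually_prod_iff.1 h1
  obtain ⟨ε', hε', h3⟩ := Metric.eventually_nhds_iff.1 hpb
  refine ⟨min ε ε', lt_min hε hε', ?_⟩
  filter_upwards [(continuousAt_extChartAt (I := I) y₀).eventually hpa,
    (continuousAt_extChartAt (I := I) y₀).eventually (Metric.closedBall_mem_nhds _ hr),
    (isOpen_extChartAt_source (I := I) y₀).mem_nhds (mem_extChartAt_source y₀)] with y hy1 hy2 hy3
  obtain ⟨ha0, ha⟩ := hα _ hy2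
  refine ⟨fun t => φ.symm (α (φ y, t)), ?_, fun t ht => ?_⟩
  · simp only
    rw [ha0]
    exact φ.left_inv hy3
  · have ht1 : t ∈ Ioo (-ε) ε := ⟨by linarith [ht.1, min_le_left ε ε'], ht.2.trans_le
        (min_le_left _ _)⟩
    have ht2 : dist t 0 < ε' := by
      rw [Real.dist_eq, sub_zero, abs_lt]
      exact ⟨by linarith [ht.1, min_le_right ε ε'], ht.2.trans_le (min_le_right _ _)⟩
    obtain ⟨h4, h5⟩ := h2 hy1 (h3 ht2)
    refine ⟨?_, h5⟩
    have h6 := (ha t ⟨by linarith [ht1.1], by linarith [ht1.2]⟩).hasDerivAt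
      (Icc_mem_nhds (by linarith [ht1.1]) (by linarith [ht1.2]))
    have h7 := HasMFDerivAt.comp t (mdifferentiableAt_extChartAt_symm' h4).hasMFDerivAt
      h6.hasFDerivAt.hasMFDerivAt
    refine h7.congr_mfderiv ?_
    have h8 := mfderivWithin_extChartAt_symm_comp_mfderiv_extChartAt h4
    rw [I.range_eq_univ, mfderivWithin_univ] at h8
    refine ContinuousLinearMap.ext fun (τ : ℝ) => ?_
    have h9 := DFunLike.congr_fun h8 (X (φ.symm (α (φ y, t))))
    exact (map_smul (mfderiv 𝓘(ℝ, F) I φ.symm (α (φ y, t))) τ _).trans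
      (congrArg (fun w : TangentSpace I (φ.symm (α (φ y, t))) => τ • w) h9)

/-- Restarting the curve at distance `ε / 2` from each end, with lifespan `ε`, gains `ε / 2` on both
sides; the pieces agree near the gluing times `±(a - ε / 2)` by uniqueness. -/
theorem HasCurveOn.extend [T2Space N] {ε a : ℝ} (hε : 0 < ε) (ha : ε ≤ a)
    (hX : ∀ y ∈ U, ContMDiffAt I I.tangent 1 (fun y => (⟨y, X y⟩ : TangentBundle I N)) y)
    (h : ∀ y ∈ U, HasCurveOn X U ε y) {y : N} (hy : HasCurveOn X U a y) :
    HasCurveOn X U (a + ε / 2) y := by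
  obtain ⟨c, h0, hc⟩ := hy
  obtain ⟨d₁, hd₁0, hd₁⟩ := h _ (hc (a - ε / 2) ⟨by linarith, by linarith⟩).2
  obtain ⟨d₂, hd₂0, hd₂⟩ := h _ (hc (-(a - ε / 2)) ⟨by linarith, by linarith⟩).2
  set t₁ := a - ε / 2 with ht₁
  have hmem : ∀ t, -a < t → t < a → IsTangentAt X c t ∧ c t ∈ U := fun t h1 h2 => hc t ⟨h1, h2⟩
  have hd₁' : ∀ t, t₁ - ε < t → t < t₁ + ε →
      IsTangentAt X (fun t => d₁ (t - t₁)) t ∧ d₁ (t - t₁) ∈ U := fun t h1 h2 =>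
    ⟨(hd₁ (t - t₁) ⟨by linarith, by linarith⟩).1.comp_sub,
      (hd₁ (t - t₁) ⟨by linarith, by linarith⟩).2⟩
  have hd₂' : ∀ t, -t₁ - ε < t → t < -t₁ + ε →
      IsTangentAt X (fun t => d₂ (t - -t₁)) t ∧ d₂ (t - -t₁) ∈ U := fun t h1 h2 =>
    ⟨(hd₂ (t - -t₁) ⟨by linarith, by linarith⟩).1.comp_sub,
      (hd₂ (t - -t₁) ⟨by linarith, by linarith⟩).2⟩
  have e₁ : c =ᶠ[𝓝 t₁] fun t => d₁ (t - t₁) := by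
    refine IsTangentAt.eventuallyEq (hX _ (hmem _ (by linarith) (by linarith)).2) ?_ ?_
      (by simp [hd₁0])
    · filter_upwards [Ioo_mem_nhds (a := -a) (b := a) (by linarith) (by linarith)] with t ht
      exact (hmem t ht.1 ht.2).1
    · filter_upwards [Ioo_mem_nhds (a := t₁ - ε) (b := t₁ + ε) (by linarith)
          (by linarith)] with t ht
      exact (hd₁' t ht.1 ht.2).1
  have e₂ : c =ᶠ[𝓝 (-t₁)] fun t => d₂ (t - -t₁) := by
    refine IsTangentAt.eventuallyEq (hX _ (hmem _ (by linarith) (by linarith)).2) ?_ ?_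
      (by simp [hd₂0])
    · filter_upwards [Ioo_mem_nhds (a := -a) (b := a) (by linarith) (by linarith)] with t ht
      exact (hmem t ht.1 ht.2).1
    · filter_upwards [Ioo_mem_nhds (a := -t₁ - ε) (b := -t₁ + ε) (by linarith) (by linarith)]
        with t ht
      exact (hd₂' t ht.1 ht.2).1
  refine ⟨fun t => if t < -t₁ then d₂ (t - -t₁) else if t < t₁ then c t else d₁ (t - t₁), ?_, ?_⟩
  · simp only
    rw [if_neg (by linarith), if_pos (by linarith), h0]
  · intro t ht
    rcases lt_trichotomy t (-t₁) with h1 | h1 | h1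
    · simp only [if_pos h1]
      have := hd₂' t (by linarith [ht.1]) (by linarith)
      refine ⟨this.1.congr ?_, this.2⟩
      filter_upwards [Iio_mem_nhds h1] with t' ht'
      exact if_pos ht'
    · have := hmem t (by linarith) (by linarith)
      have h2 : (fun t => if t < -t₁ then d₂ (t - -t₁) else if t < t₁ then c t else d₁ (t - t₁))
          =ᶠ[𝓝 t] c := by
        rw [h1]
        filter_upwards [e₂, Iio_mem_nhds (show -t₁ < t₁ by linarith)] with t' h3 (h4 : t' < t₁)
        simp only [if_pos h4, h3, ite_self]
      refine ⟨this.1.congr h2, ?_⟩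
      exact mem_of_eq_of_mem h2.eq_of_nhds this.2
    · rcases lt_trichotomy t t₁ with h2 | h2 | h2
      · simp only [if_neg h1.not_gt, if_pos h2]
        have := hmem t (by linarith) (by linarith)
        refine ⟨this.1.congr ?_, this.2⟩
        filter_upwards [Ioo_mem_nhds h1 h2] with t' ht'
        rw [if_neg ht'.1.not_gt, if_pos ht'.2]
      · have := hmem t (by linarith) (by linarith)
        have h2 : (fun t => if t < -t₁ then d₂ (t - -t₁) else if t < t₁ then c t else d₁ (t - t₁))
            =ᶠ[𝓝 t] c := by
          rw [h2]
          filter_upwards [e₁, Ioi_mem_nhds (show -t₁ < t₁ by linarith)] with t' h3 (h4 : -t₁ < t')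
          simp only [if_neg h4.not_gt, h3, ite_self]
        refine ⟨this.1.congr h2, ?_⟩
        exact mem_of_eq_of_mem h2.eq_of_nhds this.2
      · simp only [if_neg h1.not_gt, if_neg h2.not_gt]
        have := hd₁' t (by linarith) (by linarith [ht.2])
        refine ⟨this.1.congr ?_, this.2⟩
        filter_upwards [Ioi_mem_nhds h2] with t' (ht' : t₁ < t')
        rw [if_neg (by linarith), if_neg ht'.not_gt]

/-- A vector field of class `C¹` on `U` whose integral curves in `U` exist for a uniform time has a
complete flow on `U`. -/
theorem exists_isCompleteFlow [T2Space N] {ε : ℝ} (hε : 0 < ε)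
    (hX : ∀ y ∈ U, ContMDiffAt I I.tangent 1 (fun y => (⟨y, X y⟩ : TangentBundle I N)) y)
    (h : ∀ y ∈ U, HasCurveOn X U ε y) : ∃ χ : ℝ → N → N, IsCompleteFlow X U χ := by
  have hn : ∀ y ∈ U, ∀ n : ℕ, HasCurveOn X U (ε + n * (ε / 2)) y := by
    intro y hy n
    induction n with
    | zero => simpa using h y hy
    | succ n ih =>
      have h1 := ih.extend hε (le_add_of_nonneg_right (by positivity)) hX h
      convert h1 using 1
      push_cast
      ring
  have hglob : ∀ y ∈ U, ∃ c : ℝ → N, c 0 = y ∧ ∀ t, IsTangentAt X c t ∧ c t ∈ U := by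
    intro y hy
    choose c hc0 hc using hn y hy
    have hN (t : ℝ) : ∃ n : ℕ, |t| < ε + n * (ε / 2) := by
      obtain ⟨n, hn⟩ := exists_nat_gt (|t| / (ε / 2))
      refine ⟨n, ?_⟩
      rw [div_lt_iff₀ (by positivity)] at hn
      linarith
    have heq (m n : ℕ) (t : ℝ) (hm : |t| < ε + m * (ε / 2)) (hn : |t| < ε + n * (ε / 2)) :
        c m t = c n t := by
      wlog hmn : m ≤ n generalizing m n
      · exact (this n m hn hm (le_of_not_ge hmn)).symm
      have hle : ε + m * (ε / 2) ≤ ε + n * (ε / 2) := by gcongr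
      have hpos : 0 < ε + m * (ε / 2) := (abs_nonneg t).trans_lt hm
      exact eqOn_of_isTangentAt (t₀ := 0) hX isOpen_Ioo ordConnected_Ioo
        ⟨by linarith, by linarith⟩ (fun t ht => (hc m t ht).1)
        (fun t ht => (hc n t ⟨by linarith [ht.1], by linarith [ht.2]⟩).1)
        (fun t ht => (hc m t ht).2) ((hc0 m).trans (hc0 n).symm) (abs_lt.1 hm)
    -- `k t` indexes a solution whose interval contains `t`. By `heq` the glued curve coincides near
    -- `t` with the solution of the fixed index `k t`, although `k` itself may jump.
    choose k hk using hN
    refine ⟨fun t => c (k t) t, hc0 _, fun t => ?_⟩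
    have h1 : (fun t => c (k t) t) =ᶠ[𝓝 t] c (k t) := by
      have : ∀ᶠ t' in 𝓝 t, |t'| < ε + k t * (ε / 2) :=
        continuous_abs.continuousAt.eventually (Iio_mem_nhds (hk t))
      filter_upwards [this] with t' ht'
      exact heq _ _ _ (hk t') ht'
    exact ⟨(hc (k t) t (abs_lt.1 (hk t))).1.congr h1, (hc (k t) t (abs_lt.1 (hk t))).2⟩
  choose! c hc0 hc using hglob
  refine ⟨fun t y => c y t, hc0, fun y hy t => (hc y hy t).2, fun y hy t => (hc y hy t).1, ?_⟩
  intro y hy J d hJ hJ' h0 hd hdU hdy t ht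
  exact eqOn_of_isTangentAt hX hJ hJ' h0 ((isMIntegralCurveOn_iff_isTangentAt hJ).1 hd)
    (fun t _ => (hc y hy t).1) hdU (hdy.trans (hc0 y hy).symm) ht

end Flow

/-! ### Local retractions onto the fibres of a submersion. -/

section Retraction

/-- Move `x` in the direction of a linear right inverse `σ` of the differential until the prescribed
value is reached: `ρ (x, y) = x + σ b` with `g (x + σ b) = y`. The inverse function theorem solves
for `b`, and `b = 0` when `y = g x`. -/
theorem exists_retraction_of_contDiffAt {E B : Type*} [NormedAddCommGroup E] [NormedSpace ℝ E]
    [FiniteDimensional ℝ E] [NormedAddCommGroup B] [NormedSpace ℝ B] [FiniteDimensional ℝ B]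
    {g : E → B} {x₀ : E} {n : WithTop ℕ∞} (hn : n ≠ 0) (hg : ContDiffAt ℝ n g x₀)
    (hs : Function.Surjective (fderiv ℝ g x₀)) :
    ∃ ρ : E × B → E, ContDiffAt ℝ n ρ (x₀, g x₀) ∧ ρ (x₀, g x₀) = x₀ ∧
      (∀ᶠ q in 𝓝 (x₀, g x₀), g (ρ q) = q.2) ∧ ∀ᶠ x in 𝓝 x₀, ρ (x, g x) = x := by
  have := FiniteDimensional.complete ℝ E
  have := FiniteDimensional.complete ℝ B
  obtain ⟨σ₀, hσ₀⟩ := (fderiv ℝ g x₀).toLinearMap.exists_rightInverse_of_surjective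
    (LinearMap.range_eq_top.2 hs)
  set σ : B →L[ℝ] E := LinearMap.toContinuousLinearMap σ₀
  have hσ : ∀ b, fderiv ℝ g x₀ (σ b) = b := fun b => LinearMap.congr_fun hσ₀ b
  set k : E × B → E := fun q => q.1 + σ q.2 with hk
  have hkd : ContDiffAt ℝ n k (x₀, 0) := by fun_prop
  have hk0 : k (x₀, 0) = x₀ := by simp [hk]
  set Θ : E × B → E × B := fun q => (q.1, g (k q))
  have hgk : ContDiffAt ℝ n (fun q => g (k q)) (x₀, 0) :=
    ContDiffAt.comp (x₀, (0 : B)) (by rwa [hk0]) hkd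
  have hΘ : ContDiffAt ℝ n Θ (x₀, 0) := contDiffAt_fst.prodMk hgk
  -- The differential of `Θ` at `(x₀, 0)` is triangular, `(v, b) ↦ (v, dg v + b)`, because `dg ∘ σ =
  -- id`.
  let e : (E × B) ≃L[ℝ] (E × B) := ContinuousLinearEquiv.equivOfInverse
    ((ContinuousLinearMap.fst ℝ E B).prod
      ((fderiv ℝ g x₀).comp (ContinuousLinearMap.fst ℝ E B) + ContinuousLinearMap.snd ℝ E B))
    ((ContinuousLinearMap.fst ℝ E B).prod
      (ContinuousLinearMap.snd ℝ E B - (fderiv ℝ g x₀).comp (ContinuousLinearMap.fst ℝ E B)))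
    (fun q => by simp) (fun q => by simp)
  have hΘ' : HasFDerivAt Θ (e : E × B →L[ℝ] E × B) (x₀, 0) := by
    have h1 : HasFDerivAt k (ContinuousLinearMap.fst ℝ E B + σ.comp (ContinuousLinearMap.snd ℝ E B))
        (x₀, 0) := hasFDerivAt_fst.add (σ.hasFDerivAt.comp _ hasFDerivAt_snd)
    have h2 : HasFDerivAt g (fderiv ℝ g x₀) (k (x₀, 0)) := by
      rw [hk0]; exact (hg.differentiableAt hn).hasFDerivAt
    refine (hasFDerivAt_fst.prodMk (h2.comp _ h1)).congr_fderiv ?_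
    ext q <;> simp [e, hσ]
  set P := hΘ.toOpenPartialHomeomorph Θ hΘ' hn with hP
  have hΘ0 : Θ (x₀, 0) = (x₀, g x₀) := by simp [Θ, hk0]
  have hsrc : (x₀, (0 : B)) ∈ P.source := hΘ.mem_toOpenPartialHomeomorph_source hΘ' hn
  have hcoe : (P : E × B → E × B) = Θ := hΘ.toOpenPartialHomeomorph_coe hΘ' hn
  have htgt : (x₀, g x₀) ∈ P.target := by
    have := P.map_source hsrc
    rwa [hcoe, hΘ0] at this
  have hinv : ContDiffAt ℝ n P.symm (x₀, g x₀) := by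
    have := hΘ.to_localInverse hΘ' hn
    rwa [hΘ0] at this
  have hinv0 : P.symm (x₀, g x₀) = (x₀, 0) := by
    rw [← hΘ0, ← hcoe, P.left_inv hsrc]
  refine ⟨fun q => q.1 + σ (P.symm q).2, ?_, by simp [hinv0], ?_, ?_⟩
  · exact contDiffAt_fst.add (σ.contDiff.contDiffAt.comp _ hinv.snd)
  · filter_upwards [P.open_target.mem_nhds htgt] with q hq
    have h1 := P.right_inv hq
    rw [hcoe] at h1
    have h2 : (P.symm q).1 = q.1 := by have := congrArg Prod.fst h1; exact this
    have h3 : g ((P.symm q).1 + σ (P.symm q).2) = q.2 := by have := congrArg Prod.snd h1; exact this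
    rwa [h2] at h3
  · have hc : ContinuousAt (fun x : E => (x, (0 : B))) x₀ := by fun_prop
    filter_upwards [hc.eventually (P.open_source.mem_nhds hsrc)] with x hx
    have h1 := P.left_inv hx
    rw [hcoe] at h1
    have h2 : Θ (x, 0) = (x, g x) := by simp [Θ, hk]
    rw [h2] at h1
    simp [h1]

variable {E B : Type*} [NormedAddCommGroup E] [NormedSpace ℝ E]
    [FiniteDimensional ℝ E] [NormedAddCommGroup B] [NormedSpace ℝ B] [FiniteDimensional ℝ B]
    {G M : Type*} [TopologicalSpace G] [ChartedSpace E G] [IsManifold 𝓘(ℝ, E) ∞ G]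
    [TopologicalSpace M] [ChartedSpace B M]

/-- A submersion `f` has a local retraction `ρ(·, y)` onto each of its fibres `f = y`, which depends
smoothly on `y`. -/
theorem exists_retraction [IsManifold 𝓘(ℝ, B) ∞ M] {f : G → M} {γ : G}
    (hf : ContMDiffAt 𝓘(ℝ, E) 𝓘(ℝ, B) 3 f γ)
    (hs : Function.Surjective (mfderiv 𝓘(ℝ, E) 𝓘(ℝ, B) f γ)) :
    ∃ ρ : G × M → G, ContMDiffAt (𝓘(ℝ, E).prod 𝓘(ℝ, B)) 𝓘(ℝ, E) 3 ρ (γ, f γ) ∧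
      (∀ᶠ q in 𝓝 (γ, f γ), f (ρ q) = q.2) ∧ ∀ᶠ γ' in 𝓝 γ, ρ (γ', f γ') = γ' := by
  set φ := extChartAt 𝓘(ℝ, E) γ
  set ψ := extChartAt 𝓘(ℝ, B) (f γ)
  have hφ : φ.symm (φ γ) = γ := extChartAt_to_inv (I := 𝓘(ℝ, E)) γ
  have hφs : ContMDiffAt 𝓘(ℝ, E) 𝓘(ℝ, E) 3 φ.symm (φ γ) :=
    (contMDiffOn_extChartAt_symm γ).contMDiffAt
      ((isOpen_extChartAt_target γ).mem_nhds (mem_extChartAt_target (I := 𝓘(ℝ, E)) γ))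
  have hg : ContDiffAt ℝ 3 (ψ ∘ f ∘ φ.symm) (φ γ) := by
    refine contMDiffAt_iff_contDiffAt.1 (ContMDiffAt.comp_of_eq (x := φ γ)
      (contMDiffAt_extChartAt (x := f γ)) (hf.comp_of_eq hφs hφ) (congrArg f hφ))
  have hg0 : (ψ ∘ f ∘ φ.symm) (φ γ) = ψ (f γ) := congrArg (fun γ' => ψ (f γ')) hφ
  have hgs : Function.Surjective (fderiv ℝ (ψ ∘ f ∘ φ.symm) (φ γ)) := by
    have h1 := (hf.mdifferentiableAt (by simp)).mfderiv
    rw [ModelWithCorners.range_eq_univ, fderivWithin_univ] at h1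
    have h2 : mfderiv 𝓘(ℝ, E) 𝓘(ℝ, B) f γ = fderiv ℝ (ψ ∘ f ∘ φ.symm) (φ γ) := h1
    intro b
    obtain ⟨v, hv⟩ := hs b
    exact ⟨v, (DFunLike.congr_fun h2 v).symm.trans hv⟩
  obtain ⟨ρ, h1, h2, h3, h4⟩ := exists_retraction_of_contDiffAt (by simp) hg hgs
  rw [hg0] at h1 h2 h3
  have hpair : ContMDiffAt (𝓘(ℝ, E).prod 𝓘(ℝ, B)) 𝓘(ℝ, E × B) 3
      (fun q : G × M => (φ q.1, ψ q.2)) (γ, f γ) :=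
    ((contMDiffAt_extChartAt (x := γ)).comp_of_eq contMDiffAt_fst rfl).prodMk_space
      ((contMDiffAt_extChartAt (x := f γ)).comp_of_eq contMDiffAt_snd rfl)
  have hρ : ContMDiffAt (𝓘(ℝ, E).prod 𝓘(ℝ, B)) 𝓘(ℝ, E) 3
      (fun q : G × M => ρ (φ q.1, ψ q.2)) (γ, f γ) :=
    ContMDiffAt.comp_of_eq (contMDiffAt_iff_contDiffAt.2 h1) hpair rfl
  have hR : ContMDiffAt (𝓘(ℝ, E).prod 𝓘(ℝ, B)) 𝓘(ℝ, E) 3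
      (fun q : G × M => φ.symm (ρ (φ q.1, ψ q.2))) (γ, f γ) :=
    ContMDiffAt.comp_of_eq hφs hρ h2
  have hR0 : φ.symm (ρ (φ γ, ψ (f γ))) = γ := by rw [h2, hφ]
  refine ⟨fun q => φ.symm (ρ (φ q.1, ψ q.2)), hR, ?_, ?_⟩
  · have c1 : ∀ᶠ q : G × M in 𝓝 (γ, f γ), f (φ.symm (ρ (φ q.1, ψ q.2))) ∈ ψ.source := by
      have : ContinuousAt (fun q : G × M => f (φ.symm (ρ (φ q.1, ψ q.2)))) (γ, f γ) :=
        ContinuousAt.comp_of_eq hf.continuousAt hR.continuousAt hR0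
      refine this.eventually ((isOpen_extChartAt_source (I := 𝓘(ℝ, B)) (f γ)).mem_nhds ?_)
      simp only [hR0]
      exact mem_extChartAt_source (I := 𝓘(ℝ, B)) (f γ)
    have c2 : ∀ᶠ q : G × M in 𝓝 (γ, f γ), q.2 ∈ ψ.source :=
      continuousAt_snd.eventually
        ((isOpen_extChartAt_source (I := 𝓘(ℝ, B)) (f γ)).mem_nhds (mem_extChartAt_source _))
    filter_upwards [c1, c2, hpair.continuousAt.eventually h3] with q e1 e2 e3
    exact ψ.injOn e1 e2 e3
  · have c1 : ∀ᶠ γ' in 𝓝 γ, γ' ∈ φ.source :=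
      (isOpen_extChartAt_source (I := 𝓘(ℝ, E)) γ).mem_nhds (mem_extChartAt_source _)
    filter_upwards [c1, (continuousAt_extChartAt (I := 𝓘(ℝ, E)) γ).eventually h4] with γ' e1 e2
    have e3 : (ψ ∘ f ∘ φ.symm) (φ γ') = ψ (f γ') := congrArg (fun x => ψ (f x)) (φ.left_inv e1)
    rw [e3] at e2
    rw [e2]
    exact φ.left_inv e1

end Retraction

/-! ### Velocities of curves, a tool to compute differentials. -/

section Velocity

variable {F F' F'' H H' H'' N N' N'' : Type*} [NormedAddCommGroup F] [NormedSpace ℝ F]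
  [TopologicalSpace H] {I : ModelWithCorners ℝ F H} [TopologicalSpace N] [ChartedSpace H N]
  [NormedAddCommGroup F'] [NormedSpace ℝ F'] [TopologicalSpace H']
  {I' : ModelWithCorners ℝ F' H'} [TopologicalSpace N'] [ChartedSpace H' N']

/-- The curve `c` passes through `x` at time `0`, with velocity `v`. -/
def HasVelocity (I : ModelWithCorners ℝ F H) (c : ℝ → N) (x : N) (v : F) : Prop :=
  c 0 = x ∧ HasMFDerivAt 𝓘(ℝ, ℝ) I c 0 ((1 : ℝ →L[ℝ] ℝ).smulRight v : ℝ →L[ℝ] F)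

theorem HasVelocity.congr {c c' : ℝ → N} {x : N} {v : F} (h : HasVelocity I c x v)
    (hc : c' =ᶠ[𝓝 0] c) : HasVelocity I c' x v :=
  ⟨hc.eq_of_nhds.trans h.1, h.2.congr_of_eventuallyEq hc⟩

/-- The main device for identities between differentials: realize the vectors by curves, and reduce
to an equality of curves near time `0`, which the groupoid axioms supply. -/
theorem HasVelocity.unique {c c' : ℝ → N} {x x' : N} {v v' : F} (h : HasVelocity I c x v)
    (h' : HasVelocity I c' x' v') (hc : c =ᶠ[𝓝 0] c') : v = v' := by
  have h1 := hasMFDerivAt_unique (h'.congr hc).2 h.2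
  have h2 : ((1 : ℝ →L[ℝ] ℝ).smulRight v' : ℝ →L[ℝ] F) 1 = (1 : ℝ →L[ℝ] ℝ).smulRight v 1 :=
    DFunLike.congr_fun h1 (1 : ℝ)
  simpa using h2.symm

theorem hasVelocity_const (x : N) : HasVelocity I (fun _ => x) x 0 :=
  ⟨rfl, (hasMFDerivAt_const x 0).congr_mfderiv (ContinuousLinearMap.ext fun τ : ℝ =>
      (smul_zero (A := F) τ).symm)⟩

theorem HasVelocity.continuousAt {c : ℝ → N} {x : N} {v : F} (h : HasVelocity I c x v) :
    ContinuousAt c 0 := h.2.continuousAt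

theorem HasVelocity.eventually {c : ℝ → N} {x : N} {v : F} (h : HasVelocity I c x v)
    {P : N → Prop} (hP : ∀ᶠ y in 𝓝 x, P y) : ∀ᶠ t in 𝓝 0, P (c t) :=
  h.continuousAt.eventually (by rwa [h.1])

theorem HasVelocity.comp {c : ℝ → N} {x : N} {v : F} (h : HasVelocity I c x v) {f : N → N'}
    (hf : MDifferentiableAt I I' f x) :
    HasVelocity I' (fun t => f (c t)) (f x) (mfderiv I I' f x v) := by
  obtain ⟨rfl, h⟩ := h
  refine ⟨rfl, (hf.hasMFDerivAt.comp (0 : ℝ) h).congr_mfderiv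
      (ContinuousLinearMap.ext fun τ : ℝ => ?_)⟩
  exact map_smul (mfderiv I I' f (c 0)) τ _

/-- On a submanifold of positive codimension `mfderivWithin` is one choice among several linear
maps. Its value is determined on velocities of curves in the set, and these are the vectors to which
it is applied meaningfully. -/
theorem HasVelocity.comp_within {c : ℝ → N} {x : N} {v : F} (h : HasVelocity I c x v)
    {f : N → N'} {S : Set N} (hf : MDifferentiableWithinAt I I' f S x)
    (hc : ∀ᶠ t in 𝓝 0, c t ∈ S) :
    HasVelocity I' (fun t => f (c t)) (f x) (mfderivWithin I I' f S x v) := by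
  obtain ⟨rfl, h⟩ := h
  refine ⟨rfl, ?_⟩
  have h1 := (HasMFDerivWithinAt.comp (g := f) (f := c) (u := S) (s := c ⁻¹' S) (0 : ℝ)
    hf.hasMFDerivWithinAt h.hasMFDerivWithinAt subset_rfl).hasMFDerivAt hc
  refine h1.congr_mfderiv (ContinuousLinearMap.ext fun τ : ℝ => ?_)
  exact map_smul (mfderivWithin I I' f S (c 0)) τ _

theorem HasVelocity.prodMk {c : ℝ → N} {x : N} {v : F} (h : HasVelocity I c x v)
    {c' : ℝ → N'} {x' : N'} {v' : F'} (h' : HasVelocity I' c' x' v') :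
    HasVelocity (I.prod I') (fun t => (c t, c' t)) (x, x') (v, v') := by
  obtain ⟨rfl, h⟩ := h
  obtain ⟨rfl, h'⟩ := h'
  exact ⟨rfl, (h.prodMk h').congr_mfderiv (ContinuousLinearMap.ext fun τ => rfl)⟩

theorem hasVelocity_iff_hasDerivAt {c : ℝ → F} {x v : F} :
    HasVelocity 𝓘(ℝ, F) c x v ↔ c 0 = x ∧ HasDerivAt c v 0 := by
  refine and_congr_right fun _ => ?_
  have e : ((1 : ℝ →L[ℝ] ℝ).smulRight v : ℝ →L[ℝ] F) = ContinuousLinearMap.toSpanSingleton ℝ v := by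
    ext; simp
  have h1 : HasMFDerivAt 𝓘(ℝ, ℝ) 𝓘(ℝ, F) c 0 ((1 : ℝ →L[ℝ] ℝ).smulRight v : ℝ →L[ℝ] F) ↔
      HasFDerivAt c ((1 : ℝ →L[ℝ] ℝ).smulRight v : ℝ →L[ℝ] F) 0 := hasMFDerivAt_iff_hasFDerivAt
  refine h1.trans ?_
  rw [e]
  exact Iff.rfl

theorem exists_hasVelocity [I.Boundaryless] [IsManifold I 1 N] (x : N) (v : F) :
    ∃ c : ℝ → N, HasVelocity I c x v := by
  have h1 : HasVelocity 𝓘(ℝ, F) (fun t : ℝ => extChartAt I x x + t • v) (extChartAt I x x) v := by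
    refine hasVelocity_iff_hasDerivAt.2 ⟨by simp, ?_⟩
    simpa using ((hasDerivAt_id (0 : ℝ)).smul_const v).const_add (extChartAt I x x)
  have h2 := h1.comp (mdifferentiableAt_extChartAt_symm' (mem_extChartAt_target (I := I) x))
  have h3 := mfderiv_symm_comp_extChartAt (I := I) (x := x) (mem_extChartAt_source x) v
  rw [mfderiv_extChartAt_self] at h3
  exact ⟨_, (h2.1.trans (extChartAt_to_inv (I := I) x)),
    h2.2.congr_mfderiv (congrArg (fun w : F => ((1 : ℝ →L[ℝ] ℝ).smulRight w : ℝ →L[ℝ] F)) h3)⟩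

variable {E B : Type*} [NormedAddCommGroup E] [NormedSpace ℝ E]
    [NormedAddCommGroup B] [NormedSpace ℝ B]
    {G M : Type*} [TopologicalSpace G] [ChartedSpace E G] [IsManifold 𝓘(ℝ, E) ∞ G]
    [TopologicalSpace M] [ChartedSpace B M]

theorem mfderiv_retraction {f : G → M} {γ : G} {ρ : G × M → G}
    (hf : MDifferentiableAt 𝓘(ℝ, E) 𝓘(ℝ, B) f γ)
    (hρ : MDifferentiableAt (𝓘(ℝ, E).prod 𝓘(ℝ, B)) 𝓘(ℝ, E) ρ (γ, f γ))
    (h : ∀ᶠ γ' in 𝓝 γ, ρ (γ', f γ') = γ') (v : E) :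
    (mfderiv (𝓘(ℝ, E).prod 𝓘(ℝ, B)) 𝓘(ℝ, E) ρ (γ, f γ) : E × B → E)
      (v, (mfderiv 𝓘(ℝ, E) 𝓘(ℝ, B) f γ : E → B) v) = v := by
  obtain ⟨c, hc⟩ := exists_hasVelocity (I := 𝓘(ℝ, E)) γ v
  exact ((hc.prodMk (hc.comp hf)).comp hρ).unique hc (hc.eventually h)

/-- Every vector tangent to a fibre of a submersion is the velocity of a curve in this fibre. -/
theorem exists_hasVelocity_fiber [FiniteDimensional ℝ E] [FiniteDimensional ℝ B] [IsManifold 𝓘(ℝ, B) ∞ M]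
    {f : G → M} {γ : G}
    (hf : ContMDiffAt 𝓘(ℝ, E) 𝓘(ℝ, B) 3 f γ)
    (hs : Function.Surjective (mfderiv 𝓘(ℝ, E) 𝓘(ℝ, B) f γ)) {v : E}
    (hv : (mfderiv 𝓘(ℝ, E) 𝓘(ℝ, B) f γ : E → B) v = 0) :
    ∃ c : ℝ → G, HasVelocity 𝓘(ℝ, E) c γ v ∧ ∀ᶠ t in 𝓝 0, f (c t) = f γ := by
  obtain ⟨ρ, h1, h2, h3⟩ := exists_retraction hf hs
  obtain ⟨c, hc⟩ := exists_hasVelocity (I := 𝓘(ℝ, E)) γ v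
  have h4 := hc.prodMk (hasVelocity_const (I := 𝓘(ℝ, B)) (f γ))
  have h5 := h4.comp (h1.mdifferentiableAt (by simp))
  -- Retracting an arbitrary curve onto the fibre keeps its velocity, since `dρ (v, df v) = v` and
  -- `df v = 0`.
  have h6 := mfderiv_retraction (hf.mdifferentiableAt (by simp))
    (h1.mdifferentiableAt (by simp)) h3 v
  rw [hv] at h6
  refine ⟨_, ⟨h5.1.trans h3.self_of_nhds, h5.2.congr_mfderiv
    (congrArg (fun w : E => ((1 : ℝ →L[ℝ] ℝ).smulRight w : ℝ →L[ℝ] E)) h6)⟩, h4.eventually h2⟩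

end Velocity

theorem HasVelocity.congr_point {F H N : Type*} [NormedAddCommGroup F] [NormedSpace ℝ F]
    [TopologicalSpace H] {I : ModelWithCorners ℝ F H} [TopologicalSpace N] [ChartedSpace H N]
    {c : ℝ → N} {x x' : N} {v : F} (h : HasVelocity I c x v) (e : x = x') :
    HasVelocity I c x' v := ⟨h.1.trans e, h.2⟩

theorem HasVelocity.congr_vec {F H N : Type*} [NormedAddCommGroup F] [NormedSpace ℝ F]
    [TopologicalSpace H] {I : ModelWithCorners ℝ F H} [TopologicalSpace N] [ChartedSpace H N]
    {c : ℝ → N} {x : N} {v v' : F} (h : HasVelocity I c x v) (e : v = v') :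
    HasVelocity I c x v' := e ▸ h

/-! ### Differentials of the groupoid operations. -/

namespace LieGroupoid

section Velocity

variable {E B G M : Type*}
  [NormedAddCommGroup E] [NormedSpace ℝ E] [NormedAddCommGroup B] [NormedSpace ℝ B]
  [TopologicalSpace G] [ChartedSpace E G] [TopologicalSpace M] [ChartedSpace B M]
  (𝒢 : LieGroupoid E B G M)

theorem mdifferentiableAt_r (γ : G) : MDifferentiableAt 𝓘(ℝ, E) 𝓘(ℝ, B) 𝒢.r γ :=
  𝒢.r.contMDiff.mdifferentiableAt (by simp)

theorem mdifferentiableAt_s (γ : G) : MDifferentiableAt 𝓘(ℝ, E) 𝓘(ℝ, B) 𝒢.s γ :=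
  𝒢.s.contMDiff.mdifferentiableAt (by simp)

theorem mdifferentiableAt_inv (γ : G) : MDifferentiableAt 𝓘(ℝ, E) 𝓘(ℝ, E) 𝒢.inv γ :=
  𝒢.inv.contMDiff.mdifferentiableAt (by simp)

theorem mdifferentiableAt_unit (x : M) : MDifferentiableAt 𝓘(ℝ, B) 𝓘(ℝ, E) 𝒢.unit x :=
  𝒢.unit.contMDiff.mdifferentiableAt (by simp)

theorem mdifferentiableWithinAt_mul {γ₁ γ₂ : G} (h : 𝒢.s γ₁ = 𝒢.r γ₂) :
    MDifferentiableWithinAt (𝓘(ℝ, E).prod 𝓘(ℝ, E)) 𝓘(ℝ, E) (fun p : G × G => 𝒢.mul p.1 p.2)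
      {p | 𝒢.s p.1 = 𝒢.r p.2} (γ₁, γ₂) :=
  (𝒢.mul_smooth (γ₁, γ₂) h).mdifferentiableWithinAt (by simp)

theorem inv_unit (x : M) : 𝒢.inv (𝒢.unit x) = 𝒢.unit x := by
  have h1 := 𝒢.mul_inv (𝒢.unit x)
  have h2 := 𝒢.unit_mul (𝒢.inv (𝒢.unit x))
  rw [𝒢.r_inv, 𝒢.s_unit] at h2
  rw [h2, 𝒢.r_unit] at h1
  exact h1

variable {𝒢}

theorem hasVelocity_mul {γ₁ γ₂ : G} {c₁ c₂ : ℝ → G} {t₁ t₂ : E}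
    (h₁ : HasVelocity 𝓘(ℝ, E) c₁ γ₁ t₁) (h₂ : HasVelocity 𝓘(ℝ, E) c₂ γ₂ t₂)
    (h : ∀ᶠ t in 𝓝 0, 𝒢.s (c₁ t) = 𝒢.r (c₂ t)) :
    HasVelocity 𝓘(ℝ, E) (fun t => 𝒢.mul (c₁ t) (c₂ t)) (𝒢.mul γ₁ γ₂) (𝒢.dMul γ₁ γ₂ t₁ t₂) := by
  have h0 := h.self_of_nhds
  rw [h₁.1, h₂.1] at h0
  exact (h₁.prodMk h₂).comp_within (𝒢.mdifferentiableWithinAt_mul h0) h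

theorem dMul_add {γ₁ γ₂ : G} (t₁ t₂ t₁' t₂' : E) :
    (𝒢.dMul γ₁ γ₂ (t₁ + t₁' : E) (t₂ + t₂' : E) : E) =
      𝒢.dMul γ₁ γ₂ t₁ t₂ + 𝒢.dMul γ₁ γ₂ t₁' t₂' :=
  map_add (mfderivWithin (𝓘(ℝ, E).prod 𝓘(ℝ, E)) 𝓘(ℝ, E) (fun p : G × G => 𝒢.mul p.1 p.2)
    {p | 𝒢.s p.1 = 𝒢.r p.2} (γ₁, γ₂) : E × E →L[ℝ] E) (t₁, t₂) (t₁', t₂')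

theorem hasVelocity_mul_const {γ : G} {α : ℝ → G} {v : E}
    (hα : HasVelocity 𝓘(ℝ, E) α (𝒢.unit (𝒢.r γ)) v) (h : ∀ᶠ t in 𝓝 0, 𝒢.s (α t) = 𝒢.r γ) :
    HasVelocity 𝓘(ℝ, E) (fun t => 𝒢.mul (α t) γ) γ (𝒢.dRight γ v) := by
  have h1 : MDifferentiableWithinAt 𝓘(ℝ, E) 𝓘(ℝ, E) (fun α => 𝒢.mul α γ) {α | 𝒢.s α = 𝒢.r γ}
      (𝒢.unit (𝒢.r γ)) := by
    have h2 : MDifferentiableWithinAt 𝓘(ℝ, E) (𝓘(ℝ, E).prod 𝓘(ℝ, E)) (fun α : G => (α, γ))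
        {α | 𝒢.s α = 𝒢.r γ} (𝒢.unit (𝒢.r γ)) :=
      (mdifferentiableAt_id.prodMk mdifferentiableAt_const).mdifferentiableWithinAt
    exact MDifferentiableWithinAt.comp (g := fun p : G × G => 𝒢.mul p.1 p.2)
      (f := fun α : G => (α, γ)) (𝒢.unit (𝒢.r γ))
      (𝒢.mdifferentiableWithinAt_mul (𝒢.s_unit _)) h2 (fun α hα => hα)
  exact (hα.comp_within h1 h).congr_point (𝒢.unit_mul γ)

theorem hasVelocity_const_mul_inv {γ : G} {α : ℝ → G} {v : E}
    (hα : HasVelocity 𝓘(ℝ, E) α (𝒢.unit (𝒢.s γ)) v) (h : ∀ᶠ t in 𝓝 0, 𝒢.s (α t) = 𝒢.s γ) :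
    HasVelocity 𝓘(ℝ, E) (fun t => 𝒢.mul γ (𝒢.inv (α t))) γ (𝒢.dLeftInv γ v) := by
  have h1 : MDifferentiableWithinAt 𝓘(ℝ, E) 𝓘(ℝ, E) (fun α => 𝒢.mul γ (𝒢.inv α))
      {α | 𝒢.s α = 𝒢.s γ} (𝒢.unit (𝒢.s γ)) := by
    have h2 : MDifferentiableWithinAt 𝓘(ℝ, E) (𝓘(ℝ, E).prod 𝓘(ℝ, E)) (fun α : G => (γ, 𝒢.inv α))
        {α | 𝒢.s α = 𝒢.s γ} (𝒢.unit (𝒢.s γ)) :=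
      (mdifferentiableAt_const.prodMk (𝒢.mdifferentiableAt_inv _)).mdifferentiableWithinAt
    refine MDifferentiableWithinAt.comp (g := fun p : G × G => 𝒢.mul p.1 p.2)
      (f := fun α : G => (γ, 𝒢.inv α)) (𝒢.unit (𝒢.s γ))
      (𝒢.mdifferentiableWithinAt_mul ?_) h2 (fun α (hα : 𝒢.s α = 𝒢.s γ) => ?_)
    · rw [𝒢.r_inv, 𝒢.s_unit]
    · simp only [mem_preimage, mem_ofPred_eq, 𝒢.r_inv, hα]
  refine (hα.comp_within h1 h).congr_point ?_
  rw [𝒢.inv_unit, 𝒢.mul_unit]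

variable [FiniteDimensional ℝ E] [FiniteDimensional ℝ B] [IsManifold 𝓘(ℝ, E) ∞ G]
  [IsManifold 𝓘(ℝ, B) ∞ M]

theorem exists_hasVelocity_algebroid {x : M} {v : E}
    (hv : (mfderiv 𝓘(ℝ, E) 𝓘(ℝ, B) 𝒢.s (𝒢.unit x) v : B) = 0) :
    ∃ α : ℝ → G, HasVelocity 𝓘(ℝ, E) α (𝒢.unit x) v ∧ ∀ᶠ t in 𝓝 0, 𝒢.s (α t) = x := by
  have h := exists_hasVelocity_fiber ((𝒢.s.contMDiff (𝒢.unit x)).of_le (by norm_cast))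
    (𝒢.s_submersion _) hv
  rwa [𝒢.s_unit] at h

theorem exists_hasVelocity_r_fiber {γ : G} {v : E}
    (hv : (mfderiv 𝓘(ℝ, E) 𝓘(ℝ, B) 𝒢.r γ v : B) = 0) :
    ∃ α : ℝ → G, HasVelocity 𝓘(ℝ, E) α γ v ∧ ∀ᶠ t in 𝓝 0, 𝒢.r (α t) = 𝒢.r γ :=
  exists_hasVelocity_fiber ((𝒢.r.contMDiff γ).of_le (by norm_cast)) (𝒢.r_submersion _) hv

theorem mfderiv_s_dRight {γ : G} {v : E}
    (hv : (mfderiv 𝓘(ℝ, E) 𝓘(ℝ, B) 𝒢.s (𝒢.unit (𝒢.r γ)) v : B) = 0) :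
    (mfderiv 𝓘(ℝ, E) 𝓘(ℝ, B) 𝒢.s γ (𝒢.dRight γ v) : B) = 0 := by
  obtain ⟨α, hα, hs⟩ := exists_hasVelocity_algebroid hv
  refine ((hasVelocity_mul_const hα hs).comp (𝒢.mdifferentiableAt_s γ)).unique
    (hasVelocity_const (𝒢.s γ)) ?_
  filter_upwards [hs] with t ht
  exact 𝒢.s_mul _ _ ht

theorem mfderiv_s_dLeftInv {γ : G} {v : E}
    (hv : (mfderiv 𝓘(ℝ, E) 𝓘(ℝ, B) 𝒢.s (𝒢.unit (𝒢.s γ)) v : B) = 0) :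
    (mfderiv 𝓘(ℝ, E) 𝓘(ℝ, B) 𝒢.s γ (𝒢.dLeftInv γ v) : B) =
      mfderiv 𝓘(ℝ, E) 𝓘(ℝ, B) 𝒢.r (𝒢.unit (𝒢.s γ)) v := by
  obtain ⟨α, hα, hs⟩ := exists_hasVelocity_algebroid hv
  refine ((hasVelocity_const_mul_inv hα hs).comp (𝒢.mdifferentiableAt_s γ)).unique
    (hα.comp (𝒢.mdifferentiableAt_r _)) ?_
  filter_upwards [hs] with t ht
  rw [𝒢.s_mul _ _ (by rw [𝒢.r_inv, ht]), 𝒢.s_inv]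

/-- Along a curve in the fibre of `s` over `x`, right multiplication by the unit at `x` is the
identity. -/
theorem dRight_unit {x : M} {v : E}
    (hv : (mfderiv 𝓘(ℝ, E) 𝓘(ℝ, B) 𝒢.s (𝒢.unit x) v : B) = 0) :
    (𝒢.dRight (𝒢.unit x) v : E) = v := by
  obtain ⟨α, hα, hs⟩ := exists_hasVelocity_algebroid hv
  refine (hasVelocity_mul_const (γ := 𝒢.unit x) (α := α) (v := v) ?_ ?_).unique hα ?_
  · rwa [𝒢.r_unit]
  · rwa [𝒢.r_unit]
  · filter_upwards [hs] with t ht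
    conv_rhs => rw [← 𝒢.mul_unit (α t), ht]

/-- Differentiate `α α⁻¹ = υ (r α)`, where `υ` is the unit map. With `w` the velocity of `α⁻¹`,
additivity of `dm` gives `v + w = dυ (dr v)`, while `ds w = dr v`; hence `w - dυ (ds w) = -v`. This
sign cancels the one in the definition of `sCot`. -/
theorem dLeftInv_unit {x : M} {v : E}
    (hv : (mfderiv 𝓘(ℝ, E) 𝓘(ℝ, B) 𝒢.s (𝒢.unit x) v : B) = 0) :
    𝒢.unitProj x (𝒢.dLeftInv (𝒢.unit x) v : E) = (-v : E) := by
  obtain ⟨α, hα, hs⟩ := exists_hasVelocity_algebroid hv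
  have h1 : HasVelocity 𝓘(ℝ, E) (fun t => 𝒢.inv (α t)) (𝒢.unit x) (𝒢.dLeftInv (𝒢.unit x) v) := by
    refine (hasVelocity_const_mul_inv (γ := 𝒢.unit x) (α := α) (v := v) ?_ ?_).congr ?_
    · rwa [𝒢.s_unit]
    · rwa [𝒢.s_unit]
    · filter_upwards [hs] with t ht
      conv_lhs => rw [← 𝒢.unit_mul (𝒢.inv (α t)), 𝒢.r_inv, ht]
  set w : E := 𝒢.dLeftInv (𝒢.unit x) v
  have h2 : (mfderiv 𝓘(ℝ, E) 𝓘(ℝ, B) 𝒢.s (𝒢.unit x) w : B) =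
      mfderiv 𝓘(ℝ, E) 𝓘(ℝ, B) 𝒢.r (𝒢.unit x) v := by
    refine (h1.comp (𝒢.mdifferentiableAt_s _)).unique (hα.comp (𝒢.mdifferentiableAt_r _)) ?_
    filter_upwards [hs] with t ht
    rw [𝒢.s_inv]
  have h3 : HasVelocity 𝓘(ℝ, E) (fun t => 𝒢.unit (𝒢.r (α t))) (𝒢.unit x)
      (mfderiv 𝓘(ℝ, B) 𝓘(ℝ, E) 𝒢.unit x (mfderiv 𝓘(ℝ, E) 𝓘(ℝ, B) 𝒢.r (𝒢.unit x) v)) := by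
    have h4 := (hα.comp (𝒢.mdifferentiableAt_r _)).congr_point (𝒢.r_unit x)
    exact h4.comp (𝒢.mdifferentiableAt_unit x)
  have h5 : (𝒢.dMul (𝒢.unit x) (𝒢.unit x) v w : E) =
      mfderiv 𝓘(ℝ, B) 𝓘(ℝ, E) 𝒢.unit x (mfderiv 𝓘(ℝ, E) 𝓘(ℝ, B) 𝒢.r (𝒢.unit x) v) := by
    refine (hasVelocity_mul (𝒢 := 𝒢) hα h1 ?_).unique h3 ?_
    · filter_upwards with t
      rw [𝒢.r_inv]
    · filter_upwards with t
      rw [𝒢.mul_inv]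
  have h6 : (𝒢.dMul (𝒢.unit x) (𝒢.unit x) v (0 : E) : E) = v := by
    refine (hasVelocity_mul (𝒢 := 𝒢) hα (hasVelocity_const (𝒢.unit x)) ?_).unique hα ?_
    · filter_upwards [hs] with t ht
      rw [𝒢.r_unit, ht]
    · filter_upwards [hs] with t ht
      conv_rhs => rw [← 𝒢.mul_unit (α t), ht]
  have h7 : (𝒢.dMul (𝒢.unit x) (𝒢.unit x) (0 : E) w : E) = w := by
    refine (hasVelocity_mul (𝒢 := 𝒢) (hasVelocity_const (𝒢.unit x)) h1 ?_).unique h1 ?_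
    · filter_upwards [hs] with t ht
      rw [𝒢.s_unit, 𝒢.r_inv, ht]
    · filter_upwards [hs] with t ht
      conv_rhs => rw [← 𝒢.unit_mul (𝒢.inv (α t)), 𝒢.r_inv, ht]
  have h8 := dMul_add (𝒢 := 𝒢) (γ₁ := 𝒢.unit x) (γ₂ := 𝒢.unit x) v 0 0 w
  rw [add_zero, zero_add, h5, h6, h7, ← h2] at h8
  have h9 (u : E) (hu : (mfderiv 𝓘(ℝ, B) 𝓘(ℝ, E) 𝒢.unit x
      (mfderiv 𝓘(ℝ, E) 𝓘(ℝ, B) 𝒢.s (𝒢.unit x) w) : E) = u) : (𝒢.unitProj x w : E) = w - u :=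
    congrArg (fun e : E => w - e) hu
  have h10 (a b : E) : a - (b + a) = -b := by abel
  exact (h9 _ h8).trans (h10 w v)

end Velocity

end LieGroupoid

theorem cotMk_eq {E G : Type*} [NormedAddCommGroup E] [NormedSpace ℝ E] [TopologicalSpace G]
    [ChartedSpace E G] [IsManifold 𝓘(ℝ, E) ∞ G] {γ γ' : G} {ξ ξ' : E →L[ℝ] ℝ} (h : γ = γ')
    (hξ : ∀ v, ξ v = ξ' v) :
    (cotMk γ ξ : CotangentBundle E G) = cotMk γ' ξ' := by
  obtain rfl : ξ = ξ' := ContinuousLinearMap.ext hξ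
  subst h
  rfl

/-! ### The structure maps of `T*G` and its units. -/

namespace LieGroupoid

section CotangentGroupoid

variable {E B G M : Type*}
  [NormedAddCommGroup E] [NormedSpace ℝ E] [NormedAddCommGroup B] [NormedSpace ℝ B]
  [TopologicalSpace G] [ChartedSpace E G] [TopologicalSpace M] [ChartedSpace B M]
  {𝒢 : LieGroupoid E B G M}

/-- Replaces equality of dependent pairs by an equality of base points and of values on vectors of
the fixed model space, so that transports along equal base points disappear. -/
theorem dualAlgebroid_mk_eq_iff {x x' : M} {L : TangentSpace 𝓘(ℝ, E) (𝒢.unit x) →L[ℝ] ℝ}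
    {L' : TangentSpace 𝓘(ℝ, E) (𝒢.unit x') →L[ℝ] ℝ} :
    (⟨x, L.comp (𝒢.algebroid x).subtypeL⟩ : 𝒢.DualAlgebroid) =
      ⟨x', L'.comp (𝒢.algebroid x').subtypeL⟩ ↔
    x = x' ∧ ∀ v : E, (mfderiv 𝓘(ℝ, E) 𝓘(ℝ, B) 𝒢.s (𝒢.unit x) v : B) = 0 → L v = L' v := by
  constructor
  · intro h
    obtain ⟨h1, h2⟩ := Sigma.mk.inj_iff.1 h
    subst h1
    exact ⟨rfl, fun v hv => DFunLike.congr_fun (eq_of_heq h2)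
        (⟨v, LinearMap.mem_ker.2 hv⟩ : 𝒢.algebroid x)⟩
  · rintro ⟨rfl, h⟩
    exact congrArg (Sigma.mk x) (ContinuousLinearMap.ext fun v => h v.1 (LinearMap.mem_ker.1 v.2))

theorem rCot_eq_rCot_iff {δ δ' : CotangentBundle E G} : 𝒢.rCot δ = 𝒢.rCot δ' ↔
    𝒢.r δ.proj = 𝒢.r δ'.proj ∧ ∀ v : E,
      (mfderiv 𝓘(ℝ, E) 𝓘(ℝ, B) 𝒢.s (𝒢.unit (𝒢.r δ.proj)) v : B) = 0 →
        cotForm δ (𝒢.dRight δ.proj v) = cotForm δ' (𝒢.dRight δ'.proj v) :=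
  dualAlgebroid_mk_eq_iff (L := (cotForm δ).comp (𝒢.dRight δ.proj))
    (L' := (cotForm δ').comp (𝒢.dRight δ'.proj))

theorem sCot_eq_rCot_iff {δ δ' : CotangentBundle E G} : 𝒢.sCot δ = 𝒢.rCot δ' ↔
    𝒢.s δ.proj = 𝒢.r δ'.proj ∧ ∀ v : E,
      (mfderiv 𝓘(ℝ, E) 𝓘(ℝ, B) 𝒢.s (𝒢.unit (𝒢.s δ.proj)) v : B) = 0 →
        -cotForm δ (𝒢.dLeftInv δ.proj v) = cotForm δ' (𝒢.dRight δ'.proj v) :=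
  dualAlgebroid_mk_eq_iff (L := -(cotForm δ).comp (𝒢.dLeftInv δ.proj))
    (L' := (cotForm δ').comp (𝒢.dRight δ'.proj))

theorem sCot_eq_sCot_iff {δ δ' : CotangentBundle E G} : 𝒢.sCot δ = 𝒢.sCot δ' ↔
    𝒢.s δ.proj = 𝒢.s δ'.proj ∧ ∀ v : E,
      (mfderiv 𝓘(ℝ, E) 𝓘(ℝ, B) 𝒢.s (𝒢.unit (𝒢.s δ.proj)) v : B) = 0 →
        -cotForm δ (𝒢.dLeftInv δ.proj v) = -cotForm δ' (𝒢.dLeftInv δ'.proj v) :=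
  dualAlgebroid_mk_eq_iff (L := -(cotForm δ).comp (𝒢.dLeftInv δ.proj))
    (L' := -(cotForm δ').comp (𝒢.dLeftInv δ'.proj))

theorem mem_domCot_iff {δ : CotangentBundle E G} : δ ∈ 𝒢.domCot ↔ ∃ v : E,
    (mfderiv 𝓘(ℝ, E) 𝓘(ℝ, B) 𝒢.s (𝒢.unit (𝒢.r δ.proj)) v : B) = 0 ∧
      cotForm δ (𝒢.dRight δ.proj v) ≠ 0 := by
  constructor
  · intro h
    obtain ⟨v, hv⟩ := DFunLike.ne_iff.1 h
    exact ⟨v.1, LinearMap.mem_ker.1 v.2, hv⟩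
  · rintro ⟨v, hv, hv'⟩
    exact DFunLike.ne_iff.2 ⟨⟨v, LinearMap.mem_ker.2 hv⟩, hv'⟩

theorem mem_domCot_of_rCot_eq {δ δ' : CotangentBundle E G} (h : 𝒢.rCot δ = 𝒢.rCot δ')
    (hδ : δ ∈ 𝒢.domCot) : δ' ∈ 𝒢.domCot := by
  rw [domCot, mem_ofPred_eq, h] at hδ
  exact hδ

theorem unitProj_of_mem {x : M} {v : E}
    (hv : (mfderiv 𝓘(ℝ, E) 𝓘(ℝ, B) 𝒢.s (𝒢.unit x) v : B) = 0) :
    (𝒢.unitProj x v : E) = v := by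
  have h (u : E) (hu : (mfderiv 𝓘(ℝ, B) 𝓘(ℝ, E) 𝒢.unit x
      (mfderiv 𝓘(ℝ, E) 𝓘(ℝ, B) 𝒢.s (𝒢.unit x) v) : E) = u) : (𝒢.unitProj x v : E) = v - u :=
    congrArg (fun e : E => v - e) hu
  refine (h 0 ?_).trans (sub_zero v)
  exact (congrArg (fun b : B => (mfderiv 𝓘(ℝ, B) 𝓘(ℝ, E) 𝒢.unit x b : E)) hv).trans
    (map_zero (mfderiv 𝓘(ℝ, B) 𝓘(ℝ, E) 𝒢.unit x))

theorem cotForm_unitCot_of_mem (a : 𝒢.DualAlgebroid) {v w : E}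
    (hw : (𝒢.unitProj a.1 w : E) = v) (hv : v ∈ 𝒢.algebroid a.1) :
    cotForm (𝒢.unitCot a) w = a.2 ⟨v, hv⟩ :=
  congrArg a.2 (Subtype.ext hw)

theorem restrict_cotForm_unitCot (a : 𝒢.DualAlgebroid) :
    (⟨a.1, (cotForm (𝒢.unitCot a)).comp (𝒢.algebroid a.1).subtypeL⟩ : 𝒢.DualAlgebroid) = a :=
  congrArg (Sigma.mk a.1) (ContinuousLinearMap.ext fun v =>
    cotForm_unitCot_of_mem a (unitProj_of_mem (LinearMap.mem_ker.1 v.2)) v.2)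

variable [FiniteDimensional ℝ E] [FiniteDimensional ℝ B] [IsManifold 𝓘(ℝ, E) ∞ G]
  [IsManifold 𝓘(ℝ, B) ∞ M]

theorem rCot_cotMk_unit (x : M) (ξ : E →L[ℝ] ℝ) :
    𝒢.rCot (cotMk (𝒢.unit x) ξ) = ⟨x, ContinuousLinearMap.comp
      (ξ : TangentSpace 𝓘(ℝ, E) (𝒢.unit x) →L[ℝ] ℝ) (𝒢.algebroid x).subtypeL⟩ := by
  refine dualAlgebroid_mk_eq_iff.2 ⟨𝒢.r_unit x, fun v hv => ?_⟩
  change (mfderiv 𝓘(ℝ, E) 𝓘(ℝ, B) 𝒢.s (𝒢.unit (𝒢.r (𝒢.unit x))) v : B) = 0 at hv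
  rw [𝒢.r_unit] at hv
  exact congrArg ξ (dRight_unit hv)

theorem rCot_unitCot (a : 𝒢.DualAlgebroid) : 𝒢.rCot (𝒢.unitCot a) = a :=
  (rCot_cotMk_unit a.1 _).trans (restrict_cotForm_unitCot a)

theorem sCot_unitCot (a : 𝒢.DualAlgebroid) : 𝒢.sCot (𝒢.unitCot a) = a := by
  refine Eq.trans ?_ (restrict_cotForm_unitCot a)
  let L : E →L[ℝ] ℝ := ContinuousLinearMap.comp (cotForm (𝒢.unitCot a) : E →L[ℝ] ℝ)
    (𝒢.dLeftInv (𝒢.unit a.1) : E →L[ℝ] E)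
  refine (dualAlgebroid_mk_eq_iff (L := -L) (L' := cotForm (𝒢.unitCot a))).2
      ⟨𝒢.s_unit a.1, fun v hv => ?_⟩
  have hv' : (mfderiv 𝓘(ℝ, E) 𝓘(ℝ, B) 𝒢.s (𝒢.unit a.1) v : B) = 0 := by
    have h := 𝒢.s_unit a.1
    have h2 := hv
    change (mfderiv 𝓘(ℝ, E) 𝓘(ℝ, B) 𝒢.s (𝒢.unit (𝒢.s (𝒢.unit a.1))) v : B) = 0 at h2
    rwa [h] at h2
  have hm : v ∈ 𝒢.algebroid a.1 := hv'
  have h1 := cotForm_unitCot_of_mem a (dLeftInv_unit hv') ((𝒢.algebroid a.1).neg_mem hm)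
  have h2 := cotForm_unitCot_of_mem a (unitProj_of_mem hv') hm
  have h3 (u : 𝒢.algebroid a.1) : a.2 (-u) = -a.2 u := map_neg a.2 u
  exact (congrArg Neg.neg (h1.trans (h3 ⟨v, hm⟩))).trans ((neg_neg _).trans h2.symm)

theorem unitCot_mem_domCot {a : 𝒢.DualAlgebroid} (ha : a.2 ≠ 0) : 𝒢.unitCot a ∈ 𝒢.domCot := by
  rw [domCot, mem_ofPred_eq, rCot_unitCot]
  exact ha

/-- Write `t₁ = v + dυ (dr t₂)` with `v` in the algebroid. The second part multiplied with `t₂` is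
the derivative of `υ (r c) c = c`, and `v` multiplied with `0` gives `dRight γ v`, on which `δ` is
exactly `rCot δ`. -/
theorem isProductForm_unitCot (δ : CotangentBundle E G) :
    𝒢.IsProductForm (𝒢.unitCot (𝒢.rCot δ)) δ (cotForm δ : E →L[ℝ] ℝ) := by
  intro (t₁ : E) (t₂ : E) ht
  set γ := δ.proj
  set x := 𝒢.r γ
  change (mfderiv 𝓘(ℝ, E) 𝓘(ℝ, B) 𝒢.s (𝒢.unit x) t₁ : B) = _ at ht
  set v : E := 𝒢.unitProj x t₁ with hv
  set w : E := mfderiv 𝓘(ℝ, B) 𝓘(ℝ, E) 𝒢.unit x (mfderiv 𝓘(ℝ, E) 𝓘(ℝ, B) 𝒢.r γ t₂) with hw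
  have hvm : (mfderiv 𝓘(ℝ, E) 𝓘(ℝ, B) 𝒢.s (𝒢.unit x) v : B) = 0 :=
    LinearMap.mem_ker.1 (𝒢.unitProj_mem x t₁)
  have e1 : t₁ = v + w := by
    have h1 (u : E) (hu : (mfderiv 𝓘(ℝ, B) 𝓘(ℝ, E) 𝒢.unit x
      (mfderiv 𝓘(ℝ, E) 𝓘(ℝ, B) 𝒢.s (𝒢.unit x) t₁) : E) = u) : v = t₁ - u :=
      congrArg (fun e : E => t₁ - e) hu
    rw [h1 w (congrArg (fun b : B => (mfderiv 𝓘(ℝ, B) 𝓘(ℝ, E) 𝒢.unit x b : E)) ht)]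
    abel
  obtain ⟨α, hα, hs⟩ := exists_hasVelocity_algebroid hvm
  obtain ⟨c, hc⟩ := exists_hasVelocity (I := 𝓘(ℝ, E)) γ t₂
  have h1 : (𝒢.dMul (𝒢.unit x) γ v (0 : E) : E) = 𝒢.dRight γ v :=
    (hasVelocity_mul (𝒢 := 𝒢) hα (hasVelocity_const γ) hs).unique
      (hasVelocity_mul_const hα hs) (.of_forall fun t => rfl)
  have h2 : (𝒢.dMul (𝒢.unit x) γ w t₂ : E) = t₂ := by
    refine (hasVelocity_mul (𝒢 := 𝒢) ((hc.comp (𝒢.mdifferentiableAt_r _)).comp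
      (𝒢.mdifferentiableAt_unit _)) hc ?_).unique hc ?_
    · exact .of_forall fun t => 𝒢.s_unit _
    · exact .of_forall fun t => 𝒢.unit_mul _
  have h3 := dMul_add (𝒢 := 𝒢) (γ₁ := 𝒢.unit x) (γ₂ := γ) v 0 w t₂
  rw [← e1, zero_add, h1, h2] at h3
  have h4 : cotForm (𝒢.unitCot (𝒢.rCot δ)) t₁ = cotForm δ (𝒢.dRight γ v) := rfl
  rw [h4]
  exact (congrArg (cotForm δ : E →L[ℝ] ℝ) h3).trans (map_add (cotForm δ : E →L[ℝ] ℝ) _ _)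

end CotangentGroupoid

end LieGroupoid

/-! ### Common complements and local inverses. -/

section LocalInverse

/-- The infinitesimal form of a bisection: a subspace transverse to both `ker f` and `ker g`. With
right inverses `σ` of `f` and `τ` of `g`, take `T = σ - u τ`; then `f T = 1 - u (f τ)` and `g T = g
σ - u` are injective for all but finitely many `u`. -/
theorem exists_injective_comp_injective_comp {E B : Type*} [AddCommGroup E] [Module ℝ E]
    [AddCommGroup B] [Module ℝ B] [FiniteDimensional ℝ B] {f g : E →ₗ[ℝ] B}
    (hf : Function.Surjective f) (hg : Function.Surjective g) :
    ∃ T : B →ₗ[ℝ] E, Function.Injective (f ∘ₗ T) ∧ Function.Injective (g ∘ₗ T) := by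
  obtain ⟨σ, hσ⟩ := f.exists_rightInverse_of_surjective (LinearMap.range_eq_top.2 hf)
  obtain ⟨τ, hτ⟩ := g.exists_rightInverse_of_surjective (LinearMap.range_eq_top.2 hg)
  have hσ' (b : B) : f (σ b) = b := LinearMap.congr_fun hσ b
  have hτ' (b : B) : g (τ b) = b := LinearMap.congr_fun hτ b
  have hfin (h : Module.End ℝ B) : {u | h.HasEigenvalue u}.Finite := h.finite_hasEigenvalue
  -- The scalar `u` is nonzero, is not an eigenvalue of `g ∘ σ`, and its inverse is not an
  -- eigenvalue of `f ∘ τ`.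
  obtain ⟨u, hu⟩ := (((hfin (g ∘ₗ σ)).union
    ((hfin (f ∘ₗ τ)).preimage (inv_injective.injOn))).union (finite_singleton 0)).infinite_compl.nonempty
  simp only [mem_compl_iff, mem_union, mem_preimage, mem_ofPred_eq, mem_singleton_iff, not_or] at hu
  obtain ⟨⟨hu1, hu2⟩, hu0⟩ := hu
  have key (h : Module.End ℝ B) (u : ℝ) (hu : ¬ h.HasEigenvalue u) (v : B) (hv : h v = u • v) :
      v = 0 := by
    by_contra hv0
    exact hu (Module.End.hasEigenvalue_of_hasEigenvector
      ⟨Module.End.mem_eigenspace_iff.2 hv, hv0⟩)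
  refine ⟨σ - u • τ, (injective_iff_map_eq_zero _).2 fun v hv => ?_,
    (injective_iff_map_eq_zero _).2 fun v hv => ?_⟩
  · refine key _ _ hu2 v ?_
    simp only [LinearMap.comp_apply, LinearMap.sub_apply, LinearMap.smul_apply, map_sub, map_smul,
      hσ'] at hv ⊢
    conv_rhs => rw [sub_eq_zero.1 hv]
    rw [smul_smul, inv_mul_cancel₀ hu0, one_smul]
  · refine key _ _ hu1 v ?_
    simp only [LinearMap.comp_apply, LinearMap.sub_apply, LinearMap.smul_apply, map_sub, map_smul,
      hτ'] at hv ⊢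
    exact sub_eq_zero.1 hv

variable {E B : Type*} [NormedAddCommGroup E] [NormedSpace ℝ E]
    [NormedAddCommGroup B] [NormedSpace ℝ B]
    {G M : Type*} [TopologicalSpace G] [ChartedSpace E G] [IsManifold 𝓘(ℝ, E) ∞ G]
    [TopologicalSpace M] [ChartedSpace B M]

theorem exists_local_inverse [FiniteDimensional ℝ B] [IsManifold 𝓘(ℝ, B) ∞ M]
    {f : B → M} {z : B} (hf : ContMDiffAt 𝓘(ℝ, B) 𝓘(ℝ, B) 3 f z)
    (hi : Function.Injective (mfderiv 𝓘(ℝ, B) 𝓘(ℝ, B) f z)) :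
    ∃ l : M → B, ContMDiffAt 𝓘(ℝ, B) 𝓘(ℝ, B) 3 l (f z) ∧ l (f z) = z ∧
      (∀ᶠ y in 𝓝 (f z), f (l y) = y) ∧ ∀ᶠ w in 𝓝 z, l (f w) = w := by
  have surj_of_inj (L : B →L[ℝ] B) (hL : Function.Injective L) : Function.Surjective L :=
    LinearMap.surjective_of_injective (f := L.toLinearMap) hL
  obtain ⟨ρ, hρ, hρ1, hρ2⟩ := exists_retraction hf (surj_of_inj _ hi)
  set l : M → B := fun y => ρ (z, y)
  have hl : ContMDiffAt 𝓘(ℝ, B) 𝓘(ℝ, B) 3 l (f z) :=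
    ContMDiffAt.comp (f z) hρ (contMDiffAt_const.prodMk contMDiffAt_id)
  have hl0 : l (f z) = z := hρ2.self_of_nhds
  have hfl : ∀ᶠ y in 𝓝 (f z), f (l y) = y := by
    have h1 : ContinuousAt (fun y : M => (z, y)) (f z) := by fun_prop
    exact h1.eventually hρ1
  have hli : Function.Injective (mfderiv 𝓘(ℝ, B) 𝓘(ℝ, B) l (f z)) := by
    refine (injective_iff_map_eq_zero _).2 fun (v : B) hv => ?_
    obtain ⟨c, hc⟩ := exists_hasVelocity (I := 𝓘(ℝ, B)) (f z) v
    have h1 := (hc.comp (hl.mdifferentiableAt (by simp))).congr_vec hv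
    have h2 := h1.comp (f := f) (I' := 𝓘(ℝ, B)) (by rw [hl0]; exact hf.mdifferentiableAt (by simp))
    exact (hc.unique h2 ((hc.eventually hfl).mono fun t ht => ht.symm)).trans (map_zero _)
  -- The right inverse `l` of `f` has in turn a right inverse `k`; then `k = f (l k) = f` near `z`,
  -- so `l` is also a left inverse of `f`.
  obtain ⟨ρ', hρ', hρ1', hρ2'⟩ := exists_retraction hl (surj_of_inj _ hli)
  rw [hl0] at hρ' hρ1'
  set k : B → M := fun w => ρ' (f z, w)
  have hk : ContinuousAt k z :=
    ContinuousAt.comp (f := fun w => (f z, w)) hρ'.continuousAt (by fun_prop)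
  have hk0 : k z = f z := by
    have := hρ2'.self_of_nhds
    rwa [hl0] at this
  have hlk : ∀ᶠ w in 𝓝 z, l (k w) = w := by
    have h1 : ContinuousAt (fun w : B => (f z, w)) z := by fun_prop
    exact h1.eventually hρ1'
  refine ⟨l, hl, hl0, hfl, ?_⟩
  have hk1 : ∀ᶠ w in 𝓝 z, f (l (k w)) = k w := hk.eventually (p := fun y => f (l y) = y)
      (by rwa [hk0])
  filter_upwards [hlk, hk1] with w h1 h2
  rw [h1] at h2
  rw [h2, h1]

theorem exists_hasMFDerivAt (γ : G) (T : B →L[ℝ] E) :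
    ∃ b : B → G, ContMDiffAt 𝓘(ℝ, B) 𝓘(ℝ, E) 3 b 0 ∧ b 0 = γ ∧
      HasMFDerivAt 𝓘(ℝ, B) 𝓘(ℝ, E) b 0 (T : B →L[ℝ] E) := by
  set φ := extChartAt 𝓘(ℝ, E) γ
  have h0 : φ γ + T 0 = φ γ := by simp
  have h1 : ContMDiffAt 𝓘(ℝ, E) 𝓘(ℝ, E) 3 φ.symm (φ γ) :=
    (contMDiffOn_extChartAt_symm γ).contMDiffAt
      ((isOpen_extChartAt_target γ).mem_nhds (mem_extChartAt_target (I := 𝓘(ℝ, E)) γ))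
  have h2 : ContMDiffAt 𝓘(ℝ, B) 𝓘(ℝ, E) 3 (fun z => φ γ + T z) 0 := by
    refine ContDiffAt.contMDiffAt ?_
    fun_prop
  have h3 : HasMFDerivAt 𝓘(ℝ, B) 𝓘(ℝ, E) (fun z => φ γ + T z) 0 (T : B →L[ℝ] E) :=
    (T.hasFDerivAt.const_add _).hasMFDerivAt
  have h4 : HasMFDerivAt 𝓘(ℝ, E) 𝓘(ℝ, E) φ.symm (φ γ + T 0) (ContinuousLinearMap.id ℝ E) := by
    rw [h0]
    refine (h1.mdifferentiableAt (by simp)).hasMFDerivAt.congr_mfderiv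
      (ContinuousLinearMap.ext fun v : E => ?_)
    have h5 := mfderiv_symm_comp_extChartAt (I := 𝓘(ℝ, E)) (x := γ) (mem_extChartAt_source γ) v
    rw [mfderiv_extChartAt_self] at h5
    exact h5
  refine ⟨fun z => φ.symm (φ γ + T z), h1.comp_of_eq h2 h0, ?_, ?_⟩
  · simp only [h0]
    exact extChartAt_to_inv (I := 𝓘(ℝ, E)) γ
  · exact (HasMFDerivAt.comp (g := φ.symm) (f := fun z => φ γ + T z) 0 h4 h3).congr_mfderiv
      (ContinuousLinearMap.ext fun v => rfl)

end LocalInverse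

/-! ### Local bisections. -/

namespace LieGroupoid

section Bisection

variable {E B G M : Type*}
  [NormedAddCommGroup E] [NormedSpace ℝ E] [NormedAddCommGroup B] [NormedSpace ℝ B]
  [TopologicalSpace G] [ChartedSpace E G] [TopologicalSpace M] [ChartedSpace B M]
  {𝒢 : LieGroupoid E B G M}

/-- A local bisection through `γ`, parametrized by the range (`b`) and by the source (`b'`). -/
structure IsBisection (𝒢 : LieGroupoid E B G M) (b b' : M → G) (γ : G) : Prop where
  smooth : ContMDiffAt 𝓘(ℝ, B) 𝓘(ℝ, E) 3 b (𝒢.r γ)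
  smooth' : ContMDiffAt 𝓘(ℝ, B) 𝓘(ℝ, E) 3 b' (𝒢.s γ)
  apply_r : b (𝒢.r γ) = γ
  r_apply : ∀ᶠ y in 𝓝 (𝒢.r γ), 𝒢.r (b y) = y
  s_apply' : ∀ᶠ x in 𝓝 (𝒢.s γ), 𝒢.s (b' x) = x
  apply_s : ∀ᶠ y in 𝓝 (𝒢.r γ), b' (𝒢.s (b y)) = b y
  apply_r' : ∀ᶠ x in 𝓝 (𝒢.s γ), b (𝒢.r (b' x)) = b' x

theorem IsBisection.apply_s_self {b b' : M → G} {γ : G} (h : 𝒢.IsBisection b b' γ) :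
    b' (𝒢.s γ) = γ := by
  have := h.apply_s.self_of_nhds
  rwa [h.apply_r] at this

variable [FiniteDimensional ℝ B] [IsManifold 𝓘(ℝ, E) ∞ G]
  [IsManifold 𝓘(ℝ, B) ∞ M]

/-- A germ of submanifold through `γ`, tangent to a common complement of `ker dr` and `ker ds`,
projects diffeomorphically by `r` and by `s`; inverting either projection yields the two
parametrizations. -/
theorem exists_isBisection (𝒢 : LieGroupoid E B G M) (γ : G) :
    ∃ b b' : M → G, 𝒢.IsBisection b b' γ := by
  let A : E →L[ℝ] B := mfderiv 𝓘(ℝ, E) 𝓘(ℝ, B) 𝒢.r γ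
  let S : E →L[ℝ] B := mfderiv 𝓘(ℝ, E) 𝓘(ℝ, B) 𝒢.s γ
  obtain ⟨T, hT1, hT2⟩ := exists_injective_comp_injective_comp (f := A.toLinearMap)
    (g := S.toLinearMap) (𝒢.r_submersion γ) (𝒢.s_submersion γ)
  obtain ⟨b, hb, hb0, hb'⟩ := exists_hasMFDerivAt (E := E) γ T.toContinuousLinearMap
  have hr : ContMDiffAt 𝓘(ℝ, B) 𝓘(ℝ, B) 3 (𝒢.r ∘ b) 0 :=
    ((𝒢.r.contMDiff (b 0)).of_le (by norm_cast)).comp 0 hb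
  have hs : ContMDiffAt 𝓘(ℝ, B) 𝓘(ℝ, B) 3 (𝒢.s ∘ b) 0 :=
    ((𝒢.s.contMDiff (b 0)).of_le (by norm_cast)).comp 0 hb
  have hr' : Function.Injective (mfderiv 𝓘(ℝ, B) 𝓘(ℝ, B) (𝒢.r ∘ b) 0) := by
    subst hb0
    rw [((𝒢.mdifferentiableAt_r (b 0)).hasMFDerivAt.comp (0 : B) hb').mfderiv]
    exact hT1
  have hs' : Function.Injective (mfderiv 𝓘(ℝ, B) 𝓘(ℝ, B) (𝒢.s ∘ b) 0) := by
    subst hb0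
    rw [((𝒢.mdifferentiableAt_s (b 0)).hasMFDerivAt.comp (0 : B) hb').mfderiv]
    exact hT2
  obtain ⟨l, hl, hl0, hl1, hl2⟩ := exists_local_inverse hr hr'
  obtain ⟨m, hm, hm0, hm1, hm2⟩ := exists_local_inverse hs hs'
  have er : (𝒢.r ∘ b) 0 = 𝒢.r γ := congrArg 𝒢.r hb0
  have es : (𝒢.s ∘ b) 0 = 𝒢.s γ := congrArg 𝒢.s hb0
  rw [er] at hl hl0 hl1
  rw [es] at hm hm0 hm1
  refine ⟨b ∘ l, b ∘ m, ⟨hb.comp_of_eq hl hl0, hb.comp_of_eq hm hm0, ?_, hl1, hm1, ?_, ?_⟩⟩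
  · rw [Function.comp_apply, hl0, hb0]
  · have h1 : ∀ᶠ y in 𝓝 (𝒢.r γ), m ((𝒢.s ∘ b) (l y)) = l y :=
      hl.continuousAt.eventually (by rwa [hl0])
    exact h1.mono fun y hy => congrArg b hy
  · have h1 : ∀ᶠ y in 𝓝 (𝒢.s γ), l ((𝒢.r ∘ b) (m y)) = m y :=
      hm.continuousAt.eventually (p := fun w => l ((𝒢.r ∘ b) w) = w) (by rwa [hm0])
    exact h1.mono fun y hy => congrArg b hy

end Bisection

end LieGroupoid

/-- The map `(γ, ξ) ↦ (R γ, (a ξ + dh) ∘ d(K(·, γ)))` of the cotangent bundle, for maps `R` and `K`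
such that `K(R γ, γ) = γ`. -/
def cotPull {E G : Type*} [NormedAddCommGroup E] [NormedSpace ℝ E] [TopologicalSpace G]
    [ChartedSpace E G] [IsManifold 𝓘(ℝ, E) ∞ G] (a : ℝ) (h : G → ℝ) (K : G → G → G) (R : G → G)
    (δ : CotangentBundle E G) : CotangentBundle E G :=
  cotMk (R δ.proj) (ContinuousLinearMap.comp
    (a • cotForm δ + differential 𝓘(ℝ, E) h δ.proj : E →L[ℝ] ℝ)
    (mfderiv 𝓘(ℝ, E) 𝓘(ℝ, E) (fun u => K u δ.proj) (R δ.proj) : E →L[ℝ] E))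

/-! ### Right translations by bisections. -/

namespace LieGroupoid

section RightTranslation

variable {E B G M : Type*}
  [NormedAddCommGroup E] [NormedSpace ℝ E] [NormedAddCommGroup B] [NormedSpace ℝ B]
  [TopologicalSpace G] [ChartedSpace E G] [TopologicalSpace M] [ChartedSpace B M]
  {𝒢 : LieGroupoid E B G M}

theorem contMDiffAt_mul {F H N : Type*} [NormedAddCommGroup F] [NormedSpace ℝ F]
    [TopologicalSpace H] {I : ModelWithCorners ℝ F H} [TopologicalSpace N] [ChartedSpace H N]
    {f g : N → G} {x : N} (hf : ContMDiffAt I 𝓘(ℝ, E) 3 f x) (hg : ContMDiffAt I 𝓘(ℝ, E) 3 g x)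
    (h : ∀ᶠ y in 𝓝 x, 𝒢.s (f y) = 𝒢.r (g y)) :
    ContMDiffAt I 𝓘(ℝ, E) 3 (fun y => 𝒢.mul (f y) (g y)) x := by
  have h1 := (𝒢.mul_smooth (f x, g x) h.self_of_nhds).of_le (m := 3) (by norm_cast)
  have h2 := ContMDiffWithinAt.comp (g := fun p : G × G => 𝒢.mul p.1 p.2)
    (f := fun y => (f y, g y)) (s := {y | 𝒢.s (f y) = 𝒢.r (g y)}) x h1
    (hf.prodMk hg).contMDiffWithinAt (fun y hy => hy)
  exact h2.contMDiffAt h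

theorem inv_eq_of_mul_eq {x y : G} (h : 𝒢.s x = 𝒢.r y) (hxy : 𝒢.mul x y = 𝒢.unit (𝒢.r x)) :
    𝒢.inv x = y := by
  rw [← 𝒢.unit_mul y, ← h, ← 𝒢.inv_mul, 𝒢.mul_assoc _ _ _ (𝒢.s_inv x) h, hxy, ← 𝒢.s_inv,
    𝒢.mul_unit]

theorem inv_mul_inv {a c : G} (h : 𝒢.s a = 𝒢.s c) :
    𝒢.inv (𝒢.mul a (𝒢.inv c)) = 𝒢.mul c (𝒢.inv a) := by
  have h1 : 𝒢.s a = 𝒢.r (𝒢.inv c) := by rw [𝒢.r_inv, h]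
  have h2 : 𝒢.s c = 𝒢.r (𝒢.inv a) := by rw [𝒢.r_inv, h]
  have h3 : 𝒢.s (𝒢.inv c) = 𝒢.r (𝒢.mul c (𝒢.inv a)) := by rw [𝒢.r_mul _ _ h2, 𝒢.s_inv]
  refine inv_eq_of_mul_eq ?_ ?_
  · rw [𝒢.s_mul _ _ h1, h3]
  · rw [𝒢.mul_assoc _ _ _ h1 h3, ← 𝒢.mul_assoc _ _ _ (𝒢.s_inv c) h2, 𝒢.inv_mul, ← h,
      ← 𝒢.r_inv, 𝒢.unit_mul, 𝒢.mul_inv, 𝒢.r_mul _ _ (by rw [𝒢.r_inv, h])]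

theorem mul_inv_cancel_right {a c : G} (h : 𝒢.s a = 𝒢.r c) :
    𝒢.mul (𝒢.mul a c) (𝒢.inv c) = a := by
  rw [𝒢.mul_assoc _ _ _ h (𝒢.r_inv c).symm, 𝒢.mul_inv, ← h, 𝒢.mul_unit]

theorem inv_mul_cancel_right {a c : G} (h : 𝒢.s a = 𝒢.s c) :
    𝒢.mul (𝒢.mul a (𝒢.inv c)) c = a := by
  rw [𝒢.mul_assoc _ _ _ (by rw [𝒢.r_inv, h]) (𝒢.s_inv c), 𝒢.inv_mul, ← h, 𝒢.mul_unit]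

/-- Right translation by a local bisection parametrized by its range. -/
def rightTrans (𝒢 : LieGroupoid E B G M) (b : M → G) (γ : G) : G := 𝒢.mul γ (b (𝒢.s γ))

/-- Right translation by the inverse of a local bisection parametrized by its source. -/
def rightTransInv (𝒢 : LieGroupoid E B G M) (b' : M → G) (γ : G) : G :=
  𝒢.mul γ (𝒢.inv (b' (𝒢.s γ)))

variable {b b' : M → G}

theorem s_rightTrans {γ : G} (h1 : 𝒢.r (b (𝒢.s γ)) = 𝒢.s γ) :
    𝒢.s (𝒢.rightTrans b γ) = 𝒢.s (b (𝒢.s γ)) := 𝒢.s_mul _ _ h1.symm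

theorem r_rightTrans {γ : G} (h1 : 𝒢.r (b (𝒢.s γ)) = 𝒢.s γ) :
    𝒢.r (𝒢.rightTrans b γ) = 𝒢.r γ := 𝒢.r_mul _ _ h1.symm

theorem rightTransInv_rightTrans {γ : G} (h1 : 𝒢.r (b (𝒢.s γ)) = 𝒢.s γ)
    (h2 : b' (𝒢.s (b (𝒢.s γ))) = b (𝒢.s γ)) : 𝒢.rightTransInv b' (𝒢.rightTrans b γ) = γ := by
  rw [rightTransInv, s_rightTrans h1, h2]
  exact mul_inv_cancel_right h1.symm

theorem rightTrans_rightTransInv {γ : G} (h1 : 𝒢.s (b' (𝒢.s γ)) = 𝒢.s γ)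
    (h2 : b (𝒢.r (b' (𝒢.s γ))) = b' (𝒢.s γ)) : 𝒢.rightTrans b (𝒢.rightTransInv b' γ) = γ := by
  have h3 : 𝒢.s (𝒢.rightTransInv b' γ) = 𝒢.r (b' (𝒢.s γ)) := by
    rw [rightTransInv, 𝒢.s_mul _ _ (by rw [𝒢.r_inv, h1]), 𝒢.s_inv]
  rw [rightTrans, h3, h2]
  exact inv_mul_cancel_right h1.symm

/-- Associativity in the form used for symmetry: right translations commute with left
multiplications. This is why their lifts preserve `rCot`. -/
theorem mul_rightTrans {α γ : G} (h : 𝒢.s α = 𝒢.r γ) (h1 : 𝒢.r (b (𝒢.s γ)) = 𝒢.s γ) :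
    𝒢.mul α (𝒢.rightTrans b γ) = 𝒢.rightTrans b (𝒢.mul α γ) := by
  rw [rightTrans, rightTrans, 𝒢.s_mul _ _ h, 𝒢.mul_assoc _ _ _ h h1.symm]

variable {γ γ₂ : G}

theorem eventually_of_s_eq {x : M} (hγ : 𝒢.s γ = x) {P : M → Prop} (h : ∀ᶠ y in 𝓝 x, P y) :
    ∀ᶠ γ' in 𝓝 γ, P (𝒢.s γ') :=
  𝒢.s.contMDiff.continuous.continuousAt.eventually (by rwa [hγ])

namespace IsBisection

theorem rightTrans_eq (hb : 𝒢.IsBisection b b' γ₂) (hγ : 𝒢.s γ = 𝒢.r γ₂) :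
    𝒢.rightTrans b γ = 𝒢.mul γ γ₂ := by
  rw [rightTrans, hγ, hb.apply_r]

theorem s_rightTrans (hb : 𝒢.IsBisection b b' γ₂) (hγ : 𝒢.s γ = 𝒢.r γ₂) :
    𝒢.s (𝒢.rightTrans b γ) = 𝒢.s γ₂ := by
  rw [hb.rightTrans_eq hγ, 𝒢.s_mul _ _ hγ]

theorem contMDiffAt_rightTrans (hb : 𝒢.IsBisection b b' γ₂) (hγ : 𝒢.s γ = 𝒢.r γ₂) :
    ContMDiffAt 𝓘(ℝ, E) 𝓘(ℝ, E) 3 (𝒢.rightTrans b) γ :=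
  contMDiffAt_mul contMDiffAt_id
    (hb.smooth.comp_of_eq ((𝒢.s.contMDiff γ).of_le (by norm_cast)) hγ)
    ((eventually_of_s_eq hγ hb.r_apply).mono fun _ h => h.symm)

theorem contMDiffAt_rightTransInv (hb : 𝒢.IsBisection b b' γ₂) (hγ : 𝒢.s γ = 𝒢.s γ₂) :
    ContMDiffAt 𝓘(ℝ, E) 𝓘(ℝ, E) 3 (𝒢.rightTransInv b') γ := by
  refine contMDiffAt_mul contMDiffAt_id (((𝒢.inv.contMDiff _).of_le (by norm_cast)).comp γ
    (hb.smooth'.comp_of_eq ((𝒢.s.contMDiff γ).of_le (by norm_cast)) hγ)) ?_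
  filter_upwards [eventually_of_s_eq hγ hb.s_apply'] with γ' h
  rw [𝒢.r_inv, h]

theorem eventually_rightTransInv_rightTrans (hb : 𝒢.IsBisection b b' γ₂) (hγ : 𝒢.s γ = 𝒢.r γ₂) :
    ∀ᶠ γ' in 𝓝 γ, 𝒢.rightTransInv b' (𝒢.rightTrans b γ') = γ' := by
  filter_upwards [eventually_of_s_eq hγ hb.r_apply, eventually_of_s_eq hγ hb.apply_s] with γ' h1 h2
  exact rightTransInv_rightTrans h1 h2

theorem eventually_rightTrans_rightTransInv (hb : 𝒢.IsBisection b b' γ₂) (hγ : 𝒢.s γ = 𝒢.s γ₂) :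
    ∀ᶠ γ' in 𝓝 γ, 𝒢.rightTrans b (𝒢.rightTransInv b' γ') = γ' := by
  filter_upwards [eventually_of_s_eq hγ hb.s_apply', eventually_of_s_eq hγ hb.apply_r']
    with γ' h1 h2
  exact rightTrans_rightTransInv h1 h2

theorem mfderiv_rightTransInv_dMul (hb : 𝒢.IsBisection b b' γ₂) (hγ : 𝒢.s γ = 𝒢.r γ₂)
    [IsManifold 𝓘(ℝ, E) ∞ G] (t : E) :
    (mfderiv 𝓘(ℝ, E) 𝓘(ℝ, E) (𝒢.rightTransInv b') (𝒢.mul γ γ₂)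
      (𝒢.dMul γ γ₂ t (mfderiv 𝓘(ℝ, B) 𝓘(ℝ, E) b (𝒢.r γ₂)
        (mfderiv 𝓘(ℝ, E) 𝓘(ℝ, B) 𝒢.s γ t))) : E) = t := by
  obtain ⟨c, hc⟩ := exists_hasVelocity (I := 𝓘(ℝ, E)) γ t
  have h1 : HasVelocity 𝓘(ℝ, E) (fun τ => b (𝒢.s (c τ))) γ₂ (mfderiv 𝓘(ℝ, B) 𝓘(ℝ, E) b (𝒢.r γ₂)
        (mfderiv 𝓘(ℝ, E) 𝓘(ℝ, B) 𝒢.s γ t)) :=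
    (((hc.comp (𝒢.mdifferentiableAt_s γ)).congr_point hγ).comp
      (hb.smooth.mdifferentiableAt (by simp))).congr_point hb.apply_r
  have h2 := hasVelocity_mul (𝒢 := 𝒢) hc h1
    (hc.eventually ((eventually_of_s_eq hγ hb.r_apply).mono fun _ h => h.symm))
  refine (h2.comp ((hb.contMDiffAt_rightTransInv (𝒢.s_mul _ _ hγ)).mdifferentiableAt
    (by simp))).unique hc ?_
  exact hc.eventually (hb.eventually_rightTransInv_rightTrans hγ)

/-- Translating a curve through `γ γ₂` back by the bisection factors it into composable curves
through `γ` and `γ₂`. Hence the multiplication is a submersion, and a product form is determined by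
its defining property. -/
theorem exists_dMul_eq (hb : 𝒢.IsBisection b b' γ₂) (hγ : 𝒢.s γ = 𝒢.r γ₂)
    [IsManifold 𝓘(ℝ, E) ∞ G] (w : E) : ∃ t₁ t₂ : E,
      (mfderiv 𝓘(ℝ, E) 𝓘(ℝ, B) 𝒢.s γ t₁ : B) = mfderiv 𝓘(ℝ, E) 𝓘(ℝ, B) 𝒢.r γ₂ t₂ ∧
        (𝒢.dMul γ γ₂ t₁ t₂ : E) = w := by
  obtain ⟨c, hc⟩ := exists_hasVelocity (I := 𝓘(ℝ, E)) (𝒢.mul γ γ₂) w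
  have hs := 𝒢.s_mul _ _ hγ
  have h1 := (hc.comp ((hb.contMDiffAt_rightTransInv hs).mdifferentiableAt
    (by simp))).congr_point (x' := γ) (by
      rw [← hb.rightTrans_eq hγ]
      exact (hb.eventually_rightTransInv_rightTrans hγ).self_of_nhds)
  have h2 := ((h1.comp (𝒢.mdifferentiableAt_s γ)).congr_point hγ)
  have h3 := (h2.comp (hb.smooth.mdifferentiableAt (by simp))).congr_point hb.apply_r
  have h4 : ∀ᶠ t in 𝓝 (0 : ℝ), 𝒢.r (b (𝒢.s (𝒢.rightTransInv b' (c t)))) =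
    𝒢.s (𝒢.rightTransInv b' (c t)) := h2.eventually hb.r_apply
  refine ⟨_, _, h2.unique (h3.comp (𝒢.mdifferentiableAt_r γ₂)) (h4.mono fun t ht => ht.symm),
    (hasVelocity_mul (𝒢 := 𝒢) h1 h3 (h4.mono fun t ht => ht.symm)).unique hc ?_⟩
  exact hc.eventually (hb.eventually_rightTrans_rightTransInv hs)

end IsBisection

end RightTranslation

end LieGroupoid

theorem differential_comp_apply {E B G M : Type*} [NormedAddCommGroup E] [NormedSpace ℝ E]
    [NormedAddCommGroup B] [NormedSpace ℝ B] [TopologicalSpace G] [ChartedSpace E G]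
    [TopologicalSpace M] [ChartedSpace B M] {f : M → ℝ} {s : G → M} {γ : G} {x : M}
    (hx : s γ = x)
    (hf : MDifferentiableAt 𝓘(ℝ, B) 𝓘(ℝ, ℝ) f x) (hs : MDifferentiableAt 𝓘(ℝ, E) 𝓘(ℝ, B) s γ)
    (v : E) : (differential 𝓘(ℝ, E) (f ∘ s) γ v : ℝ) =
      differential 𝓘(ℝ, B) f x (mfderiv 𝓘(ℝ, E) 𝓘(ℝ, B) s γ v : B) := by
  subst hx
  exact DFunLike.congr_fun (mfderiv_comp γ hf hs) v

theorem exists_differential_eq {B M : Type*} [NormedAddCommGroup B] [NormedSpace ℝ B]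
    [TopologicalSpace M] [ChartedSpace B M] [IsManifold 𝓘(ℝ, B) ∞ M] (y : M) (l : B →L[ℝ] ℝ) :
    ∃ f : M → ℝ, ContMDiffAt 𝓘(ℝ, B) 𝓘(ℝ, ℝ) 3 f y ∧
      ∀ v : B, differential 𝓘(ℝ, B) f y v = l v := by
  refine ⟨l ∘ extChartAt 𝓘(ℝ, B) y, l.contDiff.contMDiff.contMDiffAt.comp y contMDiffAt_extChartAt,
    fun v => ?_⟩
  have h2 := mfderiv_comp y (l.differentiableAt (x := extChartAt 𝓘(ℝ, B) y y)).mdifferentiableAt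
    (mdifferentiableAt_extChartAt (I := 𝓘(ℝ, B)) (mem_chart_source B y))
  rw [mfderiv_extChartAt_self, mfderiv_eq_fderiv, l.fderiv] at h2
  exact DFunLike.congr_fun h2 v

/-! ### Right multiplication in `T*G` as a lifted right translation. -/

namespace LieGroupoid

section RightMultiplication

variable {E B G M : Type*}
  [NormedAddCommGroup E] [NormedSpace ℝ E] [NormedAddCommGroup B] [NormedSpace ℝ B]
  [TopologicalSpace G] [ChartedSpace E G] [TopologicalSpace M] [ChartedSpace B M]
  [FiniteDimensional ℝ E] [FiniteDimensional ℝ B] [IsManifold 𝓘(ℝ, E) ∞ G]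
  [IsManifold 𝓘(ℝ, B) ∞ M]
  {𝒢 : LieGroupoid E B G M} {b b' : M → G} {γ γ₂ : G}

namespace IsBisection

/-- A tangent vector `w` of the fibre of `r` through `γ₂` is expressed by the velocity `v` of the
curve `α = b'(s c) c⁻¹`, where `c` is a curve in this fibre with velocity `w`. -/
theorem exists_algebroid_vector (hb : 𝒢.IsBisection b b' γ₂) {w : E}
    (hw : (mfderiv 𝓘(ℝ, E) 𝓘(ℝ, B) 𝒢.r γ₂ w : B) = 0) :
    ∃ v : E, (mfderiv 𝓘(ℝ, E) 𝓘(ℝ, B) 𝒢.s (𝒢.unit (𝒢.r γ₂)) v : B) = 0 ∧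
      (∀ ξ : E →L[ℝ] ℝ, ξ (mfderiv 𝓘(ℝ, B) 𝓘(ℝ, E) b (𝒢.r γ₂)
        (mfderiv 𝓘(ℝ, E) 𝓘(ℝ, B) 𝒢.r (𝒢.unit (𝒢.r γ₂)) v)) = ξ (𝒢.dRight γ₂ v) + ξ w) ∧
      ∀ γ, 𝒢.s γ = 𝒢.r γ₂ → (mfderiv 𝓘(ℝ, E) 𝓘(ℝ, E) (𝒢.rightTransInv b') (𝒢.mul γ γ₂)
        (𝒢.dMul γ γ₂ (0 : E) w) : E) =
          mfderivWithin 𝓘(ℝ, E) 𝓘(ℝ, E) (fun α => 𝒢.mul γ (𝒢.inv α)) {α | 𝒢.s α = 𝒢.s γ}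
            (𝒢.unit (𝒢.s γ)) v := by
  obtain ⟨c, hc, hcr⟩ := exists_hasVelocity_r_fiber hw
  have h1 := hc.comp (𝒢.mdifferentiableAt_s γ₂)
  have h2 := (h1.comp (hb.smooth'.mdifferentiableAt (by simp))).congr_point hb.apply_s_self
  have h3 := hc.comp (𝒢.mdifferentiableAt_inv γ₂)
  have e1 : ∀ᶠ t in 𝓝 (0 : ℝ), 𝒢.s (b' (𝒢.s (c t))) = 𝒢.s (c t) := h1.eventually hb.s_apply'
  have hα := (hasVelocity_mul (𝒢 := 𝒢) h2 h3
    (e1.mono fun t ht => ht.trans (𝒢.r_inv _).symm)).congr_point (𝒢.mul_inv γ₂)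
  set α : ℝ → G := fun t => 𝒢.mul (b' (𝒢.s (c t))) (𝒢.inv (c t)) with hαd
  have hαs : ∀ᶠ t in 𝓝 (0 : ℝ), 𝒢.s (α t) = 𝒢.r γ₂ := by
    filter_upwards [e1, hcr] with t h4 h5
    rw [hαd, 𝒢.s_mul _ _ (by rw [𝒢.r_inv, h4]), 𝒢.s_inv, h5]
  obtain ⟨v, hα⟩ : ∃ v : E, HasVelocity 𝓘(ℝ, E) α (𝒢.unit (𝒢.r γ₂)) v := ⟨_, hα⟩
  refine ⟨v, ?_, ?_, fun γ hγ => ?_⟩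
  · exact (hα.comp (𝒢.mdifferentiableAt_s _)).unique (hasVelocity_const (𝒢.r γ₂)) hαs
  · have h4 : HasVelocity 𝓘(ℝ, E) (fun t => b (𝒢.r (α t))) γ₂ _ :=
      (((hα.comp (𝒢.mdifferentiableAt_r _)).congr_point (𝒢.r_unit _)).comp
        (hb.smooth.mdifferentiableAt (by simp))).congr_point hb.apply_r
    have h5 := hasVelocity_mul (𝒢 := 𝒢) hα hc (by
      filter_upwards [hαs, hcr] with t h6 h7
      rw [h6, h7])
    have h6 := h4.unique h5 (by
      filter_upwards [e1, h1.eventually hb.apply_r'] with t h6 h7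
      simp only [hαd]
      rw [𝒢.r_mul _ _ (by rw [𝒢.r_inv, h6]), h7]
      exact (inv_mul_cancel_right h6).symm)
    have h7 : (𝒢.dMul (𝒢.unit (𝒢.r γ₂)) γ₂ v (0 : E) : E) = 𝒢.dRight γ₂ v :=
      (hasVelocity_mul (𝒢 := 𝒢) hα (hasVelocity_const γ₂) hαs).unique
        (hasVelocity_mul_const hα hαs) (.of_forall fun t => rfl)
    have h8 : (𝒢.dMul (𝒢.unit (𝒢.r γ₂)) γ₂ (0 : E) w : E) = w := by
      refine (hasVelocity_mul (𝒢 := 𝒢) (hasVelocity_const (𝒢.unit (𝒢.r γ₂))) hc ?_).unique hc ?_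
      · filter_upwards [hcr] with t ht
        rw [𝒢.s_unit, ht]
      · filter_upwards [hcr] with t ht
        conv_rhs => rw [← 𝒢.unit_mul (c t), ht]
    have h9 := dMul_add (𝒢 := 𝒢) (γ₁ := 𝒢.unit (𝒢.r γ₂)) (γ₂ := γ₂) v 0 0 w
    rw [add_zero, zero_add, h7, h8] at h9
    exact fun ξ => (congrArg ξ (h6.trans h9)).trans (map_add ξ _ _)
  · have h4 := (hasVelocity_mul (𝒢 := 𝒢) (hasVelocity_const γ) hc
      (hcr.mono fun t ht => hγ.trans ht.symm)).comp
      ((hb.contMDiffAt_rightTransInv (𝒢.s_mul _ _ hγ)).mdifferentiableAt (by simp))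
    have h5 := hasVelocity_const_mul_inv (𝒢 := 𝒢) (γ := γ) (α := α) (v := v)
      (by rwa [hγ]) (by rwa [hγ])
    refine h4.unique h5 ?_
    filter_upwards [hcr, e1] with t h6 h7
    have h8 : 𝒢.s γ = 𝒢.r (c t) := hγ.trans h6.symm
    simp only [hαd]
    rw [inv_mul_inv h7, rightTransInv, 𝒢.s_mul _ _ h8,
      𝒢.mul_assoc _ _ _ h8 (by rw [𝒢.r_inv, h7])]

/-- Split `t₂` into a part tangent to the bisection and a part `w` tangent to the fibre of `r`. The
first is accounted for by `df`, which reproduces `δ₂` along the bisection; for the second, `sCot δ₁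
= rCot δ₂` converts values of `δ₁` into values of `δ₂`. -/
theorem isProductForm (hb : 𝒢.IsBisection b b' γ₂) {f : M → ℝ} {δ₁ δ₂ : CotangentBundle E G}
    (hγ₂ : δ₂.proj = γ₂) (h : 𝒢.sCot δ₁ = 𝒢.rCot δ₂)
    (hf : MDifferentiableAt 𝓘(ℝ, B) 𝓘(ℝ, ℝ) f (𝒢.r γ₂))
    (hfb : ∀ y : B, differential 𝓘(ℝ, B) f (𝒢.r γ₂) y =
      (cotForm δ₂ : E →L[ℝ] ℝ) (mfderiv 𝓘(ℝ, B) 𝓘(ℝ, E) b (𝒢.r γ₂) y)) :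
    𝒢.IsProductForm δ₁ δ₂ (cotForm (cotPull 1 (f ∘ 𝒢.s) (fun u _ => 𝒢.rightTransInv b' u)
      (𝒢.rightTrans b) δ₁) : E →L[ℝ] ℝ) := by
  subst hγ₂
  obtain ⟨hs, hform⟩ := sCot_eq_rCot_iff.1 h
  intro (t₁ : E) (t₂ : E) ht
  set γ₁ := δ₁.proj
  set γ₂ := δ₂.proj
  have hP (u : E) : cotForm (cotPull 1 (f ∘ 𝒢.s) (fun u _ => 𝒢.rightTransInv b' u)
      (𝒢.rightTrans b) δ₁) u = (fun e : E => cotForm δ₁ e + differential 𝓘(ℝ, E) (f ∘ 𝒢.s) γ₁ e)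
        (mfderiv 𝓘(ℝ, E) 𝓘(ℝ, E) (𝒢.rightTransInv b') (𝒢.mul γ₁ γ₂) u) := by
    rw [← hb.rightTrans_eq hs, ← one_smul ℝ (cotForm δ₁)]
    rfl
  set w₀ : E := mfderiv 𝓘(ℝ, B) 𝓘(ℝ, E) b (𝒢.r γ₂) (mfderiv 𝓘(ℝ, E) 𝓘(ℝ, B) 𝒢.s γ₁ t₁) with hw₀
  set w : E := t₂ - w₀ with hw
  have hrw : (mfderiv 𝓘(ℝ, E) 𝓘(ℝ, B) 𝒢.r γ₂ w : B) = 0 := by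
    have h1 (y : B) : (mfderiv 𝓘(ℝ, E) 𝓘(ℝ, B) 𝒢.r γ₂
        (mfderiv 𝓘(ℝ, B) 𝓘(ℝ, E) b (𝒢.r γ₂) y) : B) = y := by
      obtain ⟨c, hc⟩ := exists_hasVelocity (I := 𝓘(ℝ, B)) (𝒢.r γ₂) y
      exact (((hc.comp (hb.smooth.mdifferentiableAt (by simp))).congr_point hb.apply_r).comp
        (𝒢.mdifferentiableAt_r γ₂)).unique hc (hc.eventually hb.r_apply)
    have h2 := map_sub (mfderiv 𝓘(ℝ, E) 𝓘(ℝ, B) 𝒢.r γ₂) t₂ w₀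
    exact h2.trans (sub_eq_zero.2 ((ht.symm.trans (h1 _).symm)))
  obtain ⟨v, hv1, hv2, hv3⟩ := hb.exists_algebroid_vector hrw
  have e1 := dMul_add (𝒢 := 𝒢) (γ₁ := γ₁) (γ₂ := γ₂) t₁ w₀ 0 w
  rw [add_zero, show w₀ + w = t₂ by rw [hw]; abel] at e1
  have e2 := hP (𝒢.dMul γ₁ γ₂ t₁ w₀)
  have e3 := hP (𝒢.dMul γ₁ γ₂ (0 : E) w)
  rw [hb.mfderiv_rightTransInv_dMul hs] at e2
  rw [hv3 γ₁ hs] at e3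
  have hdf (e : E) : (differential 𝓘(ℝ, E) (f ∘ 𝒢.s) γ₁ e : ℝ) =
      cotForm δ₂ (mfderiv 𝓘(ℝ, B) 𝓘(ℝ, E) b (𝒢.r γ₂)
        (mfderiv 𝓘(ℝ, E) 𝓘(ℝ, B) 𝒢.s γ₁ e : B)) :=
    (differential_comp_apply hs hf (𝒢.mdifferentiableAt_s γ₁) e).trans (hfb _)
  have hv1' : (mfderiv 𝓘(ℝ, E) 𝓘(ℝ, B) 𝒢.s (𝒢.unit (𝒢.s γ₁)) v : B) = 0 := by rwa [hs]
  have e4 := hform v hv1'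
  have e5 : (mfderiv 𝓘(ℝ, E) 𝓘(ℝ, B) 𝒢.s γ₁ (𝒢.dLeftInv γ₁ v) : B) =
      mfderiv 𝓘(ℝ, E) 𝓘(ℝ, B) 𝒢.r (𝒢.unit (𝒢.r γ₂)) v := by
    rw [mfderiv_s_dLeftInv hv1', hs]
  have e6 : cotForm δ₂ (mfderiv 𝓘(ℝ, B) 𝓘(ℝ, E) b (𝒢.r γ₂)
      (mfderiv 𝓘(ℝ, E) 𝓘(ℝ, B) 𝒢.s γ₁ (𝒢.dLeftInv γ₁ v) : B)) =
      cotForm δ₂ (𝒢.dRight γ₂ v) + cotForm δ₂ w := by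
    refine (congrArg (fun y : B => cotForm δ₂ (mfderiv 𝓘(ℝ, B) 𝓘(ℝ, E) b (𝒢.r γ₂) y)) e5).trans ?_
    exact hv2 (cotForm δ₂)
  have e7 : cotForm δ₂ t₂ = cotForm δ₂ w₀ + cotForm δ₂ w := by
    refine Eq.trans ?_ (map_add (cotForm δ₂) w₀ w)
    exact congrArg (cotForm δ₂) (show t₂ = w₀ + w by rw [hw]; abel)
  set Ξ : E →L[ℝ] ℝ := cotForm (cotPull 1 (f ∘ 𝒢.s) (fun u _ => 𝒢.rightTransInv b' u)
      (𝒢.rightTrans b) δ₁)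
  -- `A` and `D` are the values of `δ₁` and of `d(f ∘ s)` on the two pieces, `P` is `δ₂ (dRight γ₂
  -- v)`, and `W₀`, `W`, `T` are the values of `δ₂` on `w₀`, `w`, `t₂`. The composability relation
  -- `k3` makes `P` cancel.
  have key (A₁ D₁ A₂ D₂ P W₀ W T : ℝ) (k1 : D₁ = W₀) (k2 : D₂ = P + W) (k3 : -A₂ = P)
      (k4 : T = W₀ + W) : (A₁ + D₁) + (A₂ + D₂) = A₁ + T := by linarith
  refine (congrArg Ξ e1).trans ((map_add Ξ _ _).trans ((congrArg₂ (· + ·) e2 e3).trans ?_))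
  exact key _ _ _ _ _ _ _ _ (hdf t₁) ((hdf _).trans e6) e4 e7

end IsBisection

theorem mulCot_eq_of_isProductForm {δ₁ δ₂ : CotangentBundle E G}
    (hs : 𝒢.s δ₁.proj = 𝒢.r δ₂.proj)
    {ξ : TangentSpace 𝓘(ℝ, E) (𝒢.mul δ₁.proj δ₂.proj) →L[ℝ] ℝ} (hξ : 𝒢.IsProductForm δ₁ δ₂ ξ) :
    𝒢.mulCot δ₁ δ₂ = cotMk (𝒢.mul δ₁.proj δ₂.proj) ξ := by
  have h : ∃ ξ, 𝒢.IsProductForm δ₁ δ₂ ξ := ⟨ξ, hξ⟩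
  obtain ⟨b, b', hb⟩ := 𝒢.exists_isBisection δ₂.proj
  rw [mulCot, dif_pos h]
  refine cotMk_eq rfl fun w => ?_
  obtain ⟨t₁, t₂, ht, rfl⟩ := hb.exists_dMul_eq hs w
  exact (h.choose_spec t₁ t₂ ht).trans (hξ t₁ t₂ ht).symm

theorem mulCot_unitCot (δ : CotangentBundle E G) :
    𝒢.mulCot (𝒢.unitCot (𝒢.rCot δ)) δ = δ :=
  (mulCot_eq_of_isProductForm (𝒢.s_unit _) (isProductForm_unitCot δ)).trans
    (cotMk_eq (𝒢.unit_mul _) fun _ => rfl)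

/-- The right-hand side does not depend on the constraint linking `δ₁` to `δ₂` and makes sense near
`δ₁` in `T*G`, so it can be differentiated in all directions. -/
theorem IsBisection.mulCot_eq_cotPull (hb : 𝒢.IsBisection b b' γ₂) {f : M → ℝ}
    {δ₁ δ₂ : CotangentBundle E G} (hγ₂ : δ₂.proj = γ₂) (h : 𝒢.sCot δ₁ = 𝒢.rCot δ₂)
    (hf : MDifferentiableAt 𝓘(ℝ, B) 𝓘(ℝ, ℝ) f (𝒢.r γ₂))
    (hfb : ∀ y : B, differential 𝓘(ℝ, B) f (𝒢.r γ₂) y =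
      (cotForm δ₂ : E →L[ℝ] ℝ) (mfderiv 𝓘(ℝ, B) 𝓘(ℝ, E) b (𝒢.r γ₂) y)) :
    𝒢.mulCot δ₁ δ₂ = cotPull 1 (f ∘ 𝒢.s) (fun u _ => 𝒢.rightTransInv b' u)
      (𝒢.rightTrans b) δ₁ := by
  have h1 := (sCot_eq_rCot_iff.1 h).1
  refine (mulCot_eq_of_isProductForm h1 (hb.isProductForm hγ₂ h hf hfb)).trans ?_
  subst hγ₂
  exact cotMk_eq (hb.rightTrans_eq h1).symm fun _ => rfl

/-- Only values on vectors `dRight γ v` matter. The translation intertwines these vectors, by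
commutation with left multiplication, and `d(f ∘ s)` vanishes on them because they lie in `ker ds`.
-/
theorem rCot_cotPull_rightTrans {f : M → ℝ} {δ : CotangentBundle E G}
    (h1 : 𝒢.r (b (𝒢.s δ.proj)) = 𝒢.s δ.proj)
    (h2 : b' (𝒢.s (b (𝒢.s δ.proj))) = b (𝒢.s δ.proj))
    (hψ : MDifferentiableAt 𝓘(ℝ, E) 𝓘(ℝ, E) (𝒢.rightTransInv b') (𝒢.rightTrans b δ.proj))
    (hf : MDifferentiableAt 𝓘(ℝ, B) 𝓘(ℝ, ℝ) f (𝒢.s δ.proj)) :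
    𝒢.rCot (cotPull 1 (f ∘ 𝒢.s) (fun u _ => 𝒢.rightTransInv b' u) (𝒢.rightTrans b) δ) =
      𝒢.rCot δ := by
  set γ := δ.proj
  refine Eq.symm (rCot_eq_rCot_iff.2 ⟨(r_rightTrans h1).symm, fun v hv => ?_⟩)
  obtain ⟨α, hα, hs⟩ := exists_hasVelocity_algebroid hv
  have hR := r_rightTrans (γ := γ) h1
  have e1 := (hasVelocity_mul_const (𝒢 := 𝒢) (γ := 𝒢.rightTrans b γ) (α := α) (v := v)
    (by rwa [hR]) (by rwa [hR])).comp hψ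
  have e2 := hasVelocity_mul_const (𝒢 := 𝒢) (γ := γ) hα hs
  have e3 := e1.unique e2 (by
    filter_upwards [hs] with t ht
    rw [mul_rightTrans ht h1]
    refine rightTransInv_rightTrans ?_ ?_
    · rwa [𝒢.s_mul _ _ ht]
    · rwa [𝒢.s_mul _ _ ht])
  have e4 : differential 𝓘(ℝ, E) (f ∘ 𝒢.s) γ (𝒢.dRight γ v) = 0 := by
    refine (differential_comp_apply rfl hf (𝒢.mdifferentiableAt_s γ) _).trans ?_
    exact (congrArg (fun y : B => (differential 𝓘(ℝ, B) f (𝒢.s γ) y : ℝ))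
      (mfderiv_s_dRight hv)).trans (map_zero (differential 𝓘(ℝ, B) f (𝒢.s γ)))
  have e5 : cotForm (cotPull 1 (f ∘ 𝒢.s) (fun u _ => 𝒢.rightTransInv b' u) (𝒢.rightTrans b) δ)
      (𝒢.dRight (𝒢.rightTrans b γ) v) = (fun e : E => 1 * cotForm δ e +
        differential 𝓘(ℝ, E) (f ∘ 𝒢.s) γ e) (mfderiv 𝓘(ℝ, E) 𝓘(ℝ, E) (𝒢.rightTransInv b')
          (𝒢.rightTrans b γ) (𝒢.dRight (𝒢.rightTrans b γ) v)) := rfl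
  have key (a c : ℝ) (hc : c = 0) : 1 * a + c = a := by rw [hc]; ring
  refine Eq.symm (e5.trans ?_)
  rw [e3]
  exact key _ _ e4

end RightMultiplication

end LieGroupoid

/-! ### Regularity of lifted maps, and their effect on the Liouville form. -/

section CotPull

variable {E : Type*} [NormedAddCommGroup E] [NormedSpace ℝ E]
  {G : Type*} [TopologicalSpace G] [ChartedSpace E G] [IsManifold 𝓘(ℝ, E) ∞ G]

theorem contMDiffAt_extChartAt_symm_self {F H N : Type*} [NormedAddCommGroup F] [NormedSpace ℝ F]
    [TopologicalSpace H] {I : ModelWithCorners ℝ F H} [I.Boundaryless] [TopologicalSpace N]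
    [ChartedSpace H N] {n : WithTop ℕ∞} [IsManifold I n N] {x : N} {z : F}
    (hz : z ∈ (extChartAt I x).target) : ContMDiffAt 𝓘(ℝ, F) I n (extChartAt I x).symm z :=
  (contMDiffOn_extChartAt_symm x).contMDiffAt ((isOpen_extChartAt_target x).mem_nhds hz)

/-- In coordinates the fibre component is an expression in the first derivatives of `K` and `h`, so
one order of regularity is lost. A general `K` covers both the lift of a local diffeomorphism and
the local lift of `rCot`, where `R` is the unit at the range. -/
theorem contMDiffAt_trivialization_cotPull {a : ℝ} {h : G → ℝ} {K : G → G → G} {R : G → G}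
    {δ₀ : CotangentBundle E G}
    (hK : ContMDiffAt (𝓘(ℝ, E).prod 𝓘(ℝ, E)) 𝓘(ℝ, E) 3 (fun q : G × G => K q.1 q.2)
      (R δ₀.proj, δ₀.proj))
    (hR : ContMDiffAt 𝓘(ℝ, E) 𝓘(ℝ, E) 3 R δ₀.proj)
    (hKR : ∀ᶠ γ in 𝓝 δ₀.proj, K (R γ) γ = γ)
    (hh : ContMDiffAt 𝓘(ℝ, E) 𝓘(ℝ, ℝ) 3 h δ₀.proj) :
    ContMDiffAt (cotModel E) 𝓘(ℝ, E →L[ℝ] ℝ) 2 (fun δ => (trivializationAt (E →L[ℝ] ℝ)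
      (fun g : G => TangentSpace 𝓘(ℝ, E) g →L[ℝ] Trivial G ℝ g) (R δ₀.proj)
        (cotPull a h K R δ)).2) δ₀ := by
  set γ₀ := δ₀.proj with hγ₀
  set φ := extChartAt 𝓘(ℝ, E) γ₀ with hφ
  set ψ := extChartAt 𝓘(ℝ, E) (R γ₀) with hψ
  set N : E × E → E := fun q => φ (K (ψ.symm q.1) (φ.symm q.2)) with hN
  set k : E → ℝ := h ∘ φ.symm with hk
  have hφ0 : φ.symm (φ γ₀) = γ₀ := extChartAt_to_inv (I := 𝓘(ℝ, E)) γ₀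
  have hψ0 : ψ.symm (ψ (R γ₀)) = R γ₀ := extChartAt_to_inv (I := 𝓘(ℝ, E)) (R γ₀)
  have hφs : ContMDiffAt 𝓘(ℝ, E) 𝓘(ℝ, E) 3 φ.symm (φ γ₀) :=
    contMDiffAt_extChartAt_symm_self (mem_extChartAt_target (I := 𝓘(ℝ, E)) γ₀)
  have hψs : ContMDiffAt 𝓘(ℝ, E) 𝓘(ℝ, E) 3 ψ.symm (ψ (R γ₀)) :=
    contMDiffAt_extChartAt_symm_self (mem_extChartAt_target (I := 𝓘(ℝ, E)) (R γ₀))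
  have hNs : ContDiffAt ℝ 3 N (ψ (R γ₀), φ γ₀) := by
    refine contMDiffAt_iff_contDiffAt.1 ?_
    have h1 : ContMDiffAt 𝓘(ℝ, E × E) (𝓘(ℝ, E).prod 𝓘(ℝ, E)) 3
        (fun q : E × E => (ψ.symm q.1, φ.symm q.2)) (ψ (R γ₀), φ γ₀) :=
      (hψs.comp_of_eq contDiffAt_fst.contMDiffAt rfl).prodMk
        (hφs.comp_of_eq contDiffAt_snd.contMDiffAt rfl)
    have h2 := hK.comp_of_eq h1 (by simp only [hφ0, hψ0])
    refine ContMDiffAt.comp_of_eq (contMDiffAt_extChartAt (x := γ₀)) h2 ?_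
    simp only [hφ0, hψ0]
    exact hKR.self_of_nhds
  have hks : ContDiffAt ℝ 3 k (φ γ₀) :=
    contMDiffAt_iff_contDiffAt.1 (hh.comp_of_eq hφs hφ0)
  have hπ : ContMDiffAt (cotModel E) 𝓘(ℝ, E) 3 (fun δ : CotangentBundle E G => δ.proj) δ₀ :=
    Bundle.contMDiffAt_proj _
  have hx : ContMDiffAt (cotModel E) 𝓘(ℝ, E) 3 (fun δ : CotangentBundle E G => φ δ.proj) δ₀ :=
    (contMDiffAt_extChartAt (x := γ₀)).comp_of_eq hπ rfl
  have hy : ContMDiffAt (cotModel E) 𝓘(ℝ, E) 3 (fun δ : CotangentBundle E G => ψ (R δ.proj)) δ₀ :=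
    (contMDiffAt_extChartAt (x := R γ₀)).comp_of_eq (hR.comp_of_eq hπ rfl) rfl
  have hξ : ContMDiffAt (cotModel E) 𝓘(ℝ, E →L[ℝ] ℝ) 3
      (fun δ : CotangentBundle E G => (extChartAt (cotModel E) δ₀ δ).2) δ₀ :=
    contDiffAt_snd.contMDiffAt.comp δ₀ (contMDiffAt_extChartAt (I := cotModel E) (x := δ₀))
  have hA : ContMDiffAt (cotModel E) 𝓘(ℝ, E →L[ℝ] ℝ) 2 (fun δ : CotangentBundle E G =>
      a • (extChartAt (cotModel E) δ₀ δ).2 + fderiv ℝ k (φ δ.proj)) δ₀ := by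
    have h1 : ContMDiffAt (cotModel E) 𝓘(ℝ, E →L[ℝ] ℝ) 2 (fun δ : CotangentBundle E G =>
      fderiv ℝ k (φ δ.proj)) δ₀ := ((hks.fderiv_right (m := 2)
          (by norm_num)).contMDiffAt).comp_of_eq
        (hx.of_le (by norm_num)) rfl
    exact ((contDiff_const_smul a).contMDiff.contMDiffAt.comp δ₀ (hξ.of_le (by norm_num))).add h1
  have hB : ContMDiffAt (cotModel E) 𝓘(ℝ, E →L[ℝ] E) 2 (fun δ : CotangentBundle E G =>
      (fderiv ℝ N (ψ (R δ.proj), φ δ.proj)).comp (ContinuousLinearMap.inl ℝ E E)) δ₀ := by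
    have h1 : ContMDiffAt (cotModel E) 𝓘(ℝ, E × E →L[ℝ] E) 2 (fun δ : CotangentBundle E G =>
      fderiv ℝ N (ψ (R δ.proj), φ δ.proj)) δ₀ :=
        ((hNs.fderiv_right (m := 2) (by norm_num)).contMDiffAt).comp_of_eq
          ((hy.prodMk_space hx).of_le (by norm_num)) rfl
    exact h1.clm_comp contMDiffAt_const
  refine (hA.clm_comp hB).congr_of_eventuallyEq ?_
  have c1 : ∀ᶠ δ in 𝓝 δ₀, δ.proj ∈ φ.source :=
    hπ.continuousAt.eventually ((isOpen_extChartAt_source γ₀).mem_nhds (mem_extChartAt_source γ₀))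
  have c2 : ∀ᶠ δ in 𝓝 δ₀, R δ.proj ∈ ψ.source :=
    (hR.continuousAt.comp_of_eq hπ.continuousAt rfl).eventually
      ((isOpen_extChartAt_source (R γ₀)).mem_nhds (mem_extChartAt_source (R γ₀)))
  have c3 : ∀ᶠ δ in 𝓝 δ₀, ContMDiffAt (𝓘(ℝ, E).prod 𝓘(ℝ, E)) 𝓘(ℝ, E) 3
      (fun q : G × G => K q.1 q.2) (R δ.proj, δ.proj) :=
    ((hR.continuousAt.comp_of_eq hπ.continuousAt rfl).prodMk hπ.continuousAt).eventually
      (contMDiffAt_iff_contMDiffAt_nhds (by simp) |>.1 hK)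
  have c4 : ∀ᶠ δ in 𝓝 δ₀, ContDiffAt ℝ 3 N (ψ (R δ.proj), φ δ.proj) :=
    (hy.continuousAt.prodMk hx.continuousAt).eventually (hNs.eventually (by simp))
  have c5 : ∀ᶠ δ in 𝓝 δ₀, ContMDiffAt 𝓘(ℝ, E) 𝓘(ℝ, ℝ) 3 h δ.proj :=
    hπ.continuousAt.eventually (contMDiffAt_iff_contMDiffAt_nhds (by simp) |>.1 hh)
  have c6 : ∀ᶠ δ in 𝓝 δ₀, K (R δ.proj) δ.proj = δ.proj := hπ.continuousAt.eventually hKR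
  filter_upwards [c1, c2, c3, c4, c5, c6] with δ d1 d2 d3 d4 d5 d6
  have d1' : δ.proj ∈ (chartAt E γ₀).source := by rwa [hφ, extChartAt_source] at d1
  have d2' : R δ.proj ∈ (chartAt E (R γ₀)).source := by rwa [hψ, extChartAt_source] at d2
  refine (cot_trivializationAt_snd (R γ₀) (cotPull a h K R δ) d2').trans ?_
  rw [cot_extChartAt_apply _ _ d1']
  refine ContinuousLinearMap.ext fun v : E => ?_
  set γ := δ.proj
  have f1 : HasVelocity 𝓘(ℝ, E) (fun t : ℝ => ψ (R γ) + t • v) (ψ (R γ)) v := by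
    refine hasVelocity_iff_hasDerivAt.2 ⟨by simp, ?_⟩
    simpa using ((hasDerivAt_id (0 : ℝ)).smul_const v).const_add (ψ (R γ))
  have f2 := (f1.comp (mdifferentiableAt_extChartAt_symm' (I := 𝓘(ℝ, E))
    (ψ.map_source d2))).congr_point (ψ.left_inv d2)
  have f3 : MDifferentiableAt 𝓘(ℝ, E) 𝓘(ℝ, E) (fun u => K u γ) (R γ) :=
    MDifferentiableAt.comp (g := fun q : G × G => K q.1 q.2) (f := fun u => (u, γ)) (R γ)
      (d3.mdifferentiableAt (by simp)) (mdifferentiableAt_id.prodMk mdifferentiableAt_const)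
  have f4 := (f2.comp f3).congr_point d6
  have f5 := f4.comp (mdifferentiableAt_extChartAt (I := 𝓘(ℝ, E)) (x := γ₀) d1')
  have f6 := (f1.prodMk (hasVelocity_const (I := 𝓘(ℝ, E)) (φ γ)))
  have f7 : HasDerivAt (fun t : ℝ => N (ψ (R γ) + t • v, φ γ))
      (fderiv ℝ N (ψ (R γ), φ γ) (v, 0)) 0 := by
    have g1 : HasDerivAt (fun t : ℝ => (ψ (R γ) + t • v, φ γ)) (v, (0 : E)) 0 :=
      (hasVelocity_iff_hasDerivAt.1 f1).2.prodMk (hasDerivAt_const _ _)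
    refine HasFDerivAt.comp_hasDerivAt_of_eq (0 : ℝ) (d4.differentiableAt
        (by simp)).hasFDerivAt g1 ?_
    simp
  have f8 := f5.unique (hasVelocity_iff_hasDerivAt.2 ⟨rfl, f7⟩) (.of_forall fun t => by
    simp only [hN]
    rw [φ.left_inv d1])
  set w : E := mfderiv 𝓘(ℝ, E) 𝓘(ℝ, E) (fun u => K u γ) (R γ)
    (mfderiv 𝓘(ℝ, E) 𝓘(ℝ, E) ψ.symm (ψ (R γ)) v) with hw
  have f9 := mfderiv_symm_comp_extChartAt (I := 𝓘(ℝ, E)) d1 w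
  have f10 : (mfderiv 𝓘(ℝ, E) 𝓘(ℝ, E) φ.symm (φ γ) (fderiv ℝ N (ψ (R γ), φ γ) (v, 0)) : E) = w :=
    (congrArg (fun e : E => (mfderiv 𝓘(ℝ, E) 𝓘(ℝ, E) φ.symm (φ γ) e : E)) f8.symm).trans f9
  have f11 (e : E) : fderiv ℝ k (φ γ) e =
      differential 𝓘(ℝ, E) h γ (mfderiv 𝓘(ℝ, E) 𝓘(ℝ, E) φ.symm (φ γ) e : E) := by
    have g1 := mfderiv_comp (φ γ) (f := φ.symm) (g := h) (I' := 𝓘(ℝ, E))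
      (by rw [φ.left_inv d1]; exact d5.mdifferentiableAt (by simp))
      (mdifferentiableAt_extChartAt_symm' (I := 𝓘(ℝ, E)) (φ.map_source d1))
    rw [mfderiv_eq_fderiv] at g1
    have g2 := DFunLike.congr_fun g1 e
    rw [φ.left_inv d1] at g2
    exact g2
  have f12 : (a • ((cotForm δ).comp (mfderiv 𝓘(ℝ, E) 𝓘(ℝ, E) φ.symm (φ γ)) : E →L[ℝ] ℝ) +
      fderiv ℝ k (φ γ)) (fderiv ℝ N (ψ (R γ), φ γ) (v, 0)) =
      a * cotForm δ w + differential 𝓘(ℝ, E) h γ w := by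
    have key (x y x' y' : ℝ) (hx : x = x') (hy : y = y') : a * x + y = a * x' + y' := by
      rw [hx, hy]
    refine key _ _ _ _ (congrArg (cotForm δ : E →L[ℝ] ℝ) f10) ?_
    exact (f11 _).trans <| congrArg (differential 𝓘(ℝ, E) h γ : E →L[ℝ] ℝ) f10
  exact f12.symm

theorem contMDiffAt_cotPull {a : ℝ} {h : G → ℝ} {K : G → G → G} {R : G → G}
    {δ₀ : CotangentBundle E G}
    (hK : ContMDiffAt (𝓘(ℝ, E).prod 𝓘(ℝ, E)) 𝓘(ℝ, E) 3 (fun q : G × G => K q.1 q.2)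
      (R δ₀.proj, δ₀.proj))
    (hR : ContMDiffAt 𝓘(ℝ, E) 𝓘(ℝ, E) 3 R δ₀.proj)
    (hKR : ∀ᶠ γ in 𝓝 δ₀.proj, K (R γ) γ = γ)
    (hh : ContMDiffAt 𝓘(ℝ, E) 𝓘(ℝ, ℝ) 3 h δ₀.proj) :
    ContMDiffAt (cotModel E) (cotModel E) 2 (cotPull a h K R) δ₀ := by
  refine Bundle.contMDiffAt_totalSpace.2
    ⟨?_, contMDiffAt_trivialization_cotPull hK hR hKR hh⟩
  exact (hR.comp_of_eq (Bundle.contMDiffAt_proj (n := 3) _) rfl).of_le (by norm_num)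

/-- The lift covers `R` and composes covectors with `dψ`; since `ψ ∘ R = id`, the base velocity is
returned unchanged to `a ξ + dh`. -/
theorem liouville_cotPull {a : ℝ} {h : G → ℝ} {ψ R : G → G} {δ : CotangentBundle E G}
    (hΦ : MDifferentiableAt (cotModel E) (cotModel E) (cotPull a h (fun u _ => ψ u) R) δ)
    (hψ : MDifferentiableAt 𝓘(ℝ, E) 𝓘(ℝ, E) ψ (R δ.proj))
    (hψR : ∀ᶠ γ in 𝓝 δ.proj, ψ (R γ) = γ)
    (hh : MDifferentiableAt 𝓘(ℝ, E) 𝓘(ℝ, ℝ) h δ.proj) (v : TangentSpace (cotModel E) δ) :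
    liouville (cotPull a h (fun u _ => ψ u) R δ)
      (mfderiv (cotModel E) (cotModel E) (cotPull a h (fun u _ => ψ u) R) δ v) =
      a * liouville δ v +
        differential (cotModel E) (fun δ' : CotangentBundle E G => h δ'.proj) δ v := by
  obtain ⟨c, hc⟩ := exists_hasVelocity (I := cotModel E) δ v
  have hπ (δ' : CotangentBundle E G) : MDifferentiableAt (cotModel E) 𝓘(ℝ, E)
      (fun δ : CotangentBundle E G => δ.proj) δ' :=
    (Bundle.contMDiffAt_proj (n := 1) _).mdifferentiableAt one_ne_zero
  set w : E := mfderiv (cotModel E) 𝓘(ℝ, E) (fun δ : CotangentBundle E G => δ.proj) δ v with hw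
  have h1 : HasVelocity 𝓘(ℝ, E) (fun t => (c t).proj) δ.proj w := hc.comp (hπ δ)
  have h2 : HasVelocity 𝓘(ℝ, E) (fun t => R (c t).proj) (R δ.proj) _ := (hc.comp hΦ).comp (hπ _)
  have h3 := (h2.comp hψ).unique h1 (h1.eventually hψR)
  have h4 : (mfderiv (cotModel E) 𝓘(ℝ, ℝ) (fun δ' : CotangentBundle E G => h δ'.proj) δ v : ℝ) =
      mfderiv 𝓘(ℝ, E) 𝓘(ℝ, ℝ) h δ.proj w :=
    DFunLike.congr_fun (mfderiv_comp δ hh (hπ δ)) v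
  have h5 : liouville (cotPull a h (fun u _ => ψ u) R δ)
      (mfderiv (cotModel E) (cotModel E) (cotPull a h (fun u _ => ψ u) R) δ v) =
      (fun e : E => a * cotForm δ e + differential 𝓘(ℝ, E) h δ.proj e)
        (mfderiv 𝓘(ℝ, E) 𝓘(ℝ, E) ψ (R δ.proj) (mfderiv (cotModel E) 𝓘(ℝ, E)
          (fun δ : CotangentBundle E G => δ.proj) (cotPull a h (fun u _ => ψ u) R δ)
          (mfderiv (cotModel E) (cotModel E) (cotPull a h (fun u _ => ψ u) R) δ v))) := rfl
  rw [h5, h3]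
  exact congrArg (fun e : ℝ => a * liouville δ v + e) h4.symm

/-- The maps `cotPull` which rescale `p` preserve the Hamiltonian field of `p`. -/
theorem mfderiv_cotPull_hamiltonianField [FiniteDimensional ℝ E] {a : ℝ} (ha : a ≠ 0) {h : G → ℝ}
    {ψ R : G → G} {p : CotangentBundle E G → ℝ} {δ : CotangentBundle E G}
    (hR : ContMDiffAt 𝓘(ℝ, E) 𝓘(ℝ, E) 3 R δ.proj)
    (hψ : ContMDiffAt 𝓘(ℝ, E) 𝓘(ℝ, E) 3 ψ (R δ.proj))
    (hψR : ∀ᶠ γ in 𝓝 δ.proj, ψ (R γ) = γ)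
    (hh : ContMDiffAt 𝓘(ℝ, E) 𝓘(ℝ, ℝ) 3 h δ.proj)
    (hp : MDifferentiableAt (cotModel E) 𝓘(ℝ, ℝ) p (cotPull a h (fun u _ => ψ u) R δ))
    (hpΦ : ∀ᶠ δ' in 𝓝 δ, p (cotPull a h (fun u _ => ψ u) R δ') = a * p δ') :
    MDifferentiableAt (cotModel E) (cotModel E) (cotPull a h (fun u _ => ψ u) R) δ ∧
    mfderiv (cotModel E) (cotModel E) (cotPull a h (fun u _ => ψ u) R) δ (hamiltonianField p δ) =
      hamiltonianField p (cotPull a h (fun u _ => ψ u) R δ) := by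
  have hπ : ContMDiffAt (cotModel E) 𝓘(ℝ, E) 3 (fun δ : CotangentBundle E G => δ.proj) δ :=
    Bundle.contMDiffAt_proj _
  have hΦ : ContMDiffAt (cotModel E) (cotModel E) 2 (cotPull a h (fun u _ => ψ u) R) δ :=
    contMDiffAt_cotPull (hψ.comp_of_eq contMDiffAt_fst rfl) hR hψR hh
  have hhπ : ContMDiffAt (cotModel E) 𝓘(ℝ, ℝ) 3 (fun δ' : CotangentBundle E G => h δ'.proj) δ :=
    hh.comp_of_eq hπ rfl
  refine ⟨hΦ.mdifferentiableAt (by simp),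
    mfderiv_hamiltonianField ha hΦ (hhπ.of_le (by norm_num)) ?_ hp hpΦ⟩
  filter_upwards [contMDiffAt_iff_contMDiffAt_nhds (by simp) |>.1 hΦ,
    hπ.continuousAt.eventually (hR.continuousAt.eventually
      (contMDiffAt_iff_contMDiffAt_nhds (by simp) |>.1 hψ)),
    hπ.continuousAt.eventually (eventually_eventually_nhds.2 hψR),
    hπ.continuousAt.eventually (contMDiffAt_iff_contMDiffAt_nhds (by simp) |>.1 hh)]
    with δ' h1 h3 h4 h5 v
  exact liouville_cotPull (h1.mdifferentiableAt (by simp))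
    (h3.mdifferentiableAt (by simp)) h4 (h5.mdifferentiableAt (by simp)) v

end CotPull

/-! ### Smoothness of `p₀ ∘ rCot` and openness of its domain. -/

namespace LieGroupoid

section Smoothness

variable {E B G M : Type*}
  [NormedAddCommGroup E] [NormedSpace ℝ E] [NormedAddCommGroup B] [NormedSpace ℝ B]
  [TopologicalSpace G] [ChartedSpace E G] [TopologicalSpace M] [ChartedSpace B M]
  [IsManifold 𝓘(ℝ, E) ∞ G] {𝒢 : LieGroupoid E B G M}

theorem cotForm_cotPull_apply {K : G → G → G} {R : G → G} (δ : CotangentBundle E G) (u : E) :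
    cotForm (cotPull 1 (fun _ => 0) K R δ) u = (cotForm δ : E →L[ℝ] ℝ)
      (mfderiv 𝓘(ℝ, E) 𝓘(ℝ, E) (fun u => K u δ.proj) (R δ.proj) u) := by
  have h (w : E) (l d : E →L[ℝ] ℝ) (hd : d = 0) : ((1 : ℝ) • l + d) w = l w := by simp [hd]
  exact h _ _ (differential 𝓘(ℝ, E) (fun _ : G => (0 : ℝ)) δ.proj) mfderiv_const

/-- The local lift to `T*G|_M` of the range map of the cotangent groupoid. -/
def rangeLift (𝒢 : LieGroupoid E B G M) (K : G → G → G) (δ : CotangentBundle E G) :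
    𝒢.UnitCotangentBundle :=
  ⟨𝒢.r δ.proj, (cotPull 1 (fun _ => 0) K (fun γ => 𝒢.unit (𝒢.r γ)) δ).2⟩

theorem contMDiffAt_rangeLift {K : G → G → G} {δ₀ : CotangentBundle E G}
    (hK : ContMDiffAt (𝓘(ℝ, E).prod 𝓘(ℝ, E)) 𝓘(ℝ, E) 3 (fun q : G × G => K q.1 q.2)
      (𝒢.unit (𝒢.r δ₀.proj), δ₀.proj))
    (hKR : ∀ᶠ γ in 𝓝 δ₀.proj, K (𝒢.unit (𝒢.r γ)) γ = γ) :
    ContMDiffAt (cotModel E) (𝓘(ℝ, B).prod 𝓘(ℝ, E →L[ℝ] ℝ)) 2 (𝒢.rangeLift K) δ₀ := by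
  have hπ : ContMDiffAt (cotModel E) 𝓘(ℝ, E) 2 (fun δ : CotangentBundle E G => δ.proj) δ₀ :=
    Bundle.contMDiffAt_proj _
  have hr : ContMDiffAt 𝓘(ℝ, E) 𝓘(ℝ, B) 3 𝒢.r δ₀.proj := (𝒢.r.contMDiff _).of_le (by norm_cast)
  have h1 : ContMDiffAt (cotModel E) 𝓘(ℝ, B) 2 (fun δ => (𝒢.rangeLift K δ).proj) δ₀ :=
    (hr.of_le (by norm_num)).comp_of_eq hπ rfl
  have h2 := contMDiffAt_trivialization_cotPull (a := 1) (h := fun _ => 0) hK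
    (((𝒢.unit.contMDiff _).of_le (by norm_cast)).comp δ₀.proj hr) hKR contMDiffAt_const
  rw [Bundle.contMDiffAt_totalSpace]
  refine ⟨h1, ?_⟩
  have h3 (q : 𝒢.UnitCotangentBundle) : (trivializationAt (E →L[ℝ] ℝ)
      (𝒢.unit *ᵖ (fun g : G => TangentSpace 𝓘(ℝ, E) g →L[ℝ] Trivial G ℝ g)) (𝒢.r δ₀.proj) q).2 =
      (trivializationAt (E →L[ℝ] ℝ)
      (fun g : G => TangentSpace 𝓘(ℝ, E) g →L[ℝ] Trivial G ℝ g) (𝒢.unit (𝒢.r δ₀.proj))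
      (cotMk (𝒢.unit q.proj) q.2)).2 := rfl
  refine h2.congr_of_eventuallyEq (.of_forall fun δ => ?_)
  exact h3 _

theorem rCot_eq_restrict_rangeLift {K : G → G → G} {δ : CotangentBundle E G}
    (h : ∀ v : E, (mfderiv 𝓘(ℝ, E) 𝓘(ℝ, B) 𝒢.s (𝒢.unit (𝒢.r δ.proj)) v : B) = 0 →
        (mfderiv 𝓘(ℝ, E) 𝓘(ℝ, E) (fun u => K u δ.proj) (𝒢.unit (𝒢.r δ.proj)) v : E) =
          𝒢.dRight δ.proj v) :
    𝒢.restrict (𝒢.rangeLift K δ) = 𝒢.rCot δ := by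
  refine dualAlgebroid_mk_eq_iff.2 ⟨rfl, fun v hv => ?_⟩
  refine (cotForm_cotPull_apply (R := fun γ => 𝒢.unit (𝒢.r γ)) δ v).trans ?_
  exact congrArg (cotForm δ : E →L[ℝ] ℝ) (h v hv)

variable [FiniteDimensional ℝ E] [FiniteDimensional ℝ B] [IsManifold 𝓘(ℝ, B) ∞ M]

/-- Near `γ₀`, right multiplication by `γ` extends from the fibre of `s` over `r γ` to a smooth map
`K(·, γ)` whose differential at the unit of `r γ` takes values in the range of `dRight γ`. -/
theorem exists_extension_mul (𝒢 : LieGroupoid E B G M) (γ₀ : G) : ∃ K : G → G → G,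
    ContMDiffAt (𝓘(ℝ, E).prod 𝓘(ℝ, E)) 𝓘(ℝ, E) 3 (fun q : G × G => K q.1 q.2)
      (𝒢.unit (𝒢.r γ₀), γ₀) ∧
    (∀ᶠ γ in 𝓝 γ₀, K (𝒢.unit (𝒢.r γ)) γ = γ) ∧
    ∀ᶠ γ in 𝓝 γ₀,
      (∀ v : E, (mfderiv 𝓘(ℝ, E) 𝓘(ℝ, B) 𝒢.s (𝒢.unit (𝒢.r γ)) v : B) = 0 →
        (mfderiv 𝓘(ℝ, E) 𝓘(ℝ, E) (fun u => K u γ) (𝒢.unit (𝒢.r γ)) v : E) = 𝒢.dRight γ v) ∧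
      ∀ u : E, ∃ v : E, (mfderiv 𝓘(ℝ, E) 𝓘(ℝ, B) 𝒢.s (𝒢.unit (𝒢.r γ)) v : B) = 0 ∧
        (mfderiv 𝓘(ℝ, E) 𝓘(ℝ, E) (fun u => K u γ) (𝒢.unit (𝒢.r γ)) u : E) = 𝒢.dRight γ v := by
  set x₀ := 𝒢.r γ₀ with hx₀
  obtain ⟨ρ, h1, h2, h3⟩ := exists_retraction
    ((𝒢.s.contMDiff (𝒢.unit x₀)).of_le (m := 3) (by norm_cast)) (𝒢.s_submersion _)
  rw [𝒢.s_unit] at h1 h2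
  have hu : Filter.Tendsto (fun γ => 𝒢.unit (𝒢.r γ)) (𝓝 γ₀) (𝓝 (𝒢.unit x₀)) :=
    (𝒢.unit.contMDiff.continuous.comp 𝒢.r.contMDiff.continuous).continuousAt
  have hr : Filter.Tendsto 𝒢.r (𝓝 γ₀) (𝓝 x₀) := 𝒢.r.contMDiff.continuous.continuousAt
  have hq : Filter.Tendsto (fun q : G × G => (q.1, 𝒢.r q.2)) (𝓝 (𝒢.unit x₀, γ₀))
      (𝓝 (𝒢.unit x₀, x₀)) := by
    refine Filter.Tendsto.prodMk_nhds continuousAt_fst ?_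
    exact (𝒢.r.contMDiff.continuous.comp continuous_snd).continuousAt
  have hr3 : ContMDiffAt (𝓘(ℝ, E).prod 𝓘(ℝ, E)) 𝓘(ℝ, B) 3 (fun q : G × G => 𝒢.r q.2)
      (𝒢.unit x₀, γ₀) :=
    ContMDiffAt.comp_of_eq ((𝒢.r.contMDiff γ₀).of_le (by norm_cast)) contMDiffAt_snd rfl
  have hK : ContMDiffAt (𝓘(ℝ, E).prod 𝓘(ℝ, E)) 𝓘(ℝ, E) 3
      (fun q : G × G => 𝒢.mul (ρ (q.1, 𝒢.r q.2)) q.2) (𝒢.unit x₀, γ₀) :=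
    contMDiffAt_mul (h1.comp_of_eq (contMDiffAt_fst.prodMk hr3) rfl) contMDiffAt_snd
      (hq.eventually h2)
  -- Retracting `u` onto the fibre of `s` over `r γ` makes it composable with `γ`. The retraction
  -- fixes this fibre, so the extension agrees with right multiplication there.
  refine ⟨fun u γ => 𝒢.mul (ρ (u, 𝒢.r γ)) γ, hK, ?_, ?_⟩
  · filter_upwards [hu.eventually h3] with γ h4
    rw [𝒢.s_unit] at h4
    rw [h4, 𝒢.unit_mul]
  · filter_upwards [hu.eventually (eventually_eventually_nhds.2 h3),
      (hu.prodMk_nhds hr).eventually (contMDiffAt_iff_contMDiffAt_nhds (by simp) |>.1 h1),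
      (hu.prodMk_nhds Filter.tendsto_id).eventually
        (contMDiffAt_iff_contMDiffAt_nhds (by simp) |>.1 hK),
      (hu.prodMk_nhds hr).eventually (eventually_eventually_nhds.2 h2)] with γ h4 h5 h6 h7
    have hKd : MDifferentiableAt 𝓘(ℝ, E) 𝓘(ℝ, E) (fun u => 𝒢.mul (ρ (u, 𝒢.r γ)) γ)
        (𝒢.unit (𝒢.r γ)) :=
      MDifferentiableAt.comp (g := fun q : G × G => 𝒢.mul (ρ (q.1, 𝒢.r q.2)) q.2)
        (f := fun u => (u, γ)) (𝒢.unit (𝒢.r γ)) (h6.mdifferentiableAt (by simp))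
        (mdifferentiableAt_id.prodMk mdifferentiableAt_const)
    have h8 := h4.self_of_nhds
    rw [𝒢.s_unit] at h8
    refine ⟨fun v hv => ?_, fun u => ?_⟩
    · obtain ⟨α, hα, hs⟩ := exists_hasVelocity_algebroid hv
      refine (hα.comp hKd).unique (hasVelocity_mul_const hα hs) ?_
      filter_upwards [hs, hα.eventually h4] with t e1 e2
      rw [e1] at e2
      rw [e2]
    · obtain ⟨c, hc⟩ := exists_hasVelocity (I := 𝓘(ℝ, E)) (𝒢.unit (𝒢.r γ)) u
      have h9 := hc.prodMk (hasVelocity_const (I := 𝓘(ℝ, B)) (𝒢.r γ))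
      have h10 := (h9.comp (h5.mdifferentiableAt (by simp))).congr_point h8
      have h11 := h9.eventually h7
      exact ⟨_, (h10.comp (𝒢.mdifferentiableAt_s _)).unique (hasVelocity_const (𝒢.r γ)) h11,
        (hc.comp hKd).unique (hasVelocity_mul_const h10 h11) (.of_forall fun t => rfl)⟩

/-- Membership is detected near `δ₀` by a continuous coordinate form being nonzero. It cannot be
nonzero without `rCot` being nonzero, since the extended differential has the same range as `dRight`
on the algebroid. -/
theorem isOpen_domCot : IsOpen 𝒢.domCot := by
  refine isOpen_iff_mem_nhds.2 fun δ₀ hδ₀ => ?_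
  obtain ⟨K, h1, h2, h3⟩ := 𝒢.exists_extension_mul δ₀.proj
  have hπ : Filter.Tendsto (fun δ : CotangentBundle E G => δ.proj) (𝓝 δ₀) (𝓝 δ₀.proj) :=
    (Bundle.contMDiffAt_proj (IB := 𝓘(ℝ, E)) (n := 1) _).continuousAt
  set R : G → G := fun γ => 𝒢.unit (𝒢.r γ)
  have hR : ContMDiffAt 𝓘(ℝ, E) 𝓘(ℝ, E) 3 R δ₀.proj :=
    ((𝒢.unit.contMDiff _).of_le (by norm_cast)).comp δ₀.proj
      ((𝒢.r.contMDiff _).of_le (by norm_cast))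
  have h4 := contMDiffAt_trivialization_cotPull (a := 1) (h := fun _ => 0) h1 hR h2
    contMDiffAt_const
  have h5 : (trivializationAt (E →L[ℝ] ℝ)
      (fun g : G => TangentSpace 𝓘(ℝ, E) g →L[ℝ] Trivial G ℝ g) (R δ₀.proj)
        (cotPull 1 (fun _ => 0) K R δ₀)).2 ≠ 0 := by
    obtain ⟨v, hv, hv'⟩ := mem_domCot_iff.1 hδ₀
    rw [← h3.self_of_nhds.1 v hv] at hv'
    intro h0
    refine hv' ((cotForm_cotPull_apply (K := K) (R := R) δ₀ v).symm.trans ?_)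
    have h6 := cot_trivializationAt_snd (R δ₀.proj) (cotPull 1 (fun _ => 0) K R δ₀)
      (mem_chart_source _ _)
    rw [h0] at h6
    have h7 := DFunLike.congr_fun h6
      (mfderiv 𝓘(ℝ, E) 𝓘(ℝ, E) (extChartAt 𝓘(ℝ, E) (R δ₀.proj)) (R δ₀.proj) v)
    refine Eq.trans ?_ h7.symm
    exact congrArg (cotForm (cotPull 1 (fun _ => 0) K R δ₀) : E →L[ℝ] ℝ)
      (mfderiv_symm_comp_extChartAt (I := 𝓘(ℝ, E)) (mem_extChartAt_source (R δ₀.proj)) v).symm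
  have c1 : ∀ᶠ δ in 𝓝 δ₀, R δ.proj ∈ (chartAt E (R δ₀.proj)).source :=
    (hR.continuousAt.tendsto.comp hπ).eventually
      ((chartAt E (R δ₀.proj)).open_source.mem_nhds (mem_chart_source _ _))
  filter_upwards [h4.continuousAt.eventually_ne h5, hπ.eventually h3, c1] with δ e1 e2 e3
  rw [cot_trivializationAt_snd (R δ₀.proj) (cotPull 1 (fun _ => 0) K R δ) e3] at e1
  obtain ⟨u, hu⟩ := DFunLike.ne_iff.1 e1
  obtain ⟨v, hv1, hv2⟩ := e2.2 (mfderiv 𝓘(ℝ, E) 𝓘(ℝ, E) (extChartAt 𝓘(ℝ, E) (R δ₀.proj)).symm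
      (extChartAt 𝓘(ℝ, E) (R δ₀.proj) (R δ.proj)) u)
  refine mem_domCot_iff.2 ⟨v, hv1, fun h0 => hu ?_⟩
  refine Eq.trans ?_ h0
  exact (cotForm_cotPull_apply (K := K) (R := R) δ _).trans
    (congrArg (cotForm δ : E →L[ℝ] ℝ) hv2)

/-- Smoothness of `p₀` is stated upstairs, on `T*G|_M`, so `rCot` is factored locally through the
lift `rangeLift`. Class `C²` suffices: it makes the Hamiltonian field `C¹`. -/
theorem contMDiffAt_comp_rCot {p₀ : 𝒢.DualAlgebroid → ℝ} (hp₀ : 𝒢.SmoothOffZero p₀)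
    {δ₀ : CotangentBundle E G} (hδ₀ : δ₀ ∈ 𝒢.domCot) :
    ContMDiffAt (cotModel E) 𝓘(ℝ, ℝ) 2 (fun δ => p₀ (𝒢.rCot δ)) δ₀ := by
  obtain ⟨K, h1, h2, h3⟩ := 𝒢.exists_extension_mul δ₀.proj
  have hπ : Filter.Tendsto (fun δ : CotangentBundle E G => δ.proj) (𝓝 δ₀) (𝓝 δ₀.proj) :=
    (Bundle.contMDiffAt_proj (IB := 𝓘(ℝ, E)) (n := 1) _).continuousAt
  have h4 : ∀ᶠ δ in 𝓝 δ₀, 𝒢.restrict (𝒢.rangeLift K δ) = 𝒢.rCot δ :=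
    (hπ.eventually h3).mono fun δ hδ => rCot_eq_restrict_rangeLift hδ.1
  have h5 := contMDiffAt_rangeLift h1 h2
  have h6 := (hp₀ (𝒢.rangeLift K δ₀) (by
    rw [mem_ofPred_eq, h4.self_of_nhds]
    exact hδ₀)).of_le (m := 2) (by norm_cast)
  have h7 := ContMDiffWithinAt.comp (g := fun q => p₀ (𝒢.restrict q)) (f := 𝒢.rangeLift K)
    (s := {δ | (𝒢.restrict (𝒢.rangeLift K δ)).2 ≠ 0}) δ₀ h6 h5.contMDiffWithinAt
    (fun δ hδ => hδ)
  refine (h7.contMDiffAt ?_).congr_of_eventuallyEq ?_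
  · filter_upwards [h4, isOpen_domCot.mem_nhds hδ₀] with δ e1 e2
    rw [e1]
    exact e2
  · filter_upwards [h4] with δ e1
    exact congrArg p₀ e1.symm

end Smoothness

end LieGroupoid

/-! ### Infinitesimal cotangent lifts and Hamilton's equations in coordinates. -/

section FibreCoordinates

theorem HasDerivAt.ringInverse_of_eq_one {R : Type*} [NormedRing R] [NormedAlgebra ℝ R]
    [CompleteSpace R] {A : ℝ → R} {D : R} {t : ℝ} (hA : HasDerivAt A D t) (h : A t = 1) :
    HasDerivAt (fun τ => Ring.inverse (A τ)) (-D) t := by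
  have h1 := hasFDerivAt_ringInverse (𝕜 := ℝ) (1 : Rˣ)
  rw [Units.val_one, ← h] at h1
  refine (HasFDerivAt.comp_hasDerivAt t h1 hA).congr_deriv ?_
  have h2 (u : Rˣ) (hu : (↑u⁻¹ : R) = 1) : -((↑u⁻¹ : R) * D * ↑u⁻¹) = -D := by
    rw [hu, one_mul, mul_one]
  exact h2 1 (by rw [inv_one, Units.val_one])

/-- The covector transported by `N (τ, ·)` is `ξ₀ ∘ (d_x N)⁻¹`. Since `d_x N` is the identity at `τ
= 0`, the derivative there is `-ξ₀ ∘ D`, where `D` is the differential of the generator of the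
family. -/
theorem exists_transported_form {E : Type*} [NormedAddCommGroup E] [NormedSpace ℝ E]
    [CompleteSpace E] {N : ℝ × E → E} {x₀ : E} (hN : ContDiffAt ℝ 2 N (0, x₀))
    (hN0 : ∀ᶠ x in 𝓝 x₀, N (0, x) = x) (ξ₀ : E →L[ℝ] ℝ) :
    ∃ ζ : ℝ → E →L[ℝ] ℝ, ζ 0 = ξ₀ ∧
      (∀ᶠ τ in 𝓝 0, ∀ e, ζ τ (fderiv ℝ N (τ, x₀) (0, e)) = ξ₀ e) ∧
      ∃ D : E →L[ℝ] E, HasFDerivAt (fun x => fderiv ℝ N (0, x) (1, 0)) D x₀ ∧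
        HasDerivAt ζ (-ξ₀.comp D) 0 := by
  have hN2 : HasFDerivAt (fderiv ℝ N) (fderiv ℝ (fderiv ℝ N) (0, x₀)) (0, x₀) :=
    ((hN.fderiv_right (m := 1) (by norm_num)).differentiableAt (by simp)).hasFDerivAt
  have hsym := hN.isSymmSndFDerivAt (by simp)
  have hi : HasFDerivAt (fun x : E => ((0 : ℝ), x)) (ContinuousLinearMap.inr ℝ ℝ E) x₀ :=
    (ContinuousLinearMap.inr ℝ ℝ E).hasFDerivAt
  have hD := HasFDerivAt.clm_apply_vec (HasFDerivAt.comp x₀ hN2 hi) ((1 : ℝ), (0 : E))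
  set D : E →L[ℝ] E := ((fderiv ℝ (fderiv ℝ N) (0, x₀)).comp
    (ContinuousLinearMap.inr ℝ ℝ E)).flip ((1 : ℝ), (0 : E)) with hDdef
  have hj : HasDerivAt (fun τ : ℝ => (τ, x₀)) ((1 : ℝ), (0 : E)) 0 :=
    (hasDerivAt_id (0 : ℝ)).prodMk (hasDerivAt_const _ _)
  have hA : HasDerivAt (fun τ : ℝ => (fderiv ℝ N (τ, x₀)).comp (ContinuousLinearMap.inr ℝ ℝ E))
      D 0 := by
    have h1 := HasFDerivAt.comp_hasDerivAt (0 : ℝ) hN2 hj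
    have h2 := ((ContinuousLinearMap.compL ℝ E (ℝ × E) E).flip
      (ContinuousLinearMap.inr ℝ ℝ E)).hasFDerivAt.comp_hasDerivAt (0 : ℝ) h1
    refine h2.congr_deriv (ContinuousLinearMap.ext fun e => ?_)
    -- Mixed derivatives in `τ` and `x` commute, so the `τ`-derivative of `d_x N` is the
    -- `x`-differential of the generator.
    exact hsym (1, 0) (0, e)
  have hA0 : (fderiv ℝ N (0, x₀)).comp (ContinuousLinearMap.inr ℝ ℝ E) = 1 := by
    have h1 := HasFDerivAt.comp x₀ (hN.differentiableAt (by simp)).hasFDerivAt hi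
    exact h1.unique ((hasFDerivAt_id x₀).congr_of_eventuallyEq hN0)
  set A : ℝ → E →L[ℝ] E := fun τ => (fderiv ℝ N (τ, x₀)).comp (ContinuousLinearMap.inr ℝ ℝ E)
  have hinv : HasDerivAt (fun τ => Ring.inverse (A τ)) (-D) 0 := hA.ringInverse_of_eq_one hA0
  refine ⟨fun τ => ξ₀.comp (Ring.inverse (A τ)), ?_, ?_, D, hD, ?_⟩
  · simp only [A, hA0, Ring.inverse_one]
    rfl
  · have h1 : ∀ᶠ L in 𝓝 (A 0), IsUnit L :=
      Units.isOpen.mem_nhds (by simp only [A, hA0]; exact isUnit_one)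
    filter_upwards [hA.continuousAt.eventually h1] with τ hτ e
    have h2 := DFunLike.congr_fun (Ring.inverse_mul_cancel (A τ) hτ) e
    exact congrArg ξ₀ h2
  · have h1 := ((ContinuousLinearMap.compL ℝ E E ℝ) ξ₀).hasFDerivAt.comp_hasDerivAt (0 : ℝ) hinv
    refine h1.congr_deriv (ContinuousLinearMap.ext fun e => ?_)
    simp

variable {E : Type*} [NormedAddCommGroup E] [NormedSpace ℝ E]
  {G : Type*} [TopologicalSpace G] [ChartedSpace E G] [IsManifold 𝓘(ℝ, E) ∞ G]

theorem mfderiv_apply_eq_hamiltonianField [FiniteDimensional ℝ E] (p : CotangentBundle E G → ℝ)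
    (δ : CotangentBundle E G) (v : E × (E →L[ℝ] ℝ)) :
    (mfderiv (cotModel E) 𝓘(ℝ, ℝ) p δ v : ℝ) =
      v.2 (hamiltonianField p δ : E × (E →L[ℝ] ℝ)).1 -
        (hamiltonianField p δ : E × (E →L[ℝ] ℝ)).2 v.1 := by
  rw [hamiltonianField_eq]
  exact (stdFlat_symm_apply (mfderiv (cotModel E) 𝓘(ℝ, ℝ) p δ) v).symm

theorem cotForm_eq_chart (δ₀ : CotangentBundle E G) {δ : CotangentBundle E G}
    (h : δ.proj ∈ (extChartAt 𝓘(ℝ, E) δ₀.proj).source) (w : E) :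
    cotForm δ w = (extChartAt (cotModel E) δ₀ δ).2
      (mfderiv 𝓘(ℝ, E) 𝓘(ℝ, E) (extChartAt 𝓘(ℝ, E) δ₀.proj) δ.proj w : E) := by
  rw [cot_extChartAt_apply _ _ (by rwa [extChartAt_source] at h)]
  exact congrArg (cotForm δ : E →L[ℝ] ℝ)
    (mfderiv_symm_comp_extChartAt (I := 𝓘(ℝ, E)) h w).symm

theorem mfderiv_proj_cotangentBundle (δ : CotangentBundle E G) (w : E × (E →L[ℝ] ℝ)) :
    (mfderiv (cotModel E) 𝓘(ℝ, E) (fun δ : CotangentBundle E G => δ.proj) δ w : E) = w.1 := by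
  obtain ⟨c, hc⟩ := exists_hasVelocity (I := cotModel E) δ w
  have hπ : MDifferentiableAt (cotModel E) 𝓘(ℝ, E) (fun δ : CotangentBundle E G => δ.proj) δ :=
    (Bundle.contMDiffAt_proj (n := 1) _).mdifferentiableAt one_ne_zero
  have h1 := (hc.comp hπ).comp (mdifferentiableAt_extChartAt (I := 𝓘(ℝ, E))
    (mem_chart_source E δ.proj))
  have h2 := (hc.comp (mdifferentiableAt_extChartAt (I := cotModel E)
    (mem_chart_source _ δ))).comp (f := Prod.fst) (I' := 𝓘(ℝ, E))
      (mdifferentiableAt_iff_differentiableAt.2 differentiableAt_fst)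
  rw [mfderiv_extChartAt_self] at h1 h2
  rw [mfderiv_eq_fderiv, fderiv_fst] at h2
  refine h1.unique h2 ?_
  have h3 : ∀ᶠ δ' in 𝓝 δ, δ' ∈ (extChartAt (cotModel E) δ).source :=
    (isOpen_extChartAt_source δ).mem_nhds (mem_extChartAt_source δ)
  filter_upwards [hc.eventually h3] with t ht
  rw [cot_extChartAt_source] at ht
  rw [cot_extChartAt_apply _ _ ht]

/-- The curve in `T*G` with coordinates `x` and `ζ` in the chart at `δ`. -/
theorem hasVelocity_chart_symm (δ : CotangentBundle E G) {x : ℝ → E} {ζ : ℝ → E →L[ℝ] ℝ}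
    {u : E} {η : E →L[ℝ] ℝ} (hx0 : x 0 = (extChartAt (cotModel E) δ δ).1)
    (hζ0 : ζ 0 = (extChartAt (cotModel E) δ δ).2) (hx : HasDerivAt x u 0)
    (hζ : HasDerivAt ζ η 0) :
    HasVelocity (cotModel E) (fun τ => (extChartAt (cotModel E) δ).symm (x τ, ζ τ)) δ (u, η) := by
  have h0 : (x 0, ζ 0) = extChartAt (cotModel E) δ δ := by rw [hx0, hζ0]
  have h1 : HasVelocity 𝓘(ℝ, E × (E →L[ℝ] ℝ)) (fun τ => (x τ, ζ τ))
    (extChartAt (cotModel E) δ δ) (u, η) := hasVelocity_iff_hasDerivAt.2 ⟨h0, hx.prodMk hζ⟩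
  have h2 := (h1.comp (mdifferentiableAt_extChartAt_symm' (I := cotModel E)
    (mem_extChartAt_target (I := cotModel E) δ))).congr_point
        (extChartAt_to_inv (I := cotModel E) δ)
  refine h2.congr_vec ?_
  have h3 := mfderiv_symm_comp_extChartAt (I := cotModel E) (mem_extChartAt_source δ) (u, η)
  rw [mfderiv_extChartAt_self] at h3
  exact h3

end FibreCoordinates

section

variable {E G : Type*} [NormedAddCommGroup E] [NormedSpace ℝ E] [TopologicalSpace G]
  [ChartedSpace E G] [IsManifold 𝓘(ℝ, E) ∞ G]

theorem mfderiv_eq_zero_of_eventually_eq {p : CotangentBundle E G → ℝ} {δ : CotangentBundle E G}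
    (hp : MDifferentiableAt (cotModel E) 𝓘(ℝ, ℝ) p δ) {c : ℝ → CotangentBundle E G}
    {w : E × (E →L[ℝ] ℝ)} (hc : HasVelocity (cotModel E) c δ w)
    (h : ∀ᶠ τ in 𝓝 0, p (c τ) = p δ) : (mfderiv (cotModel E) 𝓘(ℝ, ℝ) p δ w : ℝ) = 0 :=
  (hc.comp hp).unique (hasVelocity_const (p δ)) h

end

/-! ### Noether's theorem for right translations. -/

namespace LieGroupoid

section Conservation

variable {E B G M : Type*}
  [NormedAddCommGroup E] [NormedSpace ℝ E] [NormedAddCommGroup B] [NormedSpace ℝ B]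
  [TopologicalSpace G] [ChartedSpace E G] [TopologicalSpace M] [ChartedSpace B M]
  [IsManifold 𝓘(ℝ, E) ∞ G] [FiniteDimensional ℝ E] [FiniteDimensional ℝ B]
  [IsManifold 𝓘(ℝ, B) ∞ M] {𝒢 : LieGroupoid E B G M}

/-- The covectors need correspond under `dT` only on `ker ds`, the space that `rCot` sees. With `T =
id` this allows changes of the covector by forms vanishing on `ker ds`. -/
theorem rCot_eq_of_equivariant {δ δ' : CotangentBundle E G} {T : G → G}
    (hT : MDifferentiableAt 𝓘(ℝ, E) 𝓘(ℝ, E) T δ.proj) (hδ' : δ'.proj = T δ.proj)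
    (hr : 𝒢.r (T δ.proj) = 𝒢.r δ.proj)
    (hmul : ∀ β, 𝒢.s β = 𝒢.r δ.proj → T (𝒢.mul β δ.proj) = 𝒢.mul β (T δ.proj))
    (hform : ∀ w : E, (mfderiv 𝓘(ℝ, E) 𝓘(ℝ, B) 𝒢.s δ.proj w : B) = 0 →
      (cotForm δ' : E →L[ℝ] ℝ) (mfderiv 𝓘(ℝ, E) 𝓘(ℝ, E) T δ.proj w) = cotForm δ w) :
    𝒢.rCot δ' = 𝒢.rCot δ := by
  obtain ⟨γ', ξ'⟩ := δ'
  change γ' = _ at hδ'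
  subst hδ'
  refine Eq.symm (rCot_eq_rCot_iff.2 ⟨hr.symm, fun v hv => ?_⟩)
  refine (hform _ (mfderiv_s_dRight hv)).symm.trans ?_
  obtain ⟨α, hα, hs⟩ := exists_hasVelocity_algebroid hv
  refine congrArg (ξ' : E →L[ℝ] ℝ) (((hasVelocity_mul_const hα hs).comp hT).unique
    (hasVelocity_mul_const (𝒢 := 𝒢) (γ := T δ.proj) (α := α) (v := v) (by rwa [hr]) (by rwa [hr]))
        ?_)
  filter_upwards [hs] with t ht
  exact hmul _ ht

/-- A vector tangent to the fibre of `s` at a unit is realized by a family `R τ` of right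
translations. -/
theorem exists_rightTrans_family (𝒢 : LieGroupoid E B G M) (γ₀ : G) {v : E}
    (hv : (mfderiv 𝓘(ℝ, E) 𝓘(ℝ, B) 𝒢.s (𝒢.unit (𝒢.s γ₀)) v : B) = 0) :
    ∃ R : ℝ × G → G, ContMDiffAt (𝓘(ℝ, ℝ).prod 𝓘(ℝ, E)) 𝓘(ℝ, E) 3 R (0, γ₀) ∧
      (∀ᶠ γ in 𝓝 γ₀, R (0, γ) = γ) ∧
      (∀ᶠ q in 𝓝 ((0 : ℝ), γ₀), 𝒢.r (R q) = 𝒢.r q.2 ∧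
        ∀ β, 𝒢.s β = 𝒢.r q.2 → R (q.1, 𝒢.mul β q.2) = 𝒢.mul β (R q)) ∧
      ∀ γ, 𝒢.s γ = 𝒢.s γ₀ → HasVelocity 𝓘(ℝ, E) (fun τ => R (τ, γ)) γ (𝒢.dLeftInv γ v) := by
  set x := 𝒢.s γ₀
  have hs3 : ContMDiffAt 𝓘(ℝ, E) 𝓘(ℝ, B) 3 𝒢.s (𝒢.unit x) :=
    (𝒢.s.contMDiff _).of_le (by norm_cast)
  obtain ⟨ρ, h1, h2, h3⟩ := exists_retraction hs3 (𝒢.s_submersion _)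
  set φ := extChartAt 𝓘(ℝ, E) (𝒢.unit x)
  have hφ : φ.symm (φ (𝒢.unit x)) = 𝒢.unit x := extChartAt_to_inv (I := 𝓘(ℝ, E)) _
  have hd := mfderiv_retraction (𝒢.mdifferentiableAt_s _) (h1.mdifferentiableAt (by simp)) h3 v
  rw [hv, 𝒢.s_unit] at hd
  rw [𝒢.s_unit] at h1 h2
  -- the curve `a(·, y)` through the unit of `y`
  set a : ℝ × M → G := fun q => φ.symm (φ (𝒢.unit q.2) + q.1 • v) with ha_def
  have ha0 : a (0, x) = 𝒢.unit x := by simp [ha_def, hφ]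
  have hs' : ContMDiffAt 𝓘(ℝ, B) 𝓘(ℝ, E) 3 (fun y => φ (𝒢.unit y)) x :=
    (contMDiffAt_extChartAt (x := 𝒢.unit x)).comp_of_eq ((𝒢.unit.contMDiff x).of_le
        (by norm_cast)) rfl
  have ha1 : ContMDiffAt (𝓘(ℝ, ℝ).prod 𝓘(ℝ, B)) 𝓘(ℝ, E) 3
      (fun q : ℝ × M => φ (𝒢.unit q.2) + q.1 • v) (0, x) := by
    refine (hs'.comp_of_eq contMDiffAt_snd rfl).add ?_
    exact ((ContinuousLinearMap.toSpanSingleton ℝ v).contDiff.contMDiff.contMDiffAt).comp_of_eq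
      contMDiffAt_fst rfl
  have ha : ContMDiffAt (𝓘(ℝ, ℝ).prod 𝓘(ℝ, B)) 𝓘(ℝ, E) 3 a (0, x) :=
    (contMDiffAt_extChartAt_symm_self (I := 𝓘(ℝ, E)) (mem_extChartAt_target (𝒢.unit x))).comp_of_eq
      ha1 (by simp only [zero_smul, add_zero]; rfl)
  set α : ℝ × M → G := fun q => ρ (a q, q.2) with hα_def
  have hα : ContMDiffAt (𝓘(ℝ, ℝ).prod 𝓘(ℝ, B)) 𝓘(ℝ, E) 3 α (0, x) :=
    h1.comp_of_eq (ha.prodMk contMDiffAt_snd) (by rw [ha0])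
  have hαs : ∀ᶠ q in 𝓝 ((0 : ℝ), x), 𝒢.s (α q) = q.2 :=
    (ha.continuousAt.prodMk continuousAt_snd).eventually (by simpa only [ha0] using h2)
  have hα0 : ∀ᶠ y in 𝓝 x, α (0, y) = 𝒢.unit y := by
    have e1 : ∀ᶠ y in 𝓝 x, 𝒢.unit y ∈ φ.source :=
      𝒢.unit.contMDiff.continuous.continuousAt.eventually
        ((isOpen_extChartAt_source (𝒢.unit x)).mem_nhds (mem_extChartAt_source (𝒢.unit x)))
    filter_upwards [e1, 𝒢.unit.contMDiff.continuous.continuousAt.eventually h3] with y e2 e3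
    rw [𝒢.s_unit] at e3
    simp only [hα_def, ha_def, zero_smul, add_zero]
    rw [φ.left_inv e2, e3]
  have hαv : HasVelocity 𝓘(ℝ, E) (fun τ => α (τ, x)) (𝒢.unit x) v := by
    have e1 : HasVelocity 𝓘(ℝ, E) (fun τ : ℝ => φ (𝒢.unit x) + τ • v) (φ (𝒢.unit x)) v := by
      refine hasVelocity_iff_hasDerivAt.2 ⟨by simp, ?_⟩
      simpa using ((hasDerivAt_id (0 : ℝ)).smul_const v).const_add (φ (𝒢.unit x))
    have e2 := (e1.comp (mdifferentiableAt_extChartAt_symm' (I := 𝓘(ℝ, E))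
      (mem_extChartAt_target (𝒢.unit x)))).congr_point hφ
    have e3 := mfderiv_symm_comp_extChartAt (I := 𝓘(ℝ, E)) (mem_extChartAt_source (𝒢.unit x)) v
    rw [mfderiv_extChartAt_self] at e3
    have e4 := ((e2.congr_vec e3).prodMk (hasVelocity_const (I := 𝓘(ℝ, B)) x)).comp
      (h1.mdifferentiableAt (by simp))
    refine (e4.congr_point ?_).congr_vec hd
    have := h3.self_of_nhds
    rwa [𝒢.s_unit] at this
  have hsγ : ContMDiffAt (𝓘(ℝ, ℝ).prod 𝓘(ℝ, E)) (𝓘(ℝ, ℝ).prod 𝓘(ℝ, B)) 3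
      (fun q : ℝ × G => (q.1, 𝒢.s q.2)) (0, γ₀) :=
    contMDiffAt_fst.prodMk (((𝒢.s.contMDiff γ₀).of_le (by norm_cast)).comp_of_eq contMDiffAt_snd rfl)
  have hsα : ∀ᶠ q in 𝓝 ((0 : ℝ), γ₀), 𝒢.s (α (q.1, 𝒢.s q.2)) = 𝒢.s q.2 :=
    hsγ.continuousAt.eventually hαs
  -- `α (τ, y)` is a curve in the fibre of `s` over `y` starting at the unit, with velocity `v` at
  -- `y = x`. The inverse makes the product composable and its velocity `dLeftInv γ v`.
  refine ⟨fun q => 𝒢.mul q.2 (𝒢.inv (α (q.1, 𝒢.s q.2))), ?_, ?_, ?_, fun γ hγ => ?_⟩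
  · refine contMDiffAt_mul contMDiffAt_snd (((𝒢.inv.contMDiff _).of_le (by norm_cast)).comp _
      (hα.comp_of_eq hsγ rfl)) (hsα.mono fun q hq => ?_)
    rw [𝒢.r_inv, hq]
  · filter_upwards [𝒢.s.contMDiff.continuous.continuousAt.eventually hα0] with γ hγ
    rw [hγ, 𝒢.inv_unit, 𝒢.mul_unit]
  · filter_upwards [hsα] with q hq
    refine ⟨𝒢.r_mul _ _ (by rw [𝒢.r_inv, hq]), fun β hβ => ?_⟩
    rw [𝒢.s_mul _ _ hβ, 𝒢.mul_assoc _ _ _ hβ (by rw [𝒢.r_inv, hq])]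
  · simp only [hγ]
    refine hasVelocity_const_mul_inv (by rwa [hγ]) ?_
    rw [hγ]
    have e1 : ContinuousAt (fun τ : ℝ => (τ, x)) 0 := by fun_prop
    exact e1.eventually hαs

/-- Moving the covector along `l ∘ ds` leaves `rCot` fixed. Hence `dp` vanishes in this vertical
direction, which by Hamilton's equations says `l (ds X.1) = 0`, for every functional `l`. -/
theorem mfderiv_s_hamiltonianField {p₀ : 𝒢.DualAlgebroid → ℝ} {δ : CotangentBundle E G}
    (hp : MDifferentiableAt (cotModel E) 𝓘(ℝ, ℝ) (fun δ => p₀ (𝒢.rCot δ)) δ) :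
    (mfderiv 𝓘(ℝ, E) 𝓘(ℝ, B) 𝒢.s δ.proj
      (hamiltonianField (fun δ => p₀ (𝒢.rCot δ)) δ : E × (E →L[ℝ] ℝ)).1 : B) = 0 := by
  set X : E × (E →L[ℝ] ℝ) := hamiltonianField (fun δ => p₀ (𝒢.rCot δ)) δ with hX
  set A : E →L[ℝ] B := mfderiv 𝓘(ℝ, E) 𝓘(ℝ, B) 𝒢.s δ.proj with hA
  refine SeparatingDual.eq_zero_of_forall_dual_eq_zero (R := ℝ) (x := A X.1) fun l => ?_
  set z := extChartAt (cotModel E) δ δ with hz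
  have hz1 : z.1 = extChartAt 𝓘(ℝ, E) δ.proj δ.proj := by
    rw [hz, cot_extChartAt_apply _ _ (mem_chart_source E δ.proj)]
  have hc := hasVelocity_chart_symm δ (x := fun _ => z.1) (ζ := fun τ => z.2 + τ • l.comp A)
    (η := l.comp A) rfl (by simp [hz]) (hasDerivAt_const _ _)
    (by simpa using ((hasDerivAt_id (0 : ℝ)).smul_const (l.comp A)).const_add z.2)
  have h1 := mfderiv_eq_zero_of_eventually_eq hp hc (.of_forall fun τ => congrArg p₀ ?_)
  · have h2 : (l.comp A) X.1 - X.2 0 = 0 :=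
      (mfderiv_apply_eq_hamiltonianField _ δ (0, l.comp A)).symm.trans h1
    simpa using h2
  have hzt : z.1 ∈ (extChartAt 𝓘(ℝ, E) δ.proj).target := hz1 ▸ mem_extChartAt_target _
  have hproj : ((extChartAt (cotModel E) δ).symm (z.1, z.2 + τ • l.comp A)).proj = δ.proj := by
    refine (cot_extChartAt_symm_proj δ (z.1, z.2 + τ • l.comp A) hzt).trans ?_
    exact (congrArg (extChartAt 𝓘(ℝ, E) δ.proj).symm hz1).trans (extChartAt_to_inv _)
  refine rCot_eq_of_equivariant (T := id) mdifferentiableAt_id hproj rfl (fun _ _ => rfl)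
    fun w hw => ?_
  rw [mfderiv_id]
  have h2 := cotForm_eq_chart δ (δ := (extChartAt (cotModel E) δ).symm (z.1, z.2 + τ • l.comp A))
    (by rw [hproj]; exact mem_extChartAt_source _) w
  have h3 := cotForm_eq_chart δ (mem_extChartAt_source _) w
  rw [(extChartAt (cotModel E) δ).right_inv (by rw [cot_extChartAt_target]; exact ⟨hzt, trivial⟩),
    hproj] at h2
  rw [mfderiv_extChartAt_self] at h2 h3
  refine h2.trans (Eq.trans ?_ h3.symm)
  have h4 : (z.2 + τ • l.comp A) w = z.2 w + τ * l (A w) := rfl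
  refine h4.trans ?_
  rw [show A w = 0 from hw, map_zero, mul_zero, add_zero]
  rfl

/-- Noether's argument: `p` is constant along the lift of the translations `R τ`, so its
differential vanishes on their lifted generator. Hamilton's equations turn this into the vanishing
of the derivative of the momentum along `c`. -/
theorem hasDerivAt_cotForm_dLeftInv {p₀ : 𝒢.DualAlgebroid → ℝ} {δ₀ : CotangentBundle E G}
    (hp : MDifferentiableAt (cotModel E) 𝓘(ℝ, ℝ) (fun δ => p₀ (𝒢.rCot δ)) δ₀)
    {c : ℝ → CotangentBundle E G}
    (hc : HasVelocity (cotModel E) c δ₀ (hamiltonianField (fun δ => p₀ (𝒢.rCot δ)) δ₀))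
    (hs : ∀ᶠ t in 𝓝 0, 𝒢.s (c t).proj = 𝒢.s δ₀.proj) {v : E}
    (hv : (mfderiv 𝓘(ℝ, E) 𝓘(ℝ, B) 𝒢.s (𝒢.unit (𝒢.s δ₀.proj)) v : B) = 0) :
    HasDerivAt (fun t => (cotForm (c t) (𝒢.dLeftInv (c t).proj v) : ℝ)) 0 0 := by
  set X : E × (E →L[ℝ] ℝ) := hamiltonianField (fun δ => p₀ (𝒢.rCot δ)) δ₀ with hX
  set γ₀ := δ₀.proj with hγ₀
  obtain ⟨R, hR, hR0, hRmul, hRv⟩ := 𝒢.exists_rightTrans_family γ₀ hv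
  have hR00 : R (0, γ₀) = γ₀ := hR0.self_of_nhds
  set φ := extChartAt 𝓘(ℝ, E) γ₀ with hφ
  set x₀ := φ γ₀ with hx₀
  have hφx₀ : φ.symm x₀ = γ₀ := extChartAt_to_inv (I := 𝓘(ℝ, E)) γ₀
  have hsrc : ∀ᶠ γ in 𝓝 γ₀, γ ∈ φ.source :=
    (isOpen_extChartAt_source γ₀).mem_nhds (mem_extChartAt_source γ₀)
  set N : ℝ × E → E := fun q => φ (R (q.1, φ.symm q.2)) with hN_def
  have hsymm : ContMDiffAt 𝓘(ℝ, E) 𝓘(ℝ, E) 3 φ.symm x₀ :=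
    contMDiffAt_extChartAt_symm_self (I := 𝓘(ℝ, E)) (mem_extChartAt_target γ₀)
  have hN : ContDiffAt ℝ 3 N (0, x₀) := by
    have h1 : ContMDiffAt 𝓘(ℝ, ℝ × E) (𝓘(ℝ, ℝ).prod 𝓘(ℝ, E)) 3
        (fun q : ℝ × E => (q.1, φ.symm q.2)) (0, x₀) :=
      (contDiff_fst.contMDiff _).prodMk (hsymm.comp_of_eq (contDiff_snd.contMDiff _) rfl)
    have h2 := hR.comp_of_eq h1 (by rw [hφx₀])
    exact ((contMDiffAt_extChartAt (I := 𝓘(ℝ, E)) (x := γ₀)).comp_of_eq h2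
      (by simp only [Function.comp_apply, hφx₀, hR00])).contDiffAt
  have hNφ : ∀ γ ∈ φ.source, ∀ τ, N (τ, φ γ) = φ (R (τ, γ)) := fun γ hγ τ => by
    simp only [hN_def, φ.left_inv hγ]
  have hN0 : ∀ᶠ x in 𝓝 x₀, N (0, x) = x := by
    filter_upwards [(isOpen_extChartAt_target γ₀).mem_nhds (mem_extChartAt_target γ₀),
      hsymm.continuousAt.eventually (p := fun γ => R (0, γ) = γ) (by rwa [hφx₀])] with x h2 h1
    simp only [hN_def]
    rw [h1, φ.right_inv h2]
  have hNd : ∀ᶠ q in 𝓝 ((0 : ℝ), x₀), DifferentiableAt ℝ N q :=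
    (hN.eventually (by simp)).mono fun q hq => hq.differentiableAt (by simp)
  obtain ⟨ζ, hζ0, hζ, D, hD, hζ'⟩ := exists_transported_form (hN.of_le (by norm_num)) hN0
    (extChartAt (cotModel E) δ₀ δ₀).2
  have hz1 : (extChartAt (cotModel E) δ₀ δ₀).1 = x₀ := by
    rw [cot_extChartAt_apply _ _ (mem_chart_source E δ₀.proj)]
  set ξ₀ := (extChartAt (cotModel E) δ₀ δ₀).2 with hξ₀
  have hτ0 : ContinuousAt (fun τ : ℝ => (τ, x₀)) 0 := by fun_prop
  -- `p` is constant along the orbit of `δ₀` under the right translations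
  have hzero : (-ξ₀.comp D) X.1 - X.2 (fderiv ℝ N (0, x₀) (1, 0)) = 0 := by
    have hN1 : HasDerivAt (fun τ => N (τ, x₀)) (fderiv ℝ N (0, x₀) (1, 0)) 0 :=
      HasFDerivAt.comp_hasDerivAt (0 : ℝ) (f := fun τ : ℝ => (τ, x₀)) hNd.self_of_nhds.hasFDerivAt
        ((hasDerivAt_id (0 : ℝ)).prodMk (hasDerivAt_const _ _))
    have hd := hasVelocity_chart_symm δ₀ (x := fun τ => N (τ, x₀)) (hN0.self_of_nhds.trans hz1.symm)
      hζ0 hN1 hζ'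
    rw [hX, ← mfderiv_apply_eq_hamiltonianField (fun δ => p₀ (𝒢.rCot δ)) δ₀
      (fderiv ℝ N (0, x₀) (1, 0), -ξ₀.comp D)]
    refine mfderiv_eq_zero_of_eventually_eq hp hd ?_
    have hτγ : ContinuousAt (fun τ : ℝ => (τ, γ₀)) 0 := by fun_prop
    have hRd : ∀ᶠ τ in 𝓝 (0 : ℝ), ContMDiffAt (𝓘(ℝ, ℝ).prod 𝓘(ℝ, E)) 𝓘(ℝ, E) 3 R (τ, γ₀) :=
      hτγ.eventually ((contMDiffAt_iff_contMDiffAt_nhds (by simp)).1 hR)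
    have hRs : ∀ᶠ τ in 𝓝 (0 : ℝ), R (τ, γ₀) ∈ φ.source :=
      (hR.continuousAt.comp_of_eq hτγ rfl).eventually (by simpa [hR00] using hsrc)
    filter_upwards [hζ, hRd, hRs, hτγ.eventually hRmul, hτ0.eventually hNd] with τ h1 h2 h3 h4 h5
    refine congrArg p₀ ?_
    have hγφ := mem_extChartAt_source (I := 𝓘(ℝ, E)) γ₀
    have h6 : N (τ, x₀) = φ (R (τ, γ₀)) := hNφ _ hγφ τ
    have h7 : N (τ, x₀) ∈ φ.target := h6 ▸ φ.map_source h3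
    have hproj : ((extChartAt (cotModel E) δ₀).symm (N (τ, x₀), ζ τ)).proj = R (τ, γ₀) := by
      rw [cot_extChartAt_symm_proj _ _ h7]
      exact (congrArg φ.symm h6).trans (φ.left_inv h3)
    have hT : MDifferentiableAt 𝓘(ℝ, E) 𝓘(ℝ, E) (fun γ => R (τ, γ)) γ₀ :=
      (h2.comp_of_eq (contMDiffAt_const.prodMk contMDiffAt_id) rfl).mdifferentiableAt (by simp)
    refine rCot_eq_of_equivariant (T := fun γ => R (τ, γ)) hT hproj h4.1 h4.2 fun w hw => ?_
    obtain ⟨a, ha⟩ := exists_hasVelocity (I := 𝓘(ℝ, E)) γ₀ w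
    have hφa := ha.comp (mdifferentiableAt_extChartAt (I := 𝓘(ℝ, E)) (mem_chart_source E γ₀))
    rw [mfderiv_extChartAt_self] at hφa
    have hφT := (ha.comp hT).comp (mdifferentiableAt_extChartAt (I := 𝓘(ℝ, E)) (x := γ₀)
      (by rwa [← extChartAt_source 𝓘(ℝ, E)]))
    have hNa : HasVelocity 𝓘(ℝ, E) (fun t => N (τ, φ (a t))) (N (τ, x₀))
        (fderiv ℝ N (τ, x₀) (0, w)) := by
      obtain ⟨e1, e2⟩ := hasVelocity_iff_hasDerivAt.1 hφa
      refine hasVelocity_iff_hasDerivAt.2 ⟨by rw [e1], ?_⟩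
      refine HasFDerivAt.comp_hasDerivAt (l := N) (l' := fderiv ℝ N (τ, x₀)) (f' := ((0 : ℝ), w))
        (0 : ℝ) (f := fun t : ℝ => (τ, φ (a t))) ?_ ((hasDerivAt_const _ _).prodMk e2)
      rw [e1]
      exact h5.hasFDerivAt
    have hw' := hφT.unique hNa ((ha.eventually hsrc).mono fun t ht => (hNφ _ ht τ).symm)
    have h8 (w' : E) := cotForm_eq_chart δ₀
      (δ := (extChartAt (cotModel E) δ₀).symm (N (τ, x₀), ζ τ)) (by rwa [hproj]) w'
    rw [(extChartAt (cotModel E) δ₀).right_inv (by rw [cot_extChartAt_target]; exact ⟨h7, trivial⟩),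
      hproj] at h8
    refine (h8 _).trans (((congrArg (ζ τ) hw').trans (h1 w)).trans ?_)
    have h9 := cotForm_eq_chart δ₀ (mem_extChartAt_source _) w
    rw [mfderiv_extChartAt_self] at h9
    exact h9.symm
  have hq := hc.comp (mdifferentiableAt_extChartAt (I := cotModel E) (mem_chart_source _ δ₀))
  rw [mfderiv_extChartAt_self] at hq
  obtain ⟨hq0, hq'⟩ := hasVelocity_iff_hasDerivAt.1 hq
  have hq1 : HasDerivAt (fun t => (extChartAt (cotModel E) δ₀ (c t)).1) X.1 0 := hq'.fst
  have hq2 : HasDerivAt (fun t => (extChartAt (cotModel E) δ₀ (c t)).2) X.2 0 := hq'.snd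
  have hg : HasDerivAt (fun t => (extChartAt (cotModel E) δ₀ (c t)).2
      (fderiv ℝ N (0, (extChartAt (cotModel E) δ₀ (c t)).1) (1, 0))) 0 0 := by
    have h1 : HasDerivAt (fun t => fderiv ℝ N (0, (extChartAt (cotModel E) δ₀ (c t)).1) (1, 0))
        (D X.1) 0 := by
      refine HasFDerivAt.comp_hasDerivAt (0 : ℝ)
        (l := fun x => fderiv ℝ N (0, x) (1, 0)) (l' := D)
        (f := fun t => (extChartAt (cotModel E) δ₀ (c t)).1) ?_ hq1
      rw [hq0, hz1]
      exact hD
    refine (hq2.clm_apply h1).congr_deriv ?_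
    rw [hq0, hz1]
    have h2 : (-ξ₀.comp D) X.1 = -ξ₀ (D X.1) := rfl
    rw [h2] at hzero
    linarith
  -- Since `c` stays in the fibre of `s`, the velocity of the translation family at each point of
  -- `c` near time `0` is `dLeftInv` of the same `v`, so the momentum is the coordinate expression
  -- differentiated in `hg`.
  refine hg.congr_of_eventuallyEq ?_
  have hπ : ContinuousAt (fun t => (c t).proj) 0 :=
    (FiberBundle.continuous_proj _ _).continuousAt.comp hc.continuousAt
  have hπ0 : (c 0).proj = γ₀ := by rw [hc.1]
  have hφc : ContinuousAt (fun t => ((0 : ℝ), φ (c t).proj)) 0 :=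
    continuousAt_const.prodMk ((continuousAt_extChartAt (I := 𝓘(ℝ, E)) γ₀).comp_of_eq hπ hπ0)
  filter_upwards [hs, hπ.eventually (p := fun γ => γ ∈ φ.source) (by simpa only [hπ0] using hsrc),
    hφc.eventually (p := fun q => DifferentiableAt ℝ N q) (by simpa only [hπ0] using hNd)] with t h1 h2 h3
  refine (cotForm_eq_chart δ₀ h2 _).trans ?_
  have h4 : (extChartAt (cotModel E) δ₀ (c t)).1 = φ (c t).proj := by
    rw [cot_extChartAt_apply _ _ (by rwa [extChartAt_source] at h2)]
  rw [h4]
  refine congrArg (extChartAt (cotModel E) δ₀ (c t)).2 ?_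
  have h5 := (hRv _ h1).comp (mdifferentiableAt_extChartAt (I := 𝓘(ℝ, E)) (x := γ₀)
      (by rwa [← extChartAt_source 𝓘(ℝ, E)]))
  have h6 : HasVelocity 𝓘(ℝ, E) (fun τ => N (τ, φ (c t).proj)) (N (0, φ (c t).proj))
      (fderiv ℝ N (0, φ (c t).proj) (1, 0)) :=
    hasVelocity_iff_hasDerivAt.2 ⟨rfl, HasFDerivAt.comp_hasDerivAt (0 : ℝ)
      (f := fun τ : ℝ => (τ, φ (c t).proj)) h3.hasFDerivAt
      ((hasDerivAt_id (0 : ℝ)).prodMk (hasDerivAt_const _ _))⟩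
  exact h5.unique h6 (.of_forall fun τ => (hNφ _ h2 τ).symm)

end Conservation

end LieGroupoid

/-! ### From infinitesimal conservation to constancy of `sCot`. -/

section

variable {F H N : Type*} [NormedAddCommGroup F] [NormedSpace ℝ F] [TopologicalSpace H]
  {I : ModelWithCorners ℝ F H} [TopologicalSpace N] [ChartedSpace H N]

theorem IsTangentAt.hasVelocity {X : (y : N) → TangentSpace I y} {c : ℝ → N} {t : ℝ}
    (h : IsTangentAt X c t) : HasVelocity I (fun t' => c (t' + t)) (c t) (X (c t)) := by
  have e : (0 : ℝ) - -t = t := by simp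
  have h1 : IsTangentAt X c (0 - -t) := by rwa [e]
  have h2 : HasVelocity I (fun t' => c (t' - -t)) (c (0 - -t)) (X (c (0 - -t))) :=
      ⟨rfl, h1.comp_sub⟩
  have h3 := (h2.congr_point (congrArg c e)).congr_vec (congrArg (fun s => (X (c s) : F)) e)
  simpa only [sub_neg_eq_add] using h3

theorem HasVelocity.isTangentAt {X : (y : N) → TangentSpace I y} {c : ℝ → N} {t : ℝ}
    (h : HasVelocity I (fun t' => c (t' + t)) (c t) (X (c t))) : IsTangentAt X c t := by
  have h1 : HasMFDerivAt 𝓘(ℝ, ℝ) 𝓘(ℝ, ℝ) (fun t' : ℝ => t' - t) t (ContinuousLinearMap.id ℝ ℝ) :=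
    ((hasFDerivAt_id t).sub_const t).hasMFDerivAt
  have h0 : HasMFDerivAt 𝓘(ℝ, ℝ) I (fun t' => c (t' + t)) (t - t)
      ((1 : ℝ →L[ℝ] ℝ).smulRight (X (c t)) : ℝ →L[ℝ] F) := by
    rw [sub_self]
    exact h.2
  have h2 := HasMFDerivAt.comp (g := fun t' => c (t' + t)) (f := fun t' : ℝ => t' - t) t h0 h1
  refine (h2.congr_mfderiv (ContinuousLinearMap.ext fun τ => rfl)).congr_of_eventuallyEq
    (.of_forall fun t' => ?_)
  simp

theorem eqOn_of_hasVelocity_zero [I.Boundaryless] [IsManifold I 2 N] [T2Space N] {f : ℝ → N}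
    {J : Set ℝ} (hJ : IsOpen J) (hJ' : J.OrdConnected)
    (h : ∀ t ∈ J, HasVelocity I (fun t' => f (t' + t)) (f t) 0) {t t' : ℝ} (ht : t ∈ J)
    (ht' : t' ∈ J) : f t = f t' := by
  have : IsManifold I 1 N := .of_le (n := 2) (by norm_num)
  -- A curve with zero velocity and the constant curve are integral curves of the zero field, so
  -- uniqueness replaces a mean value argument on the manifold.
  refine (eqOn_of_isTangentAt (U := univ) (X := fun y => (0 : TangentSpace I y)) (c := f)
    (c' := fun _ => f t') (fun y _ => ?_) hJ hJ' ht' (fun t ht => (h t ht).isTangentAt)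
    (fun t _ => (hasVelocity_const (f t')).isTangentAt) (fun _ _ => mem_univ _) rfl ht)
  exact (Bundle.contMDiff_zeroSection ℝ (TangentSpace I : N → Type _)).contMDiffAt

end

namespace LieGroupoid

section Conservation

variable {E B G M : Type*}
  [NormedAddCommGroup E] [NormedSpace ℝ E] [NormedAddCommGroup B] [NormedSpace ℝ B]
  [TopologicalSpace G] [ChartedSpace E G] [TopologicalSpace M] [ChartedSpace B M]
  [IsManifold 𝓘(ℝ, E) ∞ G] [FiniteDimensional ℝ E] [FiniteDimensional ℝ B]
  [IsManifold 𝓘(ℝ, B) ∞ M] [T2Space M] {𝒢 : LieGroupoid E B G M}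

/-- The base point is conserved because the base velocity lies in `ker ds`. This fixes the algebroid
fibre, so each `v` in it gives one real momentum whose derivative vanishes at every time. -/
theorem sCot_eq_of_isTangentAt {p₀ : 𝒢.DualAlgebroid → ℝ} {U : Set (CotangentBundle E G)}
    (hp : ∀ δ ∈ U, MDifferentiableAt (cotModel E) 𝓘(ℝ, ℝ) (fun δ => p₀ (𝒢.rCot δ)) δ)
    {J : Set ℝ} (hJ : IsOpen J) (hJ' : J.OrdConnected) {c : ℝ → CotangentBundle E G}
    (hc : ∀ t ∈ J, IsTangentAt (hamiltonianField (fun δ => p₀ (𝒢.rCot δ))) c t ∧ c t ∈ U)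
    {t t' : ℝ} (ht : t ∈ J) (ht' : t' ∈ J) : 𝒢.sCot (c t) = 𝒢.sCot (c t') := by
  have hs : ∀ t₁ ∈ J, ∀ t₂ ∈ J, 𝒢.s (c t₁).proj = 𝒢.s (c t₂).proj := by
    intro t₁ ht₁ t₂ ht₂
    have : IsManifold 𝓘(ℝ, B) 2 M := .of_le (n := ∞) (by norm_cast)
    refine eqOn_of_hasVelocity_zero (I := 𝓘(ℝ, B)) (f := fun t => 𝒢.s (c t).proj) hJ hJ'
      (fun t ht => ?_) ht₁ ht₂
    have hπ : MDifferentiableAt (cotModel E) 𝓘(ℝ, E) (fun δ : CotangentBundle E G => δ.proj)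
        (c t) :=
      (Bundle.contMDiffAt_proj (n := 1) _).mdifferentiableAt one_ne_zero
    refine (((hc t ht).1.hasVelocity.comp hπ).comp (𝒢.mdifferentiableAt_s _)).congr_vec ?_
    refine Eq.trans (congrArg (mfderiv 𝓘(ℝ, E) 𝓘(ℝ, B) 𝒢.s (c t).proj : E →L[ℝ] B)
      (mfderiv_proj_cotangentBundle (c t) _)) ?_
    exact mfderiv_s_hamiltonianField (hp _ (hc t ht).2)
  refine sCot_eq_sCot_iff.2 ⟨hs t ht t' ht', fun v hv => congrArg Neg.neg ?_⟩
  have hd : ∀ t₁ ∈ J, HasDerivAt (fun t => (cotForm (c t) (𝒢.dLeftInv (c t).proj v) : ℝ)) 0 t₁ := by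
    intro t₁ ht₁
    have h1 := hasDerivAt_cotForm_dLeftInv (v := v) (hp _ (hc t₁ ht₁).2) (hc t₁ ht₁).1.hasVelocity
        ?_ ?_
    · have h2 : HasDerivAt (fun t => t - t₁) 1 t₁ := (hasDerivAt_id t₁).sub_const t₁
      have h3 := HasDerivAt.comp (h := fun t => t - t₁)
        (h₂ := fun t => cotForm (c (t + t₁)) (𝒢.dLeftInv (c (t + t₁)).proj v)) t₁
        (by rw [sub_self]; exact h1) h2
      rw [zero_mul] at h3
      refine h3.congr_of_eventuallyEq (.of_forall fun t => ?_)
      exact congrArg (fun t => (cotForm (c t) (𝒢.dLeftInv (c t).proj v) : ℝ))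
        (sub_add_cancel t t₁).symm
    · have h2 : ContinuousAt (fun t => t + t₁) 0 := by fun_prop
      exact (h2.eventually (p := fun t => t ∈ J) (by simpa using hJ.mem_nhds ht₁)).mono
        fun t ht => hs _ ht _ ht₁
    · rw [hs t₁ ht₁ t ht]
      exact hv
  exact hJ.is_const_of_deriv_eq_zero hJ'.isPreconnected
    (fun t ht => (hd t ht).differentiableAt.differentiableWithinAt)
        (fun t ht => (hd t ht).deriv) ht ht'

end Conservation

end LieGroupoid

/-! ### Dilations and right multiplications act on integral curves. -/

theorem IsTangentAt.comp_of_mfderiv {F H N : Type*} [NormedAddCommGroup F] [NormedSpace ℝ F]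
    [TopologicalSpace H] {I : ModelWithCorners ℝ F H} [TopologicalSpace N] [ChartedSpace H N]
    {X : (y : N) → TangentSpace I y} {c : ℝ → N} {t : ℝ} (h : IsTangentAt X c t) {Φ : N → N}
    (hΦ : MDifferentiableAt I I Φ (c t)) (hX : (mfderiv I I Φ (c t) (X (c t)) : F) = X (Φ (c t))) :
    IsTangentAt X (fun t => Φ (c t)) t :=
  HasVelocity.isTangentAt ((h.hasVelocity.comp hΦ).congr_vec hX)

namespace LieGroupoid

section Symmetry

variable {E B G M : Type*}
  [NormedAddCommGroup E] [NormedSpace ℝ E] [NormedAddCommGroup B] [NormedSpace ℝ B]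
  [TopologicalSpace G] [ChartedSpace E G] [TopologicalSpace M] [ChartedSpace B M]
  {𝒢 : LieGroupoid E B G M}

theorem rCot_dilate (a : ℝ) (δ : CotangentBundle E G) :
    𝒢.rCot (dilate a δ) = ⟨(𝒢.rCot δ).1, a • (𝒢.rCot δ).2⟩ := rfl

theorem dilate_mem_domCot {a : ℝ} (ha : a ≠ 0) {δ : CotangentBundle E G} (hδ : δ ∈ 𝒢.domCot) :
    dilate a δ ∈ 𝒢.domCot := by
  rw [domCot, mem_ofPred_eq, rCot_dilate]
  intro h
  refine hδ (ContinuousLinearMap.ext fun v => ?_)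
  exact (mul_eq_zero.1 (DFunLike.congr_fun h v)).resolve_left ha

variable [IsManifold 𝓘(ℝ, E) ∞ G]

theorem dilate_eq_cotPull (a : ℝ) (δ : CotangentBundle E G) :
    dilate a δ = cotPull a (fun _ => 0) (fun u _ => u) id δ := by
  have h1 (l d : E →L[ℝ] ℝ) (L : E →L[ℝ] E) (hd : d = 0) (hL : L = .id ℝ E) (v : E) :
      (a • l) v = ((a • l + d).comp L) v := by simp [hd, hL]
  let l : E →L[ℝ] ℝ := cotForm δ
  let d : E →L[ℝ] ℝ := differential 𝓘(ℝ, E) (fun _ : G => (0 : ℝ)) δ.proj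
  let L : E →L[ℝ] E := mfderiv 𝓘(ℝ, E) 𝓘(ℝ, E) (fun u : G => u) δ.proj
  exact cotMk_eq (ξ := a • l) (ξ' := (a • l + d).comp L) rfl
    (h1 l d L mfderiv_const mfderiv_id)

variable [FiniteDimensional ℝ E] [FiniteDimensional ℝ B] [IsManifold 𝓘(ℝ, B) ∞ M]
  {p₀ : 𝒢.DualAlgebroid → ℝ}

/-- Homogeneity of degree one matches the factor by which the dilation scales the symplectic form,
so the time parameter is unchanged. -/
theorem isTangentAt_dilate (hp₀ : 𝒢.SmoothOffZero p₀) (hhom : 𝒢.HomogeneousOffZero p₀)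
    {c : ℝ → CotangentBundle E G} {t a : ℝ} (ha : 0 < a)
    (hc : IsTangentAt (hamiltonianField (fun δ => p₀ (𝒢.rCot δ))) c t) (hct : c t ∈ 𝒢.domCot) :
    IsTangentAt (hamiltonianField (fun δ => p₀ (𝒢.rCot δ))) (fun t => dilate a (c t)) t := by
  simp only [dilate_eq_cotPull]
  obtain ⟨h1, h2⟩ := mfderiv_cotPull_hamiltonianField (δ := c t) (p := fun δ => p₀ (𝒢.rCot δ))
    (ψ := id) (R := id) (h := fun _ => 0) ha.ne' contMDiffAt_id contMDiffAt_id
    (.of_forall fun _ => rfl) contMDiffAt_const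
    ((contMDiffAt_comp_rCot hp₀
      (dilate_eq_cotPull a (c t) ▸ dilate_mem_domCot ha.ne' hct)).mdifferentiableAt (by simp)) (by
      filter_upwards [𝒢.isOpen_domCot.mem_nhds hct] with δ hδ
      have h3 := congrArg (fun δ => p₀ (𝒢.rCot δ)) (dilate_eq_cotPull a δ)
      exact h3.symm.trans (hhom _ _ a hδ ha))
  exact hc.comp_of_mfderiv h1 h2

theorem IsBisection.exists_mulCot_eq_cotPull {b b' : M → G} {δ₂ : CotangentBundle E G}
    (hb : 𝒢.IsBisection b b' δ₂.proj) : ∃ f : M → ℝ,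
      ContMDiffAt 𝓘(ℝ, B) 𝓘(ℝ, ℝ) 3 f (𝒢.r δ₂.proj) ∧
      ∀ δ₁, 𝒢.sCot δ₁ = 𝒢.rCot δ₂ → 𝒢.mulCot δ₁ δ₂ =
        cotPull 1 (f ∘ 𝒢.s) (fun u _ => 𝒢.rightTransInv b' u) (𝒢.rightTrans b) δ₁ := by
  let l : E →L[ℝ] ℝ := cotForm δ₂
  let T : B →L[ℝ] E := mfderiv 𝓘(ℝ, B) 𝓘(ℝ, E) b (𝒢.r δ₂.proj)
  obtain ⟨f, hf, hfb⟩ := exists_differential_eq (𝒢.r δ₂.proj) (l.comp T)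
  exact ⟨f, hf, fun δ₁ h => hb.mulCot_eq_cotPull rfl h (hf.mdifferentiableAt (by simp)) hfb⟩

theorem rCot_mulCot {δ₁ δ₂ : CotangentBundle E G} (h : 𝒢.sCot δ₁ = 𝒢.rCot δ₂) :
    𝒢.rCot (𝒢.mulCot δ₁ δ₂) = 𝒢.rCot δ₁ := by
  obtain ⟨b, b', hb⟩ := 𝒢.exists_isBisection δ₂.proj
  obtain ⟨f, hf, hmul⟩ := hb.exists_mulCot_eq_cotPull
  have hs := (sCot_eq_rCot_iff.1 h).1
  rw [hmul _ h]
  refine rCot_cotPull_rightTrans ?_ ?_ ?_ ?_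
  · exact (eventually_of_s_eq hs hb.r_apply).self_of_nhds
  · exact (eventually_of_s_eq hs hb.apply_s).self_of_nhds
  · exact (hb.contMDiffAt_rightTransInv (hb.s_rightTrans hs)).mdifferentiableAt (by simp)
  · rw [hs]
    exact hf.mdifferentiableAt (by simp)

theorem mulCot_mem_domCot {δ₁ δ₂ : CotangentBundle E G} (h : 𝒢.sCot δ₁ = 𝒢.rCot δ₂)
    (h₁ : δ₁ ∈ 𝒢.domCot) : 𝒢.mulCot δ₁ δ₂ ∈ 𝒢.domCot :=
  mem_domCot_of_rCot_eq (rCot_mulCot h).symm h₁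

/-- Composability is needed at all times near `t`, not only at `t`: this makes the product curve
coincide locally with the image of `c` under one lifted translation. -/
theorem isTangentAt_mulCot (hp₀ : 𝒢.SmoothOffZero p₀)
    {c : ℝ → CotangentBundle E G} {t : ℝ} {δ₂ : CotangentBundle E G}
    (hc : IsTangentAt (hamiltonianField (fun δ => p₀ (𝒢.rCot δ))) c t) (hct : c t ∈ 𝒢.domCot)
    (h : ∀ᶠ t' in 𝓝 t, 𝒢.sCot (c t') = 𝒢.rCot δ₂) :
    IsTangentAt (hamiltonianField (fun δ => p₀ (𝒢.rCot δ))) (fun t => 𝒢.mulCot (c t) δ₂) t := by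
  obtain ⟨b, b', hb⟩ := 𝒢.exists_isBisection δ₂.proj
  obtain ⟨f, hf, hmul⟩ := hb.exists_mulCot_eq_cotPull
  have hs := (sCot_eq_rCot_iff.1 h.self_of_nhds).1
  have hψ := hb.contMDiffAt_rightTransInv (hb.s_rightTrans hs)
  have hR := hb.contMDiffAt_rightTrans hs
  have hπ : ContinuousAt (fun δ : CotangentBundle E G => δ.proj) (c t) :=
    (FiberBundle.continuous_proj _ _).continuousAt
  obtain ⟨h1, h2⟩ := mfderiv_cotPull_hamiltonianField (δ := c t) (p := fun δ => p₀ (𝒢.rCot δ))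
    (ψ := 𝒢.rightTransInv b') (R := 𝒢.rightTrans b) (h := f ∘ 𝒢.s) one_ne_zero hR hψ
    (hb.eventually_rightTransInv_rightTrans hs)
    (hf.comp_of_eq ((𝒢.s.contMDiff _).of_le (by norm_cast)) hs)
    ((contMDiffAt_comp_rCot hp₀ (by
      rw [← hmul _ h.self_of_nhds]
      exact mulCot_mem_domCot h.self_of_nhds hct)).mdifferentiableAt (by simp)) (by
      have h3 := (contMDiffAt_iff_contMDiffAt_nhds (by simp)).1 hψ
      have h4 := (contMDiffAt_iff_contMDiffAt_nhds (by simp)).1 hf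
      filter_upwards [hπ.eventually (eventually_of_s_eq hs hb.r_apply),
        hπ.eventually (eventually_of_s_eq hs hb.apply_s),
        hπ.eventually (hR.continuousAt.eventually h3),
        hπ.eventually (eventually_of_s_eq hs h4)] with δ h5 h6 h7 h8
      rw [one_mul, rCot_cotPull_rightTrans h5 h6 (h7.mdifferentiableAt (by simp))
        (h8.mdifferentiableAt (by simp))])
  exact (hc.comp_of_mfderiv h1 h2).congr (h.mono fun _ => hmul _)

end Symmetry

end LieGroupoid

/-! ### A locally uniform lifespan at the units. -/

theorem dilate_inv_dilate {E G : Type*} [NormedAddCommGroup E] [NormedSpace ℝ E]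
    [TopologicalSpace G] [ChartedSpace E G] [IsManifold 𝓘(ℝ, E) ∞ G] {a : ℝ} (ha : a ≠ 0)
    (δ : CotangentBundle E G) : dilate a⁻¹ (dilate a δ) = δ := by
  let l : E →L[ℝ] ℝ := cotForm δ
  exact cotMk_eq (ξ := a⁻¹ • a • l) (ξ' := l) rfl fun v => by rw [inv_smul_smul₀ ha]

theorem eq_cotMk {E G : Type*} [NormedAddCommGroup E] [NormedSpace ℝ E] [TopologicalSpace G]
    [ChartedSpace E G] [IsManifold 𝓘(ℝ, E) ∞ G] {δ : CotangentBundle E G} {γ : G} {ξ : E →L[ℝ] ℝ}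
    (h : δ.proj = γ) (hξ : ∀ v : E, (cotForm δ : E →L[ℝ] ℝ) v = ξ v) : δ = cotMk γ ξ := by
  obtain ⟨γ', ξ'⟩ := δ
  have e (l : E →L[ℝ] ℝ) (hl : ∀ v, l v = ξ v) :
      (cotMk γ' l : CotangentBundle E G) = cotMk γ ξ := cotMk_eq h hl
  exact e ξ' hξ

theorem extChartAt_dilate_snd {E G : Type*} [NormedAddCommGroup E] [NormedSpace ℝ E]
    [TopologicalSpace G] [ChartedSpace E G] [IsManifold 𝓘(ℝ, E) ∞ G] (δ₀ : CotangentBundle E G)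
    (a : ℝ) {δ : CotangentBundle E G} (h : δ.proj ∈ (chartAt E δ₀.proj).source) :
    (extChartAt (cotModel E) δ₀ (dilate a δ)).2 = a • (extChartAt (cotModel E) δ₀ δ).2 := by
  rw [cot_extChartAt_apply δ₀ δ h, cot_extChartAt_apply δ₀ (dilate a δ) h]
  rfl

namespace LieGroupoid

section Units

variable {E B G M : Type*}
  [NormedAddCommGroup E] [NormedSpace ℝ E] [NormedAddCommGroup B] [NormedSpace ℝ B]
  [TopologicalSpace G] [ChartedSpace E G] [TopologicalSpace M] [ChartedSpace B M]
  [IsManifold 𝓘(ℝ, B) ∞ M] {𝒢 : LieGroupoid E B G M}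

theorem mfderiv_s_mfderiv_unit (x : M) (b : B) :
    (mfderiv 𝓘(ℝ, E) 𝓘(ℝ, B) 𝒢.s (𝒢.unit x) (mfderiv 𝓘(ℝ, B) 𝓘(ℝ, E) 𝒢.unit x b) : B) = b := by
  obtain ⟨c, hc⟩ := exists_hasVelocity (I := 𝓘(ℝ, B)) x b
  exact ((hc.comp (𝒢.mdifferentiableAt_unit x)).comp (𝒢.mdifferentiableAt_s _)).unique hc
    (.of_forall fun t => 𝒢.s_unit _)

theorem cotForm_unitCot_mfderiv_unit (a : 𝒢.DualAlgebroid) (b : B) :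
    (cotForm (𝒢.unitCot a) : E →L[ℝ] ℝ) (mfderiv 𝓘(ℝ, B) 𝓘(ℝ, E) 𝒢.unit a.1 b) = 0 := by
  have h : (𝒢.unitProj a.1 (mfderiv 𝓘(ℝ, B) 𝓘(ℝ, E) 𝒢.unit a.1 b) : E) = 0 :=
    sub_eq_zero.2 (congrArg (mfderiv 𝓘(ℝ, B) 𝓘(ℝ, E) 𝒢.unit a.1 : B →L[ℝ] E)
      (mfderiv_s_mfderiv_unit a.1 b).symm)
  exact (cotForm_unitCot_of_mem a h (𝒢.algebroid a.1).zero_mem).trans (map_zero a.2)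

variable [IsManifold 𝓘(ℝ, E) ∞ G]

/-- Lets the condition of vanishing on the tangent space of `M`, which characterizes unit covectors,
be treated as a continuous condition in coordinates. -/
theorem exists_coordinates_mfderiv_unit (𝒢 : LieGroupoid E B G M) (x₀ : M) :
    ∃ C : M → B →L[ℝ] E, ContinuousAt C x₀ ∧
      (∀ b, C x₀ b = mfderiv 𝓘(ℝ, B) 𝓘(ℝ, E) 𝒢.unit x₀ b) ∧
      ∀ᶠ x in 𝓝 x₀, ∀ b, ∃ b' : B, C x b =
        mfderiv 𝓘(ℝ, E) 𝓘(ℝ, E) (extChartAt 𝓘(ℝ, E) (𝒢.unit x₀)) (𝒢.unit x)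
          (mfderiv 𝓘(ℝ, B) 𝓘(ℝ, E) 𝒢.unit x b') := by
  set φ := extChartAt 𝓘(ℝ, E) (𝒢.unit x₀)
  set ψ := extChartAt 𝓘(ℝ, B) x₀
  set F : B → E := fun y => φ (𝒢.unit (ψ.symm y)) with hF_def
  have hψ : ψ.symm (ψ x₀) = x₀ := extChartAt_to_inv (I := 𝓘(ℝ, B)) x₀
  have hF : ContDiffAt ℝ 3 F (ψ x₀) := by
    have h1 := contMDiffAt_extChartAt_symm_self (I := 𝓘(ℝ, B)) (n := 3)
      (mem_extChartAt_target (I := 𝓘(ℝ, B)) x₀)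
    have h2 := ((𝒢.unit.contMDiff x₀).of_le (m := 3) (by norm_cast)).comp_of_eq h1 hψ
    exact ((contMDiffAt_extChartAt (I := 𝓘(ℝ, E)) (x := 𝒢.unit x₀)).comp_of_eq h2
      (congrArg 𝒢.unit hψ)).contDiffAt
  have hψc := continuousAt_extChartAt (I := 𝓘(ℝ, B)) x₀
  have key (x : M) (b : B) (hx : x ∈ ψ.source) (hux : 𝒢.unit x ∈ φ.source)
      (hd : DifferentiableAt ℝ F (ψ x)) : fderiv ℝ F (ψ x) b =
        mfderiv 𝓘(ℝ, E) 𝓘(ℝ, E) φ (𝒢.unit x) (mfderiv 𝓘(ℝ, B) 𝓘(ℝ, E) 𝒢.unit x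
          (mfderiv 𝓘(ℝ, B) 𝓘(ℝ, B) ψ.symm (ψ x) b)) := by
    have h1 : HasVelocity 𝓘(ℝ, B) (fun t : ℝ => ψ x + t • b) (ψ x) b :=
      hasVelocity_iff_hasDerivAt.2 ⟨by simp,
        by simpa using ((hasDerivAt_id (0 : ℝ)).smul_const b).const_add (ψ x)⟩
    have h2 := (h1.comp (mdifferentiableAt_extChartAt_symm' (I := 𝓘(ℝ, B))
      (ψ.map_source hx))).congr_point (ψ.left_inv hx)
    have h3 := (h2.comp (𝒢.mdifferentiableAt_unit x)).comp
      (mdifferentiableAt_extChartAt (I := 𝓘(ℝ, E)) (x := 𝒢.unit x₀)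
        (by rwa [← extChartAt_source 𝓘(ℝ, E)]))
    have h4 := h1.comp (f := F) (I' := 𝓘(ℝ, E)) hd.mdifferentiableAt
    rw [mfderiv_eq_fderiv] at h4
    exact h4.unique h3 (.of_forall fun t => rfl)
  refine ⟨fun x => fderiv ℝ F (ψ x), ?_, fun b => ?_, ?_⟩
  · exact ((hF.fderiv_right (m := 2) (by norm_num)).continuousAt).comp hψc
  · refine (key x₀ b (mem_extChartAt_source x₀) (mem_extChartAt_source _)
      (hF.differentiableAt (by simp))).trans ?_
    have h5 := mfderiv_symm_comp_extChartAt (I := 𝓘(ℝ, B)) (mem_extChartAt_source x₀) b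
    rw [mfderiv_extChartAt_self] at h5
    rw [mfderiv_extChartAt_self]
    exact congrArg (mfderiv 𝓘(ℝ, B) 𝓘(ℝ, E) 𝒢.unit x₀ : B →L[ℝ] E) h5
  · filter_upwards [(isOpen_extChartAt_source (I := 𝓘(ℝ, B)) x₀).mem_nhds
        (mem_extChartAt_source x₀),
      𝒢.unit.contMDiff.continuous.continuousAt.eventually
        ((isOpen_extChartAt_source (I := 𝓘(ℝ, E)) (𝒢.unit x₀)).mem_nhds (mem_extChartAt_source _)),
      hψc.eventually (hF.eventually (by simp))] with x h1 h2 h3 b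
    exact ⟨_, key x b h1 h2 (h3.differentiableAt (by simp))⟩

variable [FiniteDimensional ℝ E] [FiniteDimensional ℝ B]

theorem cotMk_unit_mem_domCot_or (x : M) {ξ : E →L[ℝ] ℝ} (hξ : ξ ≠ 0) :
    (cotMk (𝒢.unit x) ξ : CotangentBundle E G) ∈ 𝒢.domCot ∨
      ∃ b : B, ξ (mfderiv 𝓘(ℝ, B) 𝓘(ℝ, E) 𝒢.unit x b) ≠ 0 := by
  by_contra! h
  obtain ⟨h1, h2⟩ := h
  refine hξ (ContinuousLinearMap.ext fun w => ?_)
  rw [domCot, mem_ofPred_eq, rCot_cotMk_unit, not_not] at h1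
  have h3 : ξ (𝒢.unitProj x w) = 0 := DFunLike.congr_fun h1 ⟨_, 𝒢.unitProj_mem x w⟩
  have h4 (u : E) (h : ξ u = 0) (hu : ξ (w - u) = 0) : ξ w = 0 := by
    rwa [map_sub, h, sub_zero] at hu
  exact h4 _ (h2 _) h3

/-- Compactness is applied to the whole unit sphere of coordinate covectors, with vanishing on the
tangent space of `M` as a side condition, so no separate sphere bundle in `A*G` is needed. Dilation
reduces to norm one. -/
theorem exists_hasCurveOn_unitCot {X : (δ : CotangentBundle E G) → TangentSpace (cotModel E) δ}
    (hX : ∀ δ ∈ 𝒢.domCot, ContMDiffAt (cotModel E) (cotModel E).tangent 1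
      (fun δ => (⟨δ, X δ⟩ : TangentBundle (cotModel E) (CotangentBundle E G))) δ)
    (hdil : ∀ a : ℝ, 0 < a → ∀ ε δ, HasCurveOn X 𝒢.domCot ε δ →
      HasCurveOn X 𝒢.domCot ε (dilate a δ))
    (x₀ : M) : ∃ ε > 0, ∀ᶠ x in 𝓝 x₀, ∀ a : 𝒢.DualAlgebroid, a.1 = x → a.2 ≠ 0 →
      HasCurveOn X 𝒢.domCot ε (𝒢.unitCot a) := by
  obtain ⟨C, hC, hC0, hCx⟩ := 𝒢.exists_coordinates_mfderiv_unit x₀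
  set φ := extChartAt 𝓘(ℝ, E) (𝒢.unit x₀)
  set δ₀ : CotangentBundle E G := cotMk (𝒢.unit x₀) 0 with hδ₀
  set e := extChartAt (cotModel E) δ₀ with he
  have htgt (y : E) (hy : y ∈ φ.target) (ζ : E →L[ℝ] ℝ) : (y, ζ) ∈ e.target := by
    rw [he, cot_extChartAt_target]
    exact ⟨hy, trivial⟩
  have hφ₀ : φ (𝒢.unit x₀) ∈ φ.target := mem_extChartAt_target _
  have hunit : ContinuousAt (fun x => φ (𝒢.unit x)) x₀ :=
    (continuousAt_extChartAt (I := 𝓘(ℝ, E)) (𝒢.unit x₀)).comp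
      𝒢.unit.contMDiff.continuous.continuousAt
  have hΘ0 (ζ : E →L[ℝ] ℝ) : e.symm (φ (𝒢.unit x₀), ζ) = cotMk (𝒢.unit x₀) ζ := by
    have hproj : (e.symm (φ (𝒢.unit x₀), ζ)).proj = 𝒢.unit x₀ :=
      (cot_extChartAt_symm_proj δ₀ (φ (𝒢.unit x₀), ζ) hφ₀).trans (extChartAt_to_inv _)
    have h1 (w : E) := cotForm_eq_chart δ₀ (δ := e.symm (φ (𝒢.unit x₀), ζ))
      (by rw [hproj]; exact mem_extChartAt_source _) w
    rw [e.right_inv (htgt _ hφ₀ ζ), hproj] at h1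
    refine eq_cotMk hproj fun w => (h1 w).trans ?_
    rw [hδ₀, mfderiv_extChartAt_self]
    rfl
  have hloc : ∀ ζ₀ ∈ Metric.sphere (0 : E →L[ℝ] ℝ) 1, ∃ ε > 0,
      ∀ᶠ q in 𝓝 (x₀, ζ₀), (∀ b, q.2 (C q.1 b) = 0) →
        HasCurveOn X 𝒢.domCot ε (e.symm (φ (𝒢.unit q.1), q.2)) := by
    intro ζ₀ hζ₀
    -- Either local existence applies at the covector, or it is nonzero on the tangent space of `M`;
    -- the latter persists nearby, so the side condition fails there and any time, here `1`, will
    -- do.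
    rcases 𝒢.cotMk_unit_mem_domCot_or x₀ (ne_zero_of_mem_unit_sphere ⟨ζ₀, hζ₀⟩) with h | ⟨b, hb⟩
    · obtain ⟨ε, hε, h1⟩ := eventually_hasCurveOn 𝒢.isOpen_domCot h (hX _ h)
      refine ⟨ε, hε, ?_⟩
      have h2 : ContinuousAt (fun q : M × (E →L[ℝ] ℝ) => e.symm (φ (𝒢.unit q.1), q.2)) (x₀, ζ₀) :=
        (continuousAt_extChartAt_symm'' (htgt _ hφ₀ ζ₀)).comp_of_eq
          ((hunit.comp_of_eq continuousAt_fst rfl).prodMk continuousAt_snd) rfl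
      exact (h2.eventually (p := HasCurveOn X 𝒢.domCot ε) 
        (by simpa only [hΘ0] using h1)).mono fun _ h _ => h
    · refine ⟨1, one_pos, ?_⟩
      have h2 : ContinuousAt (fun q : M × (E →L[ℝ] ℝ) => q.2 (C q.1 b)) (x₀, ζ₀) :=
        continuousAt_snd.clm_apply
          ((hC.comp_of_eq continuousAt_fst rfl).clm_apply continuousAt_const)
      rw [← hC0] at hb
      exact (h2.eventually_ne hb).mono fun q h1 h3 => absurd (h3 b) h1
  have hsphere : ∃ ε > 0, ∀ᶠ x in 𝓝 x₀, ∀ ζ ∈ Metric.sphere (0 : E →L[ℝ] ℝ) 1,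
      (∀ b, ζ (C x b) = 0) → HasCurveOn X 𝒢.domCot ε (e.symm (φ (𝒢.unit x), ζ)) := by
    refine (isCompact_sphere (0 : E →L[ℝ] ℝ) 1).induction_on
      (p := fun S => ∃ ε > 0, ∀ᶠ x in 𝓝 x₀, ∀ ζ ∈ S,
        (∀ b, ζ (C x b) = 0) → HasCurveOn X 𝒢.domCot ε (e.symm (φ (𝒢.unit x), ζ))) ?_ ?_ ?_ ?_
    · exact ⟨1, one_pos, .of_forall fun x ζ h => h.elim⟩
    · rintro S T hST ⟨ε, hε, h⟩
      exact ⟨ε, hε, h.mono fun x hx ζ hζ => hx ζ (hST hζ)⟩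
    · rintro S T ⟨ε, hε, h⟩ ⟨ε', hε', h'⟩
      refine ⟨min ε ε', lt_min hε hε', ?_⟩
      filter_upwards [h, h'] with x h1 h2 ζ hζ hb
      rcases hζ with hζ | hζ
      · exact (h1 ζ hζ hb).mono (min_le_left _ _)
      · exact (h2 ζ hζ hb).mono (min_le_right _ _)
    · intro ζ hζ
      obtain ⟨ε, hε, h⟩ := hloc ζ hζ
      rw [nhds_prod_eq] at h
      obtain ⟨pa, hpa, pb, hpb, h2⟩ := Filter.eventually_prod_iff.1 h
      exact ⟨{ζ | pb ζ}, mem_nhdsWithin_of_mem_nhds hpb, ε, hε, hpa.mono fun x hx ζ hζ => h2 hx hζ⟩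
  obtain ⟨ε, hε, h⟩ := hsphere
  refine ⟨ε, hε, ?_⟩
  filter_upwards [h, hCx, 𝒢.unit.contMDiff.continuous.continuousAt.eventually
    ((chartAt E (𝒢.unit x₀)).open_source.mem_nhds (mem_chart_source E (𝒢.unit x₀)))]
    with x h1 h2 h3 a ha ha0
  subst ha
  set δ := 𝒢.unitCot a with hδ
  have hδe : δ ∈ e.source := by
    rw [he, cot_extChartAt_source]
    exact h3
  have hφδ : δ.proj ∈ (extChartAt 𝓘(ℝ, E) δ₀.proj).source := by rwa [extChartAt_source]
  have hζ0 : (e δ).2 ≠ 0 := by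
    intro h0
    obtain ⟨v, -, hv⟩ := mem_domCot_iff.1 (𝒢.unitCot_mem_domCot ha0)
    refine hv ((cotForm_eq_chart δ₀ hφδ _).trans ?_)
    exact DFunLike.congr_fun h0 _
  -- Normalize the fibre coordinate, use the curve found on the sphere, and dilate back by the norm;
  -- the lifespan does not change.
  have hn : 0 < ‖(e δ).2‖⁻¹ := inv_pos.2 (norm_pos_iff.2 hζ0)
  have h4 := h1 (‖(e δ).2‖⁻¹ • (e δ).2) (by
    rw [mem_sphere_zero_iff_norm, norm_smul, norm_inv, norm_norm,
      inv_mul_cancel₀ (norm_ne_zero_iff.2 hζ0)]) fun b => by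
    obtain ⟨b', hb'⟩ := h2 b
    have h5 : (e δ).2 (C a.1 b) = 0 := by
      rw [hb']
      exact (cotForm_eq_chart δ₀ hφδ _).symm.trans (cotForm_unitCot_mfderiv_unit a b')
    rw [smul_apply, h5, smul_zero]
  have h6 : e.symm (φ (𝒢.unit a.1), ‖(e δ).2‖⁻¹ • (e δ).2) = dilate ‖(e δ).2‖⁻¹ δ := by
    rw [← extChartAt_dilate_snd δ₀ _ (δ := δ) h3]
    have h7 : (φ (𝒢.unit a.1), (e (dilate ‖(e δ).2‖⁻¹ δ)).2) = e (dilate ‖(e δ).2‖⁻¹ δ) :=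
      Prod.ext (congrArg Prod.fst (cot_extChartAt_apply δ₀ (dilate ‖(e δ).2‖⁻¹ δ) h3)).symm rfl
    refine (congrArg e.symm h7).trans (e.left_inv ?_)
    rw [he, cot_extChartAt_source]
    exact h3
  rw [h6] at h4
  have h8 := hdil _ (inv_pos.2 hn) _ _ h4
  rwa [dilate_inv_dilate hn.ne'] at h8

end Units

end LieGroupoid

/-! ### Uniform lifespan and proof of the theorem. -/

theorem IsCompleteFlow.isTangentAt {F H N : Type*} [NormedAddCommGroup F] [NormedSpace ℝ F]
    [TopologicalSpace H] {I : ModelWithCorners ℝ F H} [TopologicalSpace N] [ChartedSpace H N]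
    {X : (y : N) → TangentSpace I y} {U : Set N} {χ : ℝ → N → N} (h : IsCompleteFlow X U χ) {y : N}
    (hy : y ∈ U) (t : ℝ) : IsTangentAt X (fun t => χ t y) t :=
  h.integralCurve y hy t

theorem IsCompleteFlow.eq_of_isTangentAt {F H N : Type*} [NormedAddCommGroup F] [NormedSpace ℝ F]
    [TopologicalSpace H] {I : ModelWithCorners ℝ F H} [TopologicalSpace N] [ChartedSpace H N]
    {X : (y : N) → TangentSpace I y} {U : Set N} {χ : ℝ → N → N} (h : IsCompleteFlow X U χ)
    {c : ℝ → N} (hc : ∀ t, IsTangentAt X c t) (hcU : ∀ t, c t ∈ U) (t : ℝ) : c t = χ t (c 0) :=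
  h.unique (c 0) (hcU 0) univ c isOpen_univ ordConnected_univ (mem_univ _)
    ((isMIntegralCurveOn_iff_isTangentAt isOpen_univ).2 fun t _ => hc t) (fun t _ => hcU t) rfl t
    (mem_univ t)

namespace LieGroupoid

section CompleteFlow

variable {E B G M : Type*}
  [NormedAddCommGroup E] [NormedSpace ℝ E] [NormedAddCommGroup B] [NormedSpace ℝ B]
  [TopologicalSpace G] [ChartedSpace E G] [TopologicalSpace M] [ChartedSpace B M]
  [IsManifold 𝓘(ℝ, E) ∞ G] [IsManifold 𝓘(ℝ, B) ∞ M] [FiniteDimensional ℝ E] [FiniteDimensional ℝ B]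
  {𝒢 : LieGroupoid E B G M} {p₀ : 𝒢.DualAlgebroid → ℝ}

theorem hasCurveOn_dilate (hp₀ : 𝒢.SmoothOffZero p₀) (hhom : 𝒢.HomogeneousOffZero p₀)
    {a : ℝ} (ha : 0 < a) {ε : ℝ} {δ : CotangentBundle E G}
    (h : HasCurveOn (hamiltonianField (fun δ => p₀ (𝒢.rCot δ))) 𝒢.domCot ε δ) :
    HasCurveOn (hamiltonianField (fun δ => p₀ (𝒢.rCot δ))) 𝒢.domCot ε (dilate a δ) := by
  obtain ⟨c, h0, hc⟩ := h
  exact ⟨fun t => dilate a (c t), congrArg _ h0, fun t ht =>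
    ⟨isTangentAt_dilate hp₀ hhom ha (hc t ht).1 (hc t ht).2, dilate_mem_domCot ha.ne' (hc t ht).2⟩⟩

theorem exists_forall_hasCurveOn_unitCot [CompactSpace M] (hp₀ : 𝒢.SmoothOffZero p₀)
    (hhom : 𝒢.HomogeneousOffZero p₀) : ∃ ε > 0, ∀ a : 𝒢.DualAlgebroid, a.2 ≠ 0 →
      HasCurveOn (hamiltonianField (fun δ => p₀ (𝒢.rCot δ))) 𝒢.domCot ε (𝒢.unitCot a) := by
  have h : ∃ ε > 0, ∀ x ∈ (univ : Set M), ∀ a : 𝒢.DualAlgebroid, a.1 = x → a.2 ≠ 0 →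
      HasCurveOn (hamiltonianField (fun δ => p₀ (𝒢.rCot δ))) 𝒢.domCot ε (𝒢.unitCot a) := by
    refine isCompact_univ.induction_on
      (p := fun S => ∃ ε > 0, ∀ x ∈ S, ∀ a : 𝒢.DualAlgebroid, a.1 = x → a.2 ≠ 0 →
        HasCurveOn (hamiltonianField (fun δ => p₀ (𝒢.rCot δ))) 𝒢.domCot ε (𝒢.unitCot a)) ?_ ?_ ?_ ?_
    · exact ⟨1, one_pos, fun x h => h.elim⟩
    · rintro S T hST ⟨ε, hε, h⟩
      exact ⟨ε, hε, fun x hx => h x (hST hx)⟩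
    · rintro S T ⟨ε, hε, h⟩ ⟨ε', hε', h'⟩
      refine ⟨min ε ε', lt_min hε hε', fun x hx a ha ha0 => ?_⟩
      rcases hx with hx | hx
      · exact (h x hx a ha ha0).mono (min_le_left _ _)
      · exact (h' x hx a ha ha0).mono (min_le_right _ _)
    · intro x₀ _
      obtain ⟨ε, hε, h⟩ := exists_hasCurveOn_unitCot
        (fun δ hδ => contMDiffAt_hamiltonianField (contMDiffAt_comp_rCot hp₀ hδ))
        (fun a ha ε δ => hasCurveOn_dilate hp₀ hhom ha) x₀
      exact ⟨_, mem_nhdsWithin_of_mem_nhds h, ε, hε, fun x hx => hx⟩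
  obtain ⟨ε, hε, h⟩ := h
  exact ⟨ε, hε, fun a => h a.1 (mem_univ _) a rfl⟩

variable [T2Space M]

/-- Conservation of `sCot` keeps the whole curve composable with `δ₂`, so the product curve exists
for the same time. This spreads the lifespan from the units to their right translates. -/
theorem hasCurveOn_mulCot (hp₀ : 𝒢.SmoothOffZero p₀) {ε : ℝ} (hε : 0 < ε)
    {δ₁ δ₂ : CotangentBundle E G} (h : 𝒢.sCot δ₁ = 𝒢.rCot δ₂)
    (h₁ : HasCurveOn (hamiltonianField (fun δ => p₀ (𝒢.rCot δ))) 𝒢.domCot ε δ₁) :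
    HasCurveOn (hamiltonianField (fun δ => p₀ (𝒢.rCot δ))) 𝒢.domCot ε (𝒢.mulCot δ₁ δ₂) := by
  obtain ⟨c, rfl, hc⟩ := h₁
  have hs : ∀ t ∈ Ioo (-ε) ε, 𝒢.sCot (c t) = 𝒢.rCot δ₂ := fun t ht =>
    (sCot_eq_of_isTangentAt (fun δ hδ => (contMDiffAt_comp_rCot hp₀ hδ).mdifferentiableAt (by simp))
      isOpen_Ioo ordConnected_Ioo hc ht ⟨by linarith, hε⟩).trans h
  refine ⟨fun t => 𝒢.mulCot (c t) δ₂, rfl, fun t ht =>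
    ⟨isTangentAt_mulCot hp₀ (hc t ht).1 (hc t ht).2 ?_, mulCot_mem_domCot (hs t ht) (hc t ht).2⟩⟩
  filter_upwards [isOpen_Ioo.mem_nhds ht] with t' ht'
  exact hs t' ht'

end CompleteFlow

end LieGroupoid

end

theorem mainTheorem8 {E B G M : Type*}
    [NormedAddCommGroup E] [NormedSpace ℝ E] [FiniteDimensional ℝ E]
    [NormedAddCommGroup B] [NormedSpace ℝ B] [FiniteDimensional ℝ B]
    [TopologicalSpace G] [T2Space G] [ChartedSpace E G] [IsManifold 𝓘(ℝ, E) ∞ G]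
    [TopologicalSpace M] [T2Space M] [CompactSpace M]
    [ChartedSpace B M] [IsManifold 𝓘(ℝ, B) ∞ M]
    (𝒢 : LieGroupoid E B G M) (p₀ : 𝒢.DualAlgebroid → ℝ)
    (hp₀ : 𝒢.SmoothOffZero p₀) (hhom : 𝒢.HomogeneousOffZero p₀) :
    ∃ χ : ℝ → CotangentBundle E G → CotangentBundle E G,
      IsCompleteFlow (hamiltonianField (fun δ => p₀ (𝒢.rCot δ))) 𝒢.domCot χ ∧
      (∀ a : ℝ, 0 < a → ∀ t : ℝ, ∀ δ ∈ 𝒢.domCot, dilate a (χ t δ) = χ t (dilate a δ)) ∧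
      (∀ t : ℝ, ∀ a : 𝒢.DualAlgebroid, a.2 ≠ 0 → 𝒢.sCot (χ t (𝒢.unitCot a)) = a) ∧
      (∀ t : ℝ, ∀ δ ∈ 𝒢.domCot, 𝒢.sCot (χ t δ) = 𝒢.sCot δ) ∧
      (∀ t : ℝ, ∀ δ₁ ∈ 𝒢.domCot, ∀ δ₂ : CotangentBundle E G, 𝒢.sCot δ₁ = 𝒢.rCot δ₂ →
        𝒢.mulCot δ₁ δ₂ ∈ 𝒢.domCot ∧ χ t (𝒢.mulCot δ₁ δ₂) = 𝒢.mulCot (χ t δ₁) δ₂) ∧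
      (∀ (J : Set ℝ) (c : ℝ → CotangentBundle E G), IsOpen J → J.OrdConnected →
        IsMIntegralCurveOn c (hamiltonianField (fun δ => p₀ (𝒢.rCot δ))) J →
        MapsTo c J 𝒢.domCot → ∀ t ∈ J, ∀ t' ∈ J, 𝒢.sCot (c t) = 𝒢.sCot (c t')) := by
  have : T2Space (CotangentBundle E G) := FiberBundle.t2Space_totalSpace _
  have hp : ∀ δ ∈ 𝒢.domCot, MDifferentiableAt (cotModel E) 𝓘(ℝ, ℝ) (fun δ => p₀ (𝒢.rCot δ)) δ :=
    fun δ hδ => (LieGroupoid.contMDiffAt_comp_rCot hp₀ hδ).mdifferentiableAt (by simp)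
  obtain ⟨ε, hε, hunit⟩ := LieGroupoid.exists_forall_hasCurveOn_unitCot hp₀ hhom
  obtain ⟨χ, hχ⟩ := exists_isCompleteFlow hε
    (fun δ hδ => contMDiffAt_hamiltonianField (LieGroupoid.contMDiffAt_comp_rCot hp₀ hδ))
    fun δ hδ => by
      -- Every `δ` is the right translate by itself of the unit at `rCot δ`, so the lifespan `ε` of
      -- the units serves all of the domain, which need not be compact modulo dilations.
      have h1 := LieGroupoid.hasCurveOn_mulCot hp₀ hε (LieGroupoid.sCot_unitCot (𝒢.rCot δ))
        (hunit (𝒢.rCot δ) hδ)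
      rwa [LieGroupoid.mulCot_unitCot] at h1
  have hs : ∀ t, ∀ δ ∈ 𝒢.domCot, 𝒢.sCot (χ t δ) = 𝒢.sCot δ := fun t δ hδ => by
    have h1 := LieGroupoid.sCot_eq_of_isTangentAt hp isOpen_univ ordConnected_univ
      (c := fun t => χ t δ) (fun t _ => ⟨hχ.isTangentAt hδ t, hχ.mem δ hδ t⟩) (mem_univ t)
      (mem_univ 0)
    rwa [hχ.zero δ hδ] at h1
  refine ⟨χ, hχ, fun a ha t δ hδ => ?_, fun t a ha => ?_, hs, fun t δ₁ h₁ δ₂ h => ?_,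
    fun J c hJ hJ' hc hcU t ht t' ht' => ?_⟩
  · have h1 := hχ.eq_of_isTangentAt (c := fun t => dilate a (χ t δ))
      (fun t => LieGroupoid.isTangentAt_dilate hp₀ hhom ha (hχ.isTangentAt hδ t) (hχ.mem δ hδ t))
      (fun t => LieGroupoid.dilate_mem_domCot ha.ne' (hχ.mem δ hδ t)) t
    rwa [hχ.zero δ hδ] at h1
  · rw [hs t _ (LieGroupoid.unitCot_mem_domCot ha), LieGroupoid.sCot_unitCot]
  · have h0 (t) : 𝒢.sCot (χ t δ₁) = 𝒢.rCot δ₂ := (hs t δ₁ h₁).trans h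
    have h1 := hχ.eq_of_isTangentAt (c := fun t => 𝒢.mulCot (χ t δ₁) δ₂)
      (fun t => LieGroupoid.isTangentAt_mulCot hp₀ (hχ.isTangentAt h₁ t) (hχ.mem δ₁ h₁ t)
        (.of_forall h0))
      (fun t => LieGroupoid.mulCot_mem_domCot (h0 t) (hχ.mem δ₁ h₁ t)) t
    rw [hχ.zero δ₁ h₁] at h1
    exact ⟨LieGroupoid.mulCot_mem_domCot h h₁, h1.symm⟩
  · exact LieGroupoid.sCot_eq_of_isTangentAt hp hJ hJ'
      (fun t ht => ⟨(isMIntegralCurveOn_iff_isTangentAt hJ).1 hc t ht, hcU ht⟩) ht ht'
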